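/- Let $L,T>0$ and let $\mu,\sigma:(0,L)\to\mathbb R$ be continuous with $\sigma>0$. Put $\mathcal A=\mu\,\partial_x+\tfrac12\sigma^2\partial_x^2$, with scale density $\mathfrak s(x)=\exp\big(-\int_c^x 2\mu/\sigma^2\big)$ and speed density $\mathfrak m(x)=\tfrac{2}{\sigma^2(x)}\exp\big(\int_c^x 2\mu/\sigma^2\big)$, $c\in(0,L)$. With $I_0=\int_0^c\big(\int_0^z\mathfrak s\big)\mathfrak m(z)\,dz$ and $J_0=\int_0^c\big(\int_z^c\mathfrak s\big)\mathfrak m(z)\,dz$, the endpoint $0$ is called regular if $I_0,J_0<\infty$, exit if $I_0<\infty=J_0$, and natural if $I_0=J_0=\infty$ (finiteness does not depend on $c$). Assume that $0$ is regular, exit or natural, and that $L$ is regular, i.e. $\int_c^L\big(\int_z^L\mathfrak s\big)\mathfrak m(z)\,dz<\infty$ and $\int_c^L\big(\int_c^z\mathfrak s\big)\mathfrak m(z)\,dz<\infty$. Call $0$ accessible if it is regular or exit. Let $g:[0,L]\to\mathbb R$ be $C^2$ on $(0,L)$, and let $u$, continuous on $[0,T]\times[0,L]$ and $C^{1,2}$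 on $(0,T)\times(0,L)$, be a classical solution of $$(\partial_t+\mathcal A-x)u=0,\quad u(T,x)=g(x),\quad u(t,L)=e^{-L(T-t)}g(L),\quad u(t,0)=g(0)\ \text{ if } 0 \text{ is accessible}.$$ Let $f\in C^2((0,L))$ satisfy $\tfrac12\sigma^2(f')^2-\mathcal Af-x=0$ on $(0,L)$, and let $f$ be continuous (with finite values) on $(0,L]$, and on $[0,L]$ if $0$ is accessible. Put $\tilde{\mathcal A}=(\mu-\sigma^2f')\partial_x+\tfrac12\sigma^2\partial_x^2$. Let $\tilde\Gamma(t,x;s,y)\ge 0$ ($0\le t<s\le T$, $x\in[0,L]$, $y\in(0,L)$) be a fundamental solution of $\partial_t+\tilde{\mathcal A}$ with Dirichlet conditions at the accessible endpoints, that is: for fixed $(s,y)$ it is continuous on $[0,s)\times[0,L]$, is $C^{1,2}$ on $(0,s)\times(0,L)$, satisfies $(\partial_t+\tilde{\mathcal A})\tilde\Gamma=0$ there, and vanishes at $x=L$ and, if $0$ is accessible, at $x=0$; it is locally integrable in $y\in(0,L)$; and $\tilde\Gamma(s,\cdot\,;s,y)=\delta_y$ in the sense that, for every continuous $\varphi$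 with compact support in $(0,L)$, the function equal to $\int_0^L\tilde\Gamma(t,x;s,y)\varphi(y)\,dy$ for $t<s$ and to $\varphi(x)$ for $t=s$ is continuous on $[0,s]\times[0,L]$, is $C^{1,2}$ on $(0,s)\times(0,L)$, satisfies $(\partial_t+\tilde{\mathcal A})v=0$ there, and satisfies the same Dirichlet conditions. Then for every $t\in[0,T]$ and every $x\in(0,L]$ (and also $x=0$ if $0$ is accessible) for which the double integral below converges absolutely, $$u(t,x)=e^{-x(T-t)}g(x)+e^{-f(x)}\int_t^T\!\!\int_0^L\tilde\Gamma(t,x;s,\xi)\,(\partial_s+\tilde{\mathcal A})\big[e^{-\xi(T-s)+f(\xi)}g(\xi)\big]\,d\xi\,ds .$$ -/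

import Mathlib

open Set MeasureTheory

noncomputable section

namespace ShortRate

/-- The differential operator `b(x) ∂ₓ + ½ σ(x)² ∂ₓ²`. -/
def generator (b σ : ℝ → ℝ) (φ : ℝ → ℝ) (x : ℝ) : ℝ :=
  b x * deriv φ x + 1 / 2 * σ x ^ 2 * deriv (deriv φ) x

/-- Scale density (normalised at `c`) of the diffusion with drift `b` and volatility `σ`. -/
def scaleDensity (b σ : ℝ → ℝ) (c x : ℝ) : ℝ :=
  Real.exp (-∫ y in c..x, 2 * b y / σ y ^ 2)

/-- Speed density (normalised at `c`) of the diffusion with drift `b` and volatility `σ`. -/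
def speedDensity (b σ : ℝ → ℝ) (c x : ℝ) : ℝ :=
  2 / σ x ^ 2 * Real.exp (∫ y in c..x, 2 * b y / σ y ^ 2)

/-- Scale measure of the interval with endpoints `x ≤ y` (possibly infinite). -/
def scaleMeasure (b σ : ℝ → ℝ) (c x y : ℝ) : ENNReal :=
  ∫⁻ z in Ioo x y, ENNReal.ofReal (scaleDensity b σ c z)

/-- `∫₀ᶜ S(0,z] m(z) dz`. -/
def fellerI0 (b σ : ℝ → ℝ) (c : ℝ) : ENNReal :=
  ∫⁻ z in Ioo 0 c, scaleMeasure b σ c 0 z * ENNReal.ofReal (speedDensity b σ c z)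

/-- `∫₀ᶜ S[z,c] m(z) dz`. -/
def fellerJ0 (b σ : ℝ → ℝ) (c : ℝ) : ENNReal :=
  ∫⁻ z in Ioo 0 c, scaleMeasure b σ c z c * ENNReal.ofReal (speedDensity b σ c z)

/-- `∫_c^L S[z,L) m(z) dz`. -/
def fellerIL (b σ : ℝ → ℝ) (c L : ℝ) : ENNReal :=
  ∫⁻ z in Ioo c L, scaleMeasure b σ c z L * ENNReal.ofReal (speedDensity b σ c z)

/-- `∫_c^L S[c,z] m(z) dz`. -/
def fellerJL (b σ : ℝ → ℝ) (c L : ℝ) : ENNReal :=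
  ∫⁻ z in Ioo c L, scaleMeasure b σ c c z * ENNReal.ofReal (speedDensity b σ c z)

/-! Feller's boundary classification for the diffusion on `(0, L)`. Finiteness of the integrals does
not depend on the interior reference point, which is taken to be the midpoint. -/

def ZeroIsRegular (b σ : ℝ → ℝ) (L : ℝ) : Prop :=
  fellerI0 b σ (L / 2) < ⊤ ∧ fellerJ0 b σ (L / 2) < ⊤

def ZeroIsExit (b σ : ℝ → ℝ) (L : ℝ) : Prop :=
  fellerI0 b σ (L / 2) < ⊤ ∧ fellerJ0 b σ (L / 2) = ⊤

def ZeroIsNatural (b σ : ℝ → ℝ) (L : ℝ) : Prop :=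
  fellerI0 b σ (L / 2) = ⊤ ∧ fellerJ0 b σ (L / 2) = ⊤

def RightIsRegular (b σ : ℝ → ℝ) (L : ℝ) : Prop :=
  fellerIL b σ (L / 2) L < ⊤ ∧ fellerJL b σ (L / 2) L < ⊤

/-- `v` is of class `C^{1,2}` on `(0,S) × (0,L)` (first argument: time) and satisfies
`∂ₜ v + b ∂ₓ v + ½ σ² ∂ₓ² v - k v = 0` there. -/
structure SolvesBackwardPDE (L S : ℝ) (b σ k : ℝ → ℝ) (v : ℝ → ℝ → ℝ) : Prop where
  diff_time : ∀ t ∈ Ioo 0 S, ∀ x ∈ Ioo 0 L, DifferentiableAt ℝ (fun r => v r x) t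
  diff_space : ∀ t ∈ Ioo 0 S, ∀ x ∈ Ioo 0 L, DifferentiableAt ℝ (v t) x
  diff_space_two : ∀ t ∈ Ioo 0 S, ∀ x ∈ Ioo 0 L, DifferentiableAt ℝ (deriv (v t)) x
  cont_time :
    ContinuousOn (fun p : ℝ × ℝ => deriv (fun r => v r p.2) p.1) (Ioo 0 S ×ˢ Ioo 0 L)
  cont_space :
    ContinuousOn (fun p : ℝ × ℝ => deriv (v p.1) p.2) (Ioo 0 S ×ˢ Ioo 0 L)
  cont_space_two :
    ContinuousOn (fun p : ℝ × ℝ => deriv (deriv (v p.1)) p.2) (Ioo 0 S ×ˢ Ioo 0 L)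
  pde : ∀ t ∈ Ioo 0 S, ∀ x ∈ Ioo 0 L,
    deriv (fun r => v r x) t + generator b σ (v t) x - k x * v t x = 0

/-- `v` is a classical solution on `[0,S] × [0,L]` of the terminal-boundary value problem
`(∂ₜ + b ∂ₓ + ½ σ² ∂ₓ² - k) v = 0`, `v(S,·) = φ`, `v(·,L) = βL`, and, if `acc` holds,
`v(·,0) = β0`. -/
structure IsClassicalSolution (acc : Prop) (L S : ℝ) (b σ k φ β0 βL : ℝ → ℝ)
    (v : ℝ → ℝ → ℝ) : Prop where
  continuousOn : ContinuousOn (fun p : ℝ × ℝ => v p.1 p.2) (Icc 0 S ×ˢ Icc 0 L)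
  solves : SolvesBackwardPDE L S b σ k v
  terminal : ∀ x ∈ Icc 0 L, v S x = φ x
  bc_zero : acc → ∀ t ∈ Icc 0 S, v t 0 = β0 t
  bc_right : ∀ t ∈ Icc 0 S, v t L = βL t

/-- The pricing Cauchy problem for a payoff `g` at maturity `T`, with discounting at rate `x`. -/
def SolvesPricingProblem (L T : ℝ) (μ σ g : ℝ → ℝ) (u : ℝ → ℝ → ℝ) : Prop :=
  IsClassicalSolution (ZeroIsRegular μ σ L ∨ ZeroIsExit μ σ L) L T μ σ (fun x => x) g
    (fun _ => g 0) (fun t => Real.exp (-L * (T - t)) * g L) u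

/-- `Γ t x s y` is a fundamental solution of `∂ₜ + b ∂ₓ + ½ σ² ∂ₓ²` on `(0,L)` for terminal times
`s ∈ (0,T]`, with a Dirichlet condition at `L` and, if `acc` holds, at `0`.
For fixed `(s,y)` it is a nonnegative classical solution for `t < s`. The terminal condition
`Γ(s,·;s,y) = δ_y` has the usual meaning: for every continuous `φ` with compact support in
`(0,L)`, the function `∫ Γ(t,x;s,y) φ(y) dy` is the classical solution with terminal value `φ`
at time `s`. -/
structure IsFundamentalSolution (acc : Prop) (L T : ℝ) (b σ : ℝ → ℝ)
    (Γ : ℝ → ℝ → ℝ → ℝ → ℝ) : Prop where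
  nonneg : ∀ s ∈ Ioc 0 T, ∀ t ∈ Ico 0 s, ∀ x ∈ Icc 0 L, ∀ y ∈ Ioo 0 L, 0 ≤ Γ t x s y
  continuousOn : ∀ s ∈ Ioc 0 T, ∀ y ∈ Ioo 0 L,
    ContinuousOn (fun p : ℝ × ℝ => Γ p.1 p.2 s y) (Ico 0 s ×ˢ Icc 0 L)
  solves : ∀ s ∈ Ioc 0 T, ∀ y ∈ Ioo 0 L,
    SolvesBackwardPDE L s b σ (fun _ => 0) (fun t x => Γ t x s y)
  bc_zero : acc → ∀ s ∈ Ioc 0 T, ∀ y ∈ Ioo 0 L, ∀ t ∈ Ico 0 s, Γ t 0 s y = 0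
  bc_right : ∀ s ∈ Ioc 0 T, ∀ y ∈ Ioo 0 L, ∀ t ∈ Ico 0 s, Γ t L s y = 0
  locallyIntegrable : ∀ s ∈ Ioc 0 T, ∀ t ∈ Ico 0 s, ∀ x ∈ Icc 0 L,
    LocallyIntegrableOn (fun y => Γ t x s y) (Ioo 0 L)
  terminal : ∀ s ∈ Ioc 0 T, ∀ φ : ℝ → ℝ, Continuous φ → HasCompactSupport φ →
    tsupport φ ⊆ Ioo 0 L →
    IsClassicalSolution acc L s b σ (fun _ => 0) φ (fun _ => 0) (fun _ => 0)
      (fun t x => if t < s then ∫ y in 0..L, Γ t x s y * φ y else φ x)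

/-- The drift `μ - σ² f'`. -/
def tiltedDrift (μ σ f : ℝ → ℝ) (x : ℝ) : ℝ := μ x - σ x ^ 2 * deriv f x

/-- `(∂ₛ + Ã) [e^{-ξ(T-s) + f(ξ)} g(ξ)]`, where `Ã = (μ - σ² f') ∂ₓ + ½ σ² ∂ₓ²`. -/
def source (T : ℝ) (μ σ f g : ℝ → ℝ) (s ξ : ℝ) : ℝ :=
  deriv (fun r => Real.exp (-ξ * (T - r) + f ξ) * g ξ) s +
    generator (tiltedDrift μ σ f) σ (fun y => Real.exp (-y * (T - s) + f y) * g y) ξ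

end ShortRate

end

/-! The ODE for `f` says that `e^{-f}` solves the equation with killing rate `x`, so that
`w = e^f (u - e^{-x(T-t)} g)` solves `(∂ₜ + Ã) w = -(∂ₛ + Ã) [e^{-ξ(T-s) + f} g]`, without killing
and with zero terminal and Dirichlet data. Duhamel's formula for `Γ` then gives `w`. There are three
obstacles.

* At a natural endpoint no boundary value is prescribed for `u` or `Γ`. Uniqueness comes from a
  Lyapunov function: some `V ≥ 1` with `Ã V ≤ V` for which `V e^{-f} → ∞` at `0`, so that
  `w = o(V)`. It is built from Feller's double integrals, `I₀ = ∞` serving the case of bounded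
  `e^{-f}` and `J₀ = ∞` the case `e^{-f} → ∞`.
* The source is unbounded. A comparison from one side needs only a source that dominates from that
  side, so only the negative part is cut off; dominated convergence then removes the cut-off.
* `Γ` is tested against functions of `x` only, with no regularity in `s`. Sources with compact
  support are approximated by sums of `e^{-k s} φₖ(x)`. By homogeneity in time, the Duhamel integral
  of such a term is an integral in time of the single solution with terminal value `φₖ`.
-/

noncomputable section

open Filter Topology Asymptotics

namespace ShortRate

/-! ### The parabolic minimum principle -/

/-- At the point `(t, x)` the function `q` has a time derivative and two space derivatives, and
`∂ₜ q + b ∂ₓ q + ½ σ² ∂ₓ² q = ℓ` there. The derivatives are witnesses rather than values of `deriv`,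
so that the differentiability is part of the statement. -/
def HasParabolicAt (b σ : ℝ → ℝ) (q : ℝ → ℝ → ℝ) (t x ℓ : ℝ) : Prop :=
  ∃ (qt : ℝ) (D : ℝ → ℝ) (d : ℝ), HasDerivAt (fun r => q r x) qt t ∧
    (∀ᶠ y in 𝓝 x, HasDerivAt (q t) (D y) y) ∧ HasDerivAt D d x ∧
    ℓ = qt + (b x * D x + 1 / 2 * σ x ^ 2 * d)

/-- `φ` is twice differentiable at `x` and `b φ' + ½ σ² φ'' = ℓ` there: the time-independent
analogue of `HasParabolicAt`. -/
def HasGeneratorAt (b σ φ : ℝ → ℝ) (x ℓ : ℝ) : Prop :=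
  ∃ (D : ℝ → ℝ) (d : ℝ), (∀ᶠ y in 𝓝 x, HasDerivAt φ (D y) y) ∧ HasDerivAt D d x ∧
    ℓ = b x * D x + 1 / 2 * σ x ^ 2 * d

theorem second_deriv_nonneg_of_isLocalMin {φ D : ℝ → ℝ} {x d : ℝ}
    (hφ : ∀ᶠ y in 𝓝 x, HasDerivAt φ (D y) y) (hD : HasDerivAt D d x) (hmin : IsLocalMin φ x) :
    0 ≤ d := by
  by_contra! hd
  have hderiv : deriv φ =ᶠ[𝓝 x] D := hφ.mono fun y hy => hy.deriv
  have hmax : IsLocalMax φ x := isLocalMax_of_deriv_deriv_neg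
    (by rwa [hderiv.deriv_eq, hD.deriv]) hmin.deriv_eq_zero hφ.self_of_nhds.continuousAt
  have hconst : φ =ᶠ[𝓝 x] fun _ => φ x := by
    filter_upwards [hmin, hmax] with y h1 h2 using le_antisymm h2 h1
  have hzero : D =ᶠ[𝓝 x] fun _ => 0 := by
    filter_upwards [hconst.eventuallyEq_nhds, hderiv] with y h1 h2
    rw [← h2, h1.deriv_eq, deriv_const]
  exact hd.ne (hD.unique ((hasDerivAt_const x 0).congr_of_eventuallyEq hzero))

theorem deriv_nonneg_of_forall_right {φ : ℝ → ℝ} {t S d : ℝ} (htS : t < S)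
    (hφ : HasDerivAt φ d t) (hmin : ∀ r ∈ Ioo t S, φ t ≤ φ r) : 0 ≤ d := by
  have h := (hasDerivAt_iff_tendsto_slope.1 hφ).mono_left
    (nhdsWithin_mono t (s := Ioi t) fun y hy => ne_of_gt hy)
  refine ge_of_tendsto h ?_
  filter_upwards [Ioo_mem_nhdsGT htS] with r hr
  rw [slope_def_field]
  exact div_nonneg (sub_nonneg.2 (hmin r hr)) (sub_pos.2 hr.1).le

namespace HasParabolicAt

variable {b σ : ℝ → ℝ} {p q : ℝ → ℝ → ℝ} {t x ℓ ℓ' : ℝ}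

theorem add (hp : HasParabolicAt b σ p t x ℓ) (hq : HasParabolicAt b σ q t x ℓ') :
    HasParabolicAt b σ (fun r y => p r y + q r y) t x (ℓ + ℓ') := by
  obtain ⟨a, D, d, h1, h2, h3, h4⟩ := hp
  obtain ⟨a', D', d', h1', h2', h3', h4'⟩ := hq
  refine ⟨a + a', fun y => D y + D' y, d + d', h1.add h1', ?_, h3.add h3', ?_⟩
  · filter_upwards [h2, h2'] with y hy hy' using hy.add hy'
  · rw [h4, h4']; ring

theorem const_mul (c : ℝ) (hp : HasParabolicAt b σ p t x ℓ) :
    HasParabolicAt b σ (fun r y => c * p r y) t x (c * ℓ) := by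
  obtain ⟨a, D, d, h1, h2, h3, h4⟩ := hp
  refine ⟨c * a, fun y => c * D y, c * d, h1.const_mul c, ?_, h3.const_mul c, ?_⟩
  · filter_upwards [h2] with y hy using hy.const_mul c
  · rw [h4]; ring

theorem neg (hp : HasParabolicAt b σ p t x ℓ) :
    HasParabolicAt b σ (fun r y => -p r y) t x (-ℓ) := by
  simpa using hp.const_mul (-1)

theorem sub (hp : HasParabolicAt b σ p t x ℓ) (hq : HasParabolicAt b σ q t x ℓ') :
    HasParabolicAt b σ (fun r y => p r y - q r y) t x (ℓ - ℓ') := by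
  simpa [sub_eq_add_neg] using hp.add hq.neg

theorem of_time {c : ℝ → ℝ} {c' : ℝ} (hc : HasDerivAt c c' t) :
    HasParabolicAt b σ (fun r _ => c r) t x c' :=
  ⟨c', fun _ => 0, 0, hc, Eventually.of_forall fun y => hasDerivAt_const y _,
    hasDerivAt_const x _, by ring⟩

theorem sum {ι : Type*} (s : Finset ι) {p : ι → ℝ → ℝ → ℝ} {ℓ : ι → ℝ}
    (hp : ∀ i ∈ s, HasParabolicAt b σ (p i) t x (ℓ i)) :
    HasParabolicAt b σ (fun r y => ∑ i ∈ s, p i r y) t x (∑ i ∈ s, ℓ i) := by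
  classical
  induction s using Finset.induction_on with
  | empty => simpa using of_time (hasDerivAt_const t (0 : ℝ))
  | insert i s hi ih =>
    simp only [Finset.sum_insert hi]
    exact (hp i (by simp)).add (ih fun j hj => hp j (by simp [hj]))

theorem comp_add_const {s : ℝ} (hp : HasParabolicAt b σ p (t + s) x ℓ) :
    HasParabolicAt b σ (fun r y => p (r + s) y) t x ℓ := by
  obtain ⟨a, D, d, h1, h2, h3, h4⟩ := hp
  exact ⟨a, D, d, h1.comp_add_const t s, h2, h3, h4⟩

theorem nonneg_of_isLocalMin {S : ℝ} (hq : HasParabolicAt b σ q t x ℓ) (htS : t < S)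
    (hspace : IsLocalMin (q t) x) (htime : ∀ r ∈ Ioo t S, q t x ≤ q r x) : 0 ≤ ℓ := by
  obtain ⟨qt, D, d, h1, h2, h3, rfl⟩ := hq
  have hqt : 0 ≤ qt := deriv_nonneg_of_forall_right htS h1 htime
  have hD : D x = 0 := by rw [← h2.self_of_nhds.deriv, hspace.deriv_eq_zero]
  have hd : 0 ≤ d := second_deriv_nonneg_of_isLocalMin h2 h3 hspace
  rw [hD, mul_zero, zero_add]
  positivity

end HasParabolicAt

namespace HasGeneratorAt

variable {b σ φ : ℝ → ℝ} {x ℓ : ℝ}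

theorem generator_eq (h : HasGeneratorAt b σ φ x ℓ) : generator b σ φ x = ℓ := by
  obtain ⟨D, d, h1, h2, rfl⟩ := h
  have hderiv : deriv φ =ᶠ[𝓝 x] D := h1.mono fun y hy => hy.deriv
  rw [generator, hderiv.eq_of_nhds, hderiv.deriv_eq, h2.deriv]

theorem const_add (h : HasGeneratorAt b σ φ x ℓ) (c : ℝ) :
    HasGeneratorAt b σ (fun y => c + φ y) x ℓ := by
  obtain ⟨D, d, h1, h2, h3⟩ := h
  exact ⟨D, d, h1.mono fun y hy => hy.const_add c, h2, h3⟩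

theorem mul_time {c : ℝ → ℝ} {t c' : ℝ} (h : HasGeneratorAt b σ φ x ℓ) (hc : HasDerivAt c c' t) :
    HasParabolicAt b σ (fun r y => c r * φ y) t x (c' * φ x + c t * ℓ) := by
  obtain ⟨D, d, h1, h2, rfl⟩ := h
  refine ⟨c' * φ x, fun y => c t * D y, c t * d, hc.mul_const _, ?_, h2.const_mul _, by ring⟩
  filter_upwards [h1] with y hy using hy.const_mul _

end HasGeneratorAt

theorem SolvesBackwardPDE.hasParabolicAt {L S : ℝ} {b σ k : ℝ → ℝ} {v : ℝ → ℝ → ℝ}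
    (hv : SolvesBackwardPDE L S b σ k v) {t x : ℝ} (ht : t ∈ Ioo 0 S) (hx : x ∈ Ioo 0 L) :
    HasParabolicAt b σ v t x (k x * v t x) := by
  refine ⟨_, deriv (v t), _, (hv.diff_time t ht x hx).hasDerivAt, ?_,
    (hv.diff_space_two t ht x hx).hasDerivAt, (sub_eq_zero.1 (hv.pde t ht x hx)).symm⟩
  filter_upwards [isOpen_Ioo.mem_nhds hx] with y hy using (hv.diff_space t ht y hy).hasDerivAt

theorem nonneg_of_forall_pos_nonneg_add_mul {a c : ℝ} (h : ∀ δ > 0, 0 ≤ a + δ * c) : 0 ≤ a := by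
  have hlim : Tendsto (fun δ : ℝ => a + δ * c) (𝓝[>] 0) (𝓝 a) :=
    tendsto_nhdsWithin_of_tendsto_nhds (Continuous.tendsto' (by fun_prop) _ _ (by simp))
  exact ge_of_tendsto hlim (eventually_mem_nhdsWithin.mono h)

section MinimumPrinciple

variable {b σ : ℝ → ℝ} {q : ℝ → ℝ → ℝ} {S₀ S l r : ℝ}

theorem nonneg_of_hasParabolicAt_neg
    (hcont : ContinuousOn (fun p : ℝ × ℝ => q p.1 p.2) (Icc S₀ S ×ˢ Icc l r))
    (hpar : ∀ t ∈ Ico S₀ S, ∀ x ∈ Ioo l r, ∃ ℓ < 0, HasParabolicAt b σ q t x ℓ)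
    (hbd : ∀ t ∈ Icc S₀ S, ∀ x ∈ Icc l r, t = S ∨ x = l ∨ x = r → 0 ≤ q t x) :
    ∀ t ∈ Icc S₀ S, ∀ x ∈ Icc l r, 0 ≤ q t x := by
  intro t₁ ht₁ x₁ hx₁
  obtain ⟨⟨t, x⟩, ⟨ht, hx⟩, hmin⟩ :=
    (isCompact_Icc.prod isCompact_Icc).exists_isMinOn ⟨(t₁, x₁), ⟨ht₁, hx₁⟩⟩ hcont
  have hle : ∀ t' ∈ Icc S₀ S, ∀ x' ∈ Icc l r, q t x ≤ q t' x' :=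
    fun t' ht' x' hx' => hmin (⟨ht', hx'⟩ : (t', x') ∈ Icc S₀ S ×ˢ Icc l r)
  refine le_trans ?_ (hle t₁ ht₁ x₁ hx₁)
  by_cases hb : t = S ∨ x = l ∨ x = r
  · exact hbd t ht x hx hb
  · push Not at hb
    obtain ⟨htS, hxl, hxr⟩ := hb
    replace htS := lt_of_le_of_ne ht.2 htS
    replace hxl := lt_of_le_of_ne hx.1 hxl.symm
    replace hxr := lt_of_le_of_ne hx.2 hxr
    obtain ⟨ℓ, hℓ, hq⟩ := hpar t ⟨ht.1, htS⟩ x ⟨hxl, hxr⟩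
    refine absurd (hq.nonneg_of_isLocalMin htS ?_ fun s hs => ?_) hℓ.not_ge
    · filter_upwards [Icc_mem_nhds hxl hxr] with y hy using hle t ht y hy
    · exact hle s ⟨ht.1.trans hs.1.le, hs.2.le⟩ x hx

theorem nonneg_of_hasParabolicAt_nonpos
    (hcont : ContinuousOn (fun p : ℝ × ℝ => q p.1 p.2) (Icc S₀ S ×ˢ Icc l r))
    (hpar : ∀ t ∈ Ioo S₀ S, ∀ x ∈ Ioo l r, ∃ ℓ ≤ 0, HasParabolicAt b σ q t x ℓ)
    (hbd : ∀ t ∈ Icc S₀ S, ∀ x ∈ Icc l r, t = S ∨ x = l ∨ x = r → 0 ≤ q t x) :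
    ∀ t ∈ Icc S₀ S, ∀ x ∈ Icc l r, 0 ≤ q t x := by
  have hlater : ∀ t ∈ Ioc S₀ S, ∀ x ∈ Icc l r, 0 ≤ q t x := by
    intro t₁ ht₁ x₁ hx₁
    have hperturbed : ∀ η > 0, 0 ≤ q t₁ x₁ + η * (S - t₁) := by
      intro η hη
      refine nonneg_of_hasParabolicAt_neg (b := b) (σ := σ) (S₀ := t₁) (S := S)
        (q := fun t x => q t x + η * (S - t)) ?_ ?_ ?_ t₁ (left_mem_Icc.2 ht₁.2) x₁ hx₁
      · exact (hcont.mono (prod_mono (Icc_subset_Icc_left ht₁.1.le) Subset.rfl)).add (by fun_prop)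
      · intro t ht x hx
        obtain ⟨ℓ, hℓ, hq⟩ := hpar t ⟨ht₁.1.trans_le ht.1, ht.2⟩ x hx
        refine ⟨_, ?_, hq.add (.of_time (((hasDerivAt_id t).const_sub S).const_mul η))⟩
        linarith
      · intro t ht x hx hb
        have := hbd t ⟨ht₁.1.le.trans ht.1, ht.2⟩ x hx hb
        have := sub_nonneg.2 ht.2
        positivity
    exact nonneg_of_forall_pos_nonneg_add_mul hperturbed
  intro t ht x hx
  rcases ht.2.eq_or_lt with rfl | htS
  · exact hbd t ht x hx (.inl rfl)
  have hc : ContinuousWithinAt (fun s => q s x) (Ioc t S) t :=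
    (hcont.comp (f := fun s : ℝ => (s, x)) (s := Icc S₀ S) (by fun_prop)
      (fun s hs => ⟨hs, hx⟩) t ht).mono fun s hs => ⟨ht.1.trans hs.1.le, hs.2⟩
  have : (𝓝[Ioc t S] t).NeBot := by
    rw [nhdsWithin_Ioc_eq_nhdsGT htS]; infer_instance
  exact ge_of_tendsto hc (eventually_mem_nhdsWithin.mono fun s hs =>
    hlater s ⟨ht.1.trans_lt hs.1, hs.2⟩ x hx)

end MinimumPrinciple

/-! ### Lyapunov functions -/

/-- The lateral boundary `[0, S] × {0, L}` of the strip `[0, S] × (0, L)`, approached from inside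
the strip uniformly in time. -/
def lateralBoundary (L S : ℝ) : Filter (ℝ × ℝ) := 𝓟 (Icc 0 S) ×ˢ (𝓝[>] 0 ⊔ 𝓝[<] L)

theorem eventually_lateralBoundary {L S : ℝ} {P : ℝ × ℝ → Prop} :
    (∀ᶠ p in lateralBoundary L S, P p) ↔
      ∀ᶠ x in 𝓝[>] 0 ⊔ 𝓝[<] L, ∀ t ∈ Icc 0 S, P (t, x) := by
  rw [lateralBoundary, prod_comm, eventually_map, eventually_prod_principal_iff]
  rfl

theorem eventually_lateralBoundary_mem_Ioo {L : ℝ} (hL : 0 < L) (S : ℝ) :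
    ∀ᶠ p in lateralBoundary L S, p ∈ Icc 0 S ×ˢ Ioo 0 L :=
  eventually_lateralBoundary.2 <| eventually_sup.2
    ⟨mem_of_superset (Ioo_mem_nhdsGT hL) fun _ hx _ ht => ⟨ht, hx⟩,
      mem_of_superset (Ioo_mem_nhdsLT hL) fun _ hx _ ht => ⟨ht, hx⟩⟩

theorem tendsto_lateralBoundary_add_const {S S' s : ℝ} (L : ℝ) (hs : 0 ≤ s) (hS : S + s ≤ S') :
    Tendsto (fun p : ℝ × ℝ => (p.1 + s, p.2)) (lateralBoundary L S) (lateralBoundary L S') :=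
  have htime : Tendsto (· + s) (𝓟 (Icc 0 S)) (𝓟 (Icc 0 S')) :=
    tendsto_principal_principal.2 fun t ht => ⟨add_nonneg ht.1 hs, by linarith [ht.2]⟩
  htime.prodMap tendsto_id

theorem tendsto_zero_of_continuousOn_prod {X Y E : Type*} [TopologicalSpace X]
    [TopologicalSpace Y] [TopologicalSpace E] [Zero E] {K : Set X} {s : Set Y} {k : X × Y → E}
    {e : Y}
    (hK : IsCompact K) (hk : ContinuousOn k (K ×ˢ s)) (he : e ∈ s) (h0 : ∀ x ∈ K, k (x, e) = 0) :
    Tendsto k (𝓟 K ×ˢ 𝓝[s] e) (𝓝 0) := by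
  intro U hU
  have hnear : ∀ x ∈ K, ∀ᶠ z in 𝓝 (e, x), z.1 ∈ s → z.2 ∈ K → k (z.2, z.1) ∈ U := by
    intro x hx
    have hc := hk (x, e) ⟨hx, he⟩
    rw [ContinuousWithinAt, h0 x hx] at hc
    have hev : ∀ᶠ z in 𝓝 (x, e), z ∈ K ×ˢ s → k z ∈ U := eventually_nhdsWithin_iff.1 (hc hU)
    filter_upwards [(continuous_swap.tendsto (e, x)).eventually hev] with z hz h1 h2
      using hz ⟨h2, h1⟩
  rw [mem_map, prod_comm]
  refine eventually_prod_principal_iff.2 (eventually_nhdsWithin_iff.2 ?_)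
  filter_upwards [hK.eventually_forall_of_forall_eventually (x₀ := e)
    (P := fun y x => y ∈ s → x ∈ K → k (x, y) ∈ U) hnear] with y hy hys x hx
    using hy x hx hys hx

theorem isLittleO_exp_mul_nhdsWithin {L S e : ℝ} {d : ℝ → ℝ → ℝ} {h V : ℝ → ℝ} (he : e ∈ Icc 0 L)
    (hd : ContinuousOn (fun p : ℝ × ℝ => d p.1 p.2) (Icc 0 S ×ˢ Icc 0 L))
    (hde : ∀ t ∈ Icc 0 S, d t e = 0) (hh : ContinuousWithinAt h (Ioo 0 L) e)
    (hV : ∀ x ∈ Ioo 0 L, 1 ≤ V x) :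
    (fun p : ℝ × ℝ => Real.exp (h p.2) * d p.1 p.2)
      =o[𝓟 (Icc 0 S) ×ˢ 𝓝[Ioo 0 L] e] fun p => V p.2 := by
  have hd_lim : Tendsto (fun p : ℝ × ℝ => d p.1 p.2) (𝓟 (Icc 0 S) ×ˢ 𝓝[Ioo 0 L] e) (𝓝 0) :=
    (tendsto_zero_of_continuousOn_prod isCompact_Icc hd he hde).mono_left
      (prod_mono le_rfl (nhdsWithin_mono _ Ioo_subset_Icc_self))
  have hlim := (hh.tendsto.rexp.comp tendsto_snd).mul hd_lim
  rw [mul_zero] at hlim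
  refine ((isLittleO_one_iff ℝ).2 hlim).trans_isBigO (IsBigO.of_bound 1 ?_)
  filter_upwards [tendsto_snd.eventually (eventually_mem_nhdsWithin (s := Ioo 0 L) (a := e))]
    with p hp
  rw [one_mul, norm_one]
  exact (hV _ hp).trans (le_abs_self _)

theorem isLittleO_exp_mul {acc : Prop} {L S : ℝ} {d : ℝ → ℝ → ℝ} {h V : ℝ → ℝ} (hL : 0 < L)
    (hd : ContinuousOn (fun p : ℝ × ℝ => d p.1 p.2) (Icc 0 S ×ˢ Icc 0 L))
    (hd0 : acc → ∀ t ∈ Icc 0 S, d t 0 = 0) (hdL : ∀ t ∈ Icc 0 S, d t L = 0)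
    (hh : ContinuousOn h (Ioc 0 L)) (hh0 : acc → ContinuousOn h (Icc 0 L))
    (hV : ∀ x ∈ Ioo 0 L, 1 ≤ V x)
    (hacc : ¬acc → Tendsto (fun x => V x * Real.exp (-h x)) (𝓝[>] 0) atTop) :
    (fun p : ℝ × ℝ => Real.exp (h p.2) * d p.1 p.2) =o[lateralBoundary L S] fun p => V p.2 := by
  have hright := isLittleO_exp_mul_nhdsWithin (right_mem_Icc.2 hL.le) hd hdL
    ((hh L (right_mem_Ioc.2 hL)).mono Ioo_subset_Ioc_self) hV
  rw [nhdsWithin_Ioo_eq_nhdsLT hL] at hright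
  rw [lateralBoundary, prod_sup]
  refine .sup ?_ hright
  by_cases h_acc : acc
  · have hleft := isLittleO_exp_mul_nhdsWithin (left_mem_Icc.2 hL.le) hd (hd0 h_acc)
      ((hh0 h_acc 0 (left_mem_Icc.2 hL.le)).mono Ioo_subset_Icc_self) hV
    rwa [nhdsWithin_Ioo_eq_nhdsGT hL] at hleft
  · obtain ⟨C, hC⟩ := (isCompact_Icc.prod isCompact_Icc).exists_bound_of_continuousOn hd
    have hd_bdd : (fun p : ℝ × ℝ => Real.exp (h p.2) * d p.1 p.2)
        =O[𝓟 (Icc 0 S) ×ˢ 𝓝[>] 0] fun p => Real.exp (h p.2) := by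
      refine IsBigO.of_bound C ?_
      filter_upwards [prod_mem_prod (mem_principal_self _) (Ioo_mem_nhdsGT hL)] with p hp
      rw [norm_mul, mul_comm]
      gcongr
      exact hC p ⟨hp.1, Ioo_subset_Icc_self hp.2⟩
    have hexp : (fun x => Real.exp (h x)) =o[𝓝[>] 0] V := by
      refine (isLittleO_iff_tendsto' ?_).2 ?_
      · filter_upwards [Ioo_mem_nhdsGT hL] with x hx h0
        exact absurd h0 (zero_lt_one.trans_le (hV x hx)).ne'
      · refine (tendsto_inv_atTop_zero.comp (hacc h_acc)).congr fun x => ?_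
        simp [Real.exp_neg, div_eq_mul_inv, mul_comm]
    exact hd_bdd.trans_isLittleO (hexp.comp_tendsto tendsto_snd)

/-- A function `V ≥ 1` on `(0, L)` with `b V' + ½ σ² V'' ≤ V`, tending to infinity at `0` unless
`acc` holds. Then `e^{S - t} V` is a supersolution of the backward equation, which controls
solutions near the lateral boundary. -/
structure IsLyapunov (acc : Prop) (L : ℝ) (b σ V : ℝ → ℝ) : Prop where
  one_le : ∀ x ∈ Ioo 0 L, 1 ≤ V x
  gen : ∀ x ∈ Ioo 0 L, ∃ ℓ ≤ V x, HasGeneratorAt b σ V x ℓ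
  tendsto_atTop : ¬acc → Tendsto V (𝓝[>] 0) atTop

theorem isLyapunov_one {acc : Prop} (hacc : acc) (L : ℝ) (b σ : ℝ → ℝ) :
    IsLyapunov acc L b σ fun _ => 1 where
  one_le _ _ := le_rfl
  gen x _ := ⟨0, zero_le_one, fun _ => 0, 0, Eventually.of_forall fun y => hasDerivAt_const y _,
    hasDerivAt_const x _, by ring⟩
  tendsto_atTop h := absurd hacc h

namespace IsLyapunov

variable {acc : Prop} {L : ℝ} {b σ V : ℝ → ℝ}

theorem continuousOn (hV : IsLyapunov acc L b σ V) : ContinuousOn V (Ioo 0 L) := fun x hx => by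
  obtain ⟨ℓ, -, D, d, h1, -⟩ := hV.gen x hx
  exact h1.self_of_nhds.continuousAt.continuousWithinAt

theorem exists_hasParabolicAt_exp_mul (hV : IsLyapunov acc L b σ V) {x : ℝ} (hx : x ∈ Ioo 0 L)
    (S t : ℝ) :
    ∃ ℓ ≤ 0, HasParabolicAt b σ (fun r y => Real.exp (S - r) * V y) t x ℓ := by
  obtain ⟨ℓ, hℓ, hgen⟩ := hV.gen x hx
  have hexp : HasDerivAt (fun r => Real.exp (S - r)) (-Real.exp (S - t)) t := by
    simpa using ((hasDerivAt_id t).const_sub S).exp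
  refine ⟨_, ?_, hgen.mul_time hexp⟩
  have := mul_le_mul_of_nonneg_left hℓ (Real.exp_pos (S - t)).le
  linarith

theorem le_exp_mul (hV : IsLyapunov acc L b σ V) {S t x : ℝ} (ht : t ≤ S) (hx : x ∈ Ioo 0 L) :
    V x ≤ Real.exp (S - t) * V x :=
  le_mul_of_one_le_left (zero_le_one.trans (hV.one_le x hx)) (Real.one_le_exp (sub_nonneg.2 ht))

theorem continuousOn_exp_mul (hV : IsLyapunov acc L b σ V) (S : ℝ) (s : Set ℝ) :
    ContinuousOn (fun p : ℝ × ℝ => Real.exp (S - p.1) * V p.2) (s ×ˢ Ioo 0 L) :=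
  (by fun_prop : Continuous fun p : ℝ × ℝ => Real.exp (S - p.1)).continuousOn.mul
    (hV.continuousOn.comp continuousOn_snd fun _ hp => hp.2)

theorem nonneg_of_eventually_lateralBoundary {S : ℝ} {q : ℝ → ℝ → ℝ} (hV : IsLyapunov acc L b σ V)
    (hcont : ContinuousOn (fun p : ℝ × ℝ => q p.1 p.2) (Icc 0 S ×ˢ Ioo 0 L))
    (hpar : ∀ t ∈ Ioo 0 S, ∀ x ∈ Ioo 0 L, ∃ ℓ ≤ 0, HasParabolicAt b σ q t x ℓ)
    (hterm : ∀ x ∈ Ioo 0 L, 0 ≤ q S x)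
    (hbd : ∀ κ > 0, ∀ᶠ p in lateralBoundary L S, -(κ * V p.2) ≤ q p.1 p.2) :
    ∀ t ∈ Icc 0 S, ∀ x ∈ Ioo 0 L, 0 ≤ q t x := by
  intro t ht x hx
  have hperturbed : ∀ κ > 0, 0 ≤ q t x + κ * (Real.exp (S - t) * V x) := by
    intro κ hκ
    obtain ⟨hleft, hright⟩ := eventually_sup.1 (eventually_lateralBoundary.1 (hbd κ hκ))
    obtain ⟨l, hl, hl0, hlx⟩ := (hleft.and (Ioo_mem_nhdsGT hx.1)).exists
    obtain ⟨r, hr, hxr, hrL⟩ := (hright.and (Ioo_mem_nhdsLT hx.2)).exists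
    have hsub : Icc l r ⊆ Ioo 0 L := fun y hy => ⟨hl0.trans_le hy.1, hy.2.trans_lt hrL⟩
    refine nonneg_of_hasParabolicAt_nonpos (b := b) (σ := σ) (S₀ := 0) (S := S) (l := l) (r := r)
      (q := fun s y => q s y + κ * (Real.exp (S - s) * V y)) ?_ ?_ ?_ t ht x ⟨hlx.le, hxr.le⟩
    · exact (hcont.add (continuousOn_const.mul (hV.continuousOn_exp_mul S _))).mono
        (prod_mono Subset.rfl hsub)
    · intro s hs y hy
      obtain ⟨ℓ, hℓ, hq⟩ := hpar s hs y (hsub (Ioo_subset_Icc_self hy))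
      obtain ⟨ℓ', hℓ', hVy⟩ := hV.exists_hasParabolicAt_exp_mul (hsub (Ioo_subset_Icc_self hy)) S s
      exact ⟨_, add_nonpos hℓ (mul_nonpos_of_nonneg_of_nonpos hκ.le hℓ'),
        hq.add (hVy.const_mul κ)⟩
    · intro s hs y hy hb
      have hlower := mul_le_mul_of_nonneg_left (hV.le_exp_mul hs.2 (hsub hy)) hκ.le
      have hVy := mul_nonneg hκ.le (zero_le_one.trans (hV.one_le y (hsub hy)))
      rcases hb with rfl | rfl | rfl
      · linarith [hterm y (hsub hy)]
      · linarith [hl s hs]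
      · linarith [hr s hs]
  exact nonneg_of_forall_pos_nonneg_add_mul hperturbed

theorem nonneg_of_isLittleO {S : ℝ} {q : ℝ → ℝ → ℝ} (hV : IsLyapunov acc L b σ V)
    (hL : 0 < L)
    (hcont : ContinuousOn (fun p : ℝ × ℝ => q p.1 p.2) (Icc 0 S ×ˢ Ioo 0 L))
    (hpar : ∀ t ∈ Ioo 0 S, ∀ x ∈ Ioo 0 L, ∃ ℓ ≤ 0, HasParabolicAt b σ q t x ℓ)
    (hterm : ∀ x ∈ Ioo 0 L, 0 ≤ q S x)
    (hbd : (fun p : ℝ × ℝ => q p.1 p.2) =o[lateralBoundary L S] fun p => V p.2) :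
    ∀ t ∈ Icc 0 S, ∀ x ∈ Ioo 0 L, 0 ≤ q t x := by
  refine hV.nonneg_of_eventually_lateralBoundary hcont hpar hterm fun κ hκ => ?_
  filter_upwards [hbd.bound hκ, eventually_lateralBoundary_mem_Ioo hL S] with p hp hmem
  rw [Real.norm_eq_abs, Real.norm_of_nonneg (zero_le_one.trans (hV.one_le _ hmem.2))] at hp
  exact (abs_le.1 hp).1

theorem eq_zero_of_isLittleO {S : ℝ} {q : ℝ → ℝ → ℝ} (hV : IsLyapunov acc L b σ V)
    (hL : 0 < L)
    (hcont : ContinuousOn (fun p : ℝ × ℝ => q p.1 p.2) (Icc 0 S ×ˢ Ioo 0 L))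
    (hpar : ∀ t ∈ Ioo 0 S, ∀ x ∈ Ioo 0 L, HasParabolicAt b σ q t x 0)
    (hterm : ∀ x ∈ Ioo 0 L, q S x = 0)
    (hbd : (fun p : ℝ × ℝ => q p.1 p.2) =o[lateralBoundary L S] fun p => V p.2) :
    ∀ t ∈ Icc 0 S, ∀ x ∈ Ioo 0 L, q t x = 0 := by
  intro t ht x hx
  refine le_antisymm (neg_nonneg.1 ?_) ?_
  · refine hV.nonneg_of_isLittleO (q := fun t x => -q t x) hL hcont.neg
      (fun t ht x hx => ⟨_, neg_zero.le, (hpar t ht x hx).neg⟩) ?_ hbd.neg_left t ht x hx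
    exact fun x hx => (neg_eq_zero.2 (hterm x hx)).ge
  · exact hV.nonneg_of_isLittleO hL hcont (fun t ht x hx => ⟨_, le_rfl, hpar t ht x hx⟩)
      (fun x hx => (hterm x hx).ge) hbd t ht x hx

end IsLyapunov

theorem IsClassicalSolution.isLittleO_lateralBoundary {acc : Prop} {L S : ℝ} {b σ k φ V : ℝ → ℝ}
    {v : ℝ → ℝ → ℝ} (hv : IsClassicalSolution acc L S b σ k φ (fun _ => 0) (fun _ => 0) v)
    (hL : 0 < L) (hV : IsLyapunov acc L b σ V) :
    (fun p : ℝ × ℝ => v p.1 p.2) =o[lateralBoundary L S] fun p => V p.2 := by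
  simpa using isLittleO_exp_mul (h := fun _ => 0) hL hv.continuousOn hv.bc_zero hv.bc_right
    continuousOn_const (fun _ => continuousOn_const) hV.one_le (by simpa using hV.tendsto_atTop)

/-! ### Evolution of test functions -/

/-- Test functions: the continuous functions with compact support in `(0, L)`, for which the
terminal condition of a fundamental solution is required. -/
structure IsTest (L : ℝ) (φ : ℝ → ℝ) : Prop where
  continuous : Continuous φ
  hasCompactSupport : HasCompactSupport φ
  tsupport_subset : tsupport φ ⊆ Ioo 0 L

theorem isTest_zero (L : ℝ) : IsTest L fun _ => 0 where
  continuous := continuous_const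
  hasCompactSupport := HasCompactSupport.zero
  tsupport_subset := by simp [tsupport]

namespace IsTest

variable {L : ℝ} {φ χ : ℝ → ℝ}

theorem mul (hφ : IsTest L φ) (hχ : ContinuousOn χ (Ioo 0 L)) : IsTest L fun x => χ x * φ x where
  continuous := by
    refine continuous_iff_continuousAt.2 fun x => ?_
    by_cases hx : x ∈ tsupport φ
    · exact (hχ.continuousAt (isOpen_Ioo.mem_nhds (hφ.tsupport_subset hx))).mul
        hφ.continuous.continuousAt
    · have hzero : (fun x => χ x * φ x) =ᶠ[𝓝 x] fun _ => 0 := by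
        filter_upwards [notMem_tsupport_iff_eventuallyEq.1 hx] with y hy
        simp [hy]
      exact continuousAt_const.congr hzero.symm
  hasCompactSupport := hφ.hasCompactSupport.mul_left
  tsupport_subset := tsupport_mul_subset_right.trans hφ.tsupport_subset

theorem add (hφ : IsTest L φ) (hχ : IsTest L χ) : IsTest L fun x => φ x + χ x where
  continuous := hφ.continuous.add hχ.continuous
  hasCompactSupport := hφ.hasCompactSupport.add hχ.hasCompactSupport
  tsupport_subset := (tsupport_add φ χ).trans (union_subset hφ.tsupport_subset hχ.tsupport_subset)

theorem const_mul (hφ : IsTest L φ) (c : ℝ) : IsTest L fun x => c * φ x :=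
  hφ.mul continuousOn_const

theorem sub (hφ : IsTest L φ) (hχ : IsTest L χ) : IsTest L fun x => φ x - χ x := by
  simpa [sub_eq_add_neg] using hφ.add (hχ.const_mul (-1))

theorem sum {ι : Type*} (s : Finset ι) {φ : ι → ℝ → ℝ} (hφ : ∀ i ∈ s, IsTest L (φ i)) :
    IsTest L fun x => ∑ i ∈ s, φ i x := by
  classical
  induction s using Finset.induction_on with
  | empty => simpa using isTest_zero L
  | insert i s hi ih =>
    simp only [Finset.sum_insert hi]
    exact (hφ i (by simp)).add (ih fun j hj => hφ j (by simp [hj]))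

end IsTest

/-- The value at `(t, x)` of the solution with terminal value `φ` at time `s` which the kernel `Γ`
provides. -/
def evolve (Γ : ℝ → ℝ → ℝ → ℝ → ℝ) (L : ℝ) (φ : ℝ → ℝ) (s t x : ℝ) : ℝ :=
  if t < s then ∫ y in 0..L, Γ t x s y * φ y else φ x

theorem evolve_const_mul (Γ : ℝ → ℝ → ℝ → ℝ → ℝ) (L : ℝ) (φ : ℝ → ℝ) (c s t x : ℝ) :
    evolve Γ L (fun y => c * φ y) s t x = c * evolve Γ L φ s t x := by
  unfold evolve
  split_ifs
  · rw [← intervalIntegral.integral_const_mul]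
    simp only [mul_left_comm]
  · rfl

namespace IsFundamentalSolution

variable {acc : Prop} {L T : ℝ} {b σ V φ χ : ℝ → ℝ} {Γ : ℝ → ℝ → ℝ → ℝ → ℝ} {s t x : ℝ}

theorem isClassicalSolution_evolve (hΓ : IsFundamentalSolution acc L T b σ Γ)
    (hs : s ∈ Ioc 0 T) (hφ : IsTest L φ) :
    IsClassicalSolution acc L s b σ (fun _ => 0) φ (fun _ => 0) (fun _ => 0) (evolve Γ L φ s) :=
  hΓ.terminal s hs φ hφ.continuous hφ.hasCompactSupport hφ.tsupport_subset

theorem hasParabolicAt_evolve (hΓ : IsFundamentalSolution acc L T b σ Γ) (hs : s ∈ Ioc 0 T)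
    (hφ : IsTest L φ) (ht : t ∈ Ioo 0 s) (hx : x ∈ Ioo 0 L) :
    HasParabolicAt b σ (evolve Γ L φ s) t x 0 := by
  simpa using (hΓ.isClassicalSolution_evolve hs hφ).solves.hasParabolicAt ht hx

theorem integrableOn_mul_test (hΓ : IsFundamentalSolution acc L T b σ Γ)
    (hs : s ∈ Ioc 0 T) (ht : t ∈ Ico 0 s) (hx : x ∈ Icc 0 L) (hφ : IsTest L φ) :
    IntegrableOn (fun y => Γ t x s y * φ y) (Ioo 0 L) := by
  have hsupp : IntegrableOn (fun y => Γ t x s y * φ y) (tsupport φ) :=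
    ((hΓ.locallyIntegrable s hs t ht x hx).integrableOn_compact_subset hφ.tsupport_subset
      hφ.hasCompactSupport).mul_continuousOn hφ.continuous.continuousOn hφ.hasCompactSupport
  refine Integrable.integrableOn ((integrableOn_iff_integrable_of_support_subset ?_).1 hsupp)
  exact (Function.support_mul_subset_right _ _).trans (subset_tsupport φ)

theorem evolve_nonneg (hΓ : IsFundamentalSolution acc L T b σ Γ) (hs : s ≤ T)
    (ht : t ∈ Icc 0 s) (hx : x ∈ Icc 0 L) (hφ : ∀ y, 0 ≤ φ y) : 0 ≤ evolve Γ L φ s t x := by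
  unfold evolve
  split_ifs with hts
  · rw [intervalIntegral.integral_of_le (hx.1.trans hx.2), integral_Ioc_eq_integral_Ioo]
    exact setIntegral_nonneg measurableSet_Ioo fun y hy =>
      mul_nonneg (hΓ.nonneg s ⟨ht.1.trans_lt hts, hs⟩ t ⟨ht.1, hts⟩ x hx y hy) (hφ y)
  · exact hφ x

theorem evolve_add (hΓ : IsFundamentalSolution acc L T b σ Γ) (hs : s ≤ T)
    (ht : t ∈ Icc 0 s) (hx : x ∈ Icc 0 L) (hφ : IsTest L φ) (hχ : IsTest L χ) :
    evolve Γ L (fun y => φ y + χ y) s t x = evolve Γ L φ s t x + evolve Γ L χ s t x := by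
  unfold evolve
  split_ifs with hts
  · simp only [intervalIntegral.integral_of_le (hx.1.trans hx.2), integral_Ioc_eq_integral_Ioo,
      mul_add]
    have hs₀ : s ∈ Ioc 0 T := ⟨ht.1.trans_lt hts, hs⟩
    exact integral_add (hΓ.integrableOn_mul_test hs₀ ⟨ht.1, hts⟩ hx hφ)
      (hΓ.integrableOn_mul_test hs₀ ⟨ht.1, hts⟩ hx hχ)
  · rfl

theorem evolve_sub (hΓ : IsFundamentalSolution acc L T b σ Γ) (hs : s ≤ T)
    (ht : t ∈ Icc 0 s) (hx : x ∈ Icc 0 L) (hφ : IsTest L φ) (hχ : IsTest L χ) :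
    evolve Γ L (fun y => φ y - χ y) s t x = evolve Γ L φ s t x - evolve Γ L χ s t x := by
  have h := hΓ.evolve_add hs ht hx hφ (hχ.const_mul (-1))
  rw [evolve_const_mul] at h
  simpa [sub_eq_add_neg] using h

theorem evolve_sum (hΓ : IsFundamentalSolution acc L T b σ Γ) (hs : s ≤ T)
    (ht : t ∈ Icc 0 s) (hx : x ∈ Icc 0 L) {ι : Type*} (I : Finset ι) {φ : ι → ℝ → ℝ}
    (hφ : ∀ i ∈ I, IsTest L (φ i)) :
    evolve Γ L (fun y => ∑ i ∈ I, φ i y) s t x = ∑ i ∈ I, evolve Γ L (φ i) s t x := by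
  classical
  induction I using Finset.induction_on with
  | empty => simp [evolve]
  | insert i I hi ih =>
    have hI : ∀ j ∈ I, IsTest L (φ j) := fun j hj => hφ j (Finset.mem_insert_of_mem hj)
    simp only [Finset.sum_insert hi]
    rw [hΓ.evolve_add hs ht hx (hφ i (Finset.mem_insert_self i I)) (IsTest.sum I hI), ih hI]

theorem evolve_mono (hΓ : IsFundamentalSolution acc L T b σ Γ) (hs : s ≤ T)
    (ht : t ∈ Icc 0 s) (hx : x ∈ Icc 0 L) (hφ : IsTest L φ) (hχ : IsTest L χ)
    (h : ∀ y, φ y ≤ χ y) : evolve Γ L φ s t x ≤ evolve Γ L χ s t x := by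
  have := hΓ.evolve_nonneg hs ht hx fun y => sub_nonneg.2 (h y)
  rwa [hΓ.evolve_sub hs ht hx hχ hφ, sub_nonneg] at this

theorem evolve_le (hΓ : IsFundamentalSolution acc L T b σ Γ) (hV : IsLyapunov acc L b σ V)
    (hs : s ≤ T) (ht : t ∈ Icc 0 s) (hx : x ∈ Ioo 0 L) (hφ : IsTest L φ) {c : ℝ}
    (hc : 0 ≤ c) (h : ∀ y, φ y ≤ c) : evolve Γ L φ s t x ≤ c := by
  rcases ht.2.eq_or_lt with rfl | hts
  · simpa [evolve] using h x
  have hL : 0 < L := hx.1.trans hx.2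
  have hs₀ : s ∈ Ioc 0 T := ⟨ht.1.trans_lt hts, hs⟩
  have hsol := hΓ.isClassicalSolution_evolve hs₀ hφ
  refine sub_nonneg.1 (hV.nonneg_of_eventually_lateralBoundary
    (q := fun t x => c - evolve Γ L φ s t x) ?_ ?_ ?_ ?_ t ht x hx)
  · exact continuousOn_const.sub (hsol.continuousOn.mono (prod_mono_right Ioo_subset_Icc_self))
  · intro r hr y hy
    exact ⟨_, (sub_zero 0).le, (HasParabolicAt.of_time (hasDerivAt_const r c)).sub
      (hΓ.hasParabolicAt_evolve hs₀ hφ hr hy)⟩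
  · intro y hy
    rw [hsol.terminal y (Ioo_subset_Icc_self hy)]
    exact sub_nonneg.2 (h y)
  · intro κ hκ
    filter_upwards [(hsol.isLittleO_lateralBoundary hL hV).bound hκ,
      eventually_lateralBoundary_mem_Ioo hL s] with p hp hmem
    rw [Real.norm_eq_abs, Real.norm_of_nonneg (zero_le_one.trans (hV.one_le _ hmem.2))] at hp
    linarith [(abs_le.1 hp).2]

theorem abs_evolve_le (hΓ : IsFundamentalSolution acc L T b σ Γ) (hV : IsLyapunov acc L b σ V)
    (hs : s ≤ T) (ht : t ∈ Icc 0 s) (hx : x ∈ Ioo 0 L) (hφ : IsTest L φ) {c : ℝ}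
    (h : ∀ y, |φ y| ≤ c) : |evolve Γ L φ s t x| ≤ c := by
  have hc : 0 ≤ c := (abs_nonneg _).trans (h 0)
  refine abs_le'.2 ⟨hΓ.evolve_le hV hs ht hx hφ hc fun y => (abs_le'.1 (h y)).1, ?_⟩
  have := hΓ.evolve_le hV hs ht hx (hφ.const_mul (-1)) hc fun y => by
    simpa using (abs_le'.1 (h y)).2
  rwa [evolve_const_mul, neg_one_mul] at this

theorem evolve_eq_evolve_add (hΓ : IsFundamentalSolution acc L T b σ Γ)
    (hV : IsLyapunov acc L b σ V) (hs : s ≤ T) (ht : t ∈ Icc 0 s) (hx : x ∈ Ioo 0 L)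
    (hφ : IsTest L φ) : evolve Γ L φ s t x = evolve Γ L φ T (t + (T - s)) x := by
  rcases ht.2.eq_or_lt with rfl | hts
  · simp [evolve]
  have hL : 0 < L := hx.1.trans hx.2
  have hs₀ : s ∈ Ioc 0 T := ⟨ht.1.trans_lt hts, hs⟩
  have hT : T ∈ Ioc 0 T := ⟨hs₀.1.trans_le hs, le_rfl⟩
  have hsol := hΓ.isClassicalSolution_evolve hs₀ hφ
  have hsolT := hΓ.isClassicalSolution_evolve hT hφ
  refine sub_eq_zero.1 (hV.eq_zero_of_isLittleO
    (q := fun t x => evolve Γ L φ s t x - evolve Γ L φ T (t + (T - s)) x) hL ?_ ?_ ?_ ?_ t ht x hx)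
  · refine (hsol.continuousOn.mono (prod_mono_right Ioo_subset_Icc_self)).sub ?_
    refine hsolT.continuousOn.comp (f := fun p : ℝ × ℝ => (p.1 + (T - s), p.2)) (by fun_prop)
      fun p hp => ⟨⟨?_, ?_⟩, Ioo_subset_Icc_self hp.2⟩
    · linarith [hp.1.1, hs]
    · linarith [hp.1.2]
  · intro r hr y hy
    simpa using (hΓ.hasParabolicAt_evolve hs₀ hφ hr hy).sub (hΓ.hasParabolicAt_evolve hT hφ
      (t := r + (T - s)) ⟨by linarith [hr.1, hs], by linarith [hr.2]⟩ hy).comp_add_const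
  · intro y hy
    rw [add_sub_cancel, hsol.terminal y (Ioo_subset_Icc_self hy),
      hsolT.terminal y (Ioo_subset_Icc_self hy), sub_self]
  · exact (hsol.isLittleO_lateralBoundary hL hV).sub
      ((hsolT.isLittleO_lateralBoundary hL hV).comp_tendsto
        (tendsto_lateralBoundary_add_const L (sub_nonneg.2 hs) (by linarith)))

end IsFundamentalSolution

/-! ### Time integrals of a solution -/

theorem intervalIntegrable_of_continuousOn_Ioo {f : ℝ → ℝ} {α β x z : ℝ}
    (hf : ContinuousOn f (Ioo α β)) (hx : x ∈ Ioo α β) (hz : z ∈ Ioo α β) :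
    IntervalIntegrable f volume x z :=
  (hf.mono (ordConnected_Ioo.uIcc_subset hx hz)).intervalIntegrable

theorem hasDerivAt_integral_left_of_continuousOn_Ioo {f : ℝ → ℝ} {α β x z : ℝ}
    (hf : ContinuousOn f (Ioo α β)) (hx : x ∈ Ioo α β) (hz : z ∈ Ioo α β) :
    HasDerivAt (fun u => ∫ y in u..z, f y) (-f x) x :=
  intervalIntegral.integral_hasDerivAt_left (intervalIntegrable_of_continuousOn_Ioo hf hx hz)
    (hf.stronglyMeasurableAtFilter isOpen_Ioo x hx) (hf.continuousAt (isOpen_Ioo.mem_nhds hx))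

theorem hasDerivAt_intervalIntegral_of_continuousOn {G G' : ℝ → ℝ → ℝ} {t S α β y : ℝ}
    (hy : y ∈ Ioo α β) (hG : ∀ r ∈ uIcc t S, ∀ y ∈ Ioo α β, HasDerivAt (G r) (G' r y) y)
    (hGc : ∀ y ∈ Ioo α β, ContinuousOn (fun r => G r y) (uIcc t S))
    (hG'c : ContinuousOn (fun p : ℝ × ℝ => G' p.1 p.2) (uIcc t S ×ˢ Ioo α β)) :
    HasDerivAt (fun y => ∫ r in t..S, G r y) (∫ r in t..S, G' r y) y := by
  obtain ⟨l, hαl, hly⟩ := exists_between hy.1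
  obtain ⟨u, hyu, huβ⟩ := exists_between hy.2
  have hsub : Icc l u ⊆ Ioo α β := fun z hz => ⟨hαl.trans_le hz.1, hz.2.trans_lt huβ⟩
  obtain ⟨C, hC⟩ := (isCompact_uIcc.prod isCompact_Icc).exists_bound_of_continuousOn
    (hG'c.mono (prod_mono_right hsub))
  refine (intervalIntegral.hasDerivAt_integral_of_dominated_loc_of_deriv_le
    (F := fun y r => G r y) (F' := fun y r => G' r y) (bound := fun _ => C) (s := Icc l u)
    (Icc_mem_nhds hly hyu) ?_ (hGc y hy).intervalIntegrable ?_ ?_ intervalIntegrable_const ?_).2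
  · filter_upwards [isOpen_Ioo.mem_nhds hy] with z hz
    exact ((hGc z hz).mono uIoc_subset_uIcc).aestronglyMeasurable measurableSet_uIoc
  · exact ((hG'c.uncurry_right (f := G') y hy).mono uIoc_subset_uIcc).aestronglyMeasurable
      measurableSet_uIoc
  · exact Eventually.of_forall fun r hr z hz => hC (r, z) ⟨uIoc_subset_uIcc hr, hz⟩
  · exact Eventually.of_forall fun r hr z hz => hG r (uIoc_subset_uIcc hr) z (hsub hz)

theorem continuousOn_intervalIntegral_of_continuousOn {G : ℝ → ℝ → ℝ} {α β l u : ℝ}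
    (hG : ContinuousOn (fun p : ℝ × ℝ => G p.1 p.2) (Icc α β ×ˢ Icc l u)) :
    ContinuousOn (fun p : (ℝ × ℝ) × ℝ => ∫ r in p.1.1..p.2, G r p.1.2)
      ((Icc α β ×ˢ Icc l u) ×ˢ Icc α β) := by
  rcases lt_or_ge β α with hαβ | hαβ
  · simp [Icc_eq_empty hαβ.not_ge]
  rcases lt_or_ge u l with hlu | hlu
  · simp [Icc_eq_empty hlu.not_ge]
  set Ĝ : ℝ → ℝ → ℝ := fun r x => G (projIcc α β hαβ r) (projIcc l u hlu x)
  have hĜ : Continuous fun p : ℝ × ℝ => Ĝ p.1 p.2 :=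
    hG.comp_continuous
      (f := fun p : ℝ × ℝ => ((projIcc α β hαβ p.1 : ℝ), (projIcc l u hlu p.2 : ℝ)))
      (by fun_prop) fun p => ⟨Subtype.coe_prop _, Subtype.coe_prop _⟩
  have hprim : ∀ g : (ℝ × ℝ) × ℝ → ℝ, Continuous g →
      Continuous fun p : (ℝ × ℝ) × ℝ => ∫ r in α..g p, Ĝ r p.1.2 := fun g hg =>
    intervalIntegral.continuous_parametric_intervalIntegral_of_continuous
      (f := fun (p : (ℝ × ℝ) × ℝ) r => Ĝ r p.1.2)
      (hĜ.comp (f := fun q : ((ℝ × ℝ) × ℝ) × ℝ => (q.2, q.1.1.2)) (by fun_prop)) hg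
  refine ((hprim _ continuous_snd).sub (hprim _ (by fun_prop : Continuous fun p => p.1.1)))
    |>.continuousOn.congr fun p hp => ?_
  have hĜint : ∀ c d, IntervalIntegrable (fun r => Ĝ r p.1.2) volume c d := fun c d =>
    (hĜ.comp (f := fun r : ℝ => (r, p.1.2)) (by fun_prop)).intervalIntegrable c d
  simp only [Pi.sub_apply]
  rw [intervalIntegral.integral_interval_sub_left (hĜint _ _) (hĜint _ _)]
  refine intervalIntegral.integral_congr fun r hr => ?_
  simp only [Ĝ]
  rw [projIcc_of_mem hαβ (ordConnected_Icc.uIcc_subset hp.1.1 hp.2 hr),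
    projIcc_of_mem hlu hp.1.2]

namespace SolvesBackwardPDE

variable {L T : ℝ} {b σ : ℝ → ℝ} {v : ℝ → ℝ → ℝ} {a a' : ℝ → ℝ} {t S x : ℝ}

theorem integral_mul_generator (hv : SolvesBackwardPDE L T b σ (fun _ => 0) v)
    (ha : ∀ r, HasDerivAt a (a' r) r) (ha' : Continuous a') (ht : t ∈ Ioo 0 T) (hS : S ∈ Ioo 0 T)
    (hx : x ∈ Ioo 0 L) :
    b x * (∫ r in t..S, a r * deriv (v r) x) +
        1 / 2 * σ x ^ 2 * (∫ r in t..S, a r * deriv (deriv (v r)) x) =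
      (∫ r in t..S, a' r * v r x) - a S * v S x + a t * v t x := by
  have hsub : uIcc t S ⊆ Ioo 0 T := ordConnected_Ioo.uIcc_subset ht hS
  have hac : Continuous a := continuous_iff_continuousAt.2 fun r => (ha r).continuousAt
  have hint : ∀ {w : ℝ → ℝ → ℝ}, ContinuousOn (fun p : ℝ × ℝ => w p.1 p.2) (Ioo 0 T ×ˢ Ioo 0 L) →
      IntervalIntegrable (fun r => a r * w r x) volume t S := fun {w} hw =>
    intervalIntegrable_of_continuousOn_Ioo
      (hac.continuousOn.mul (hw.uncurry_right (f := w) x hx)) ht hS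
  have hparts := intervalIntegral.integral_mul_deriv_eq_deriv_mul (u := a) (v := fun r => v r x)
    (fun r _ => ha r) (fun r hr => (hv.diff_time r (hsub hr) x hx).hasDerivAt)
    (ha'.intervalIntegrable t S) ((hv.cont_time.uncurry_right
      (f := fun r y => deriv (fun s => v s y) r) x hx).mono hsub).intervalIntegrable
  have hpde : ∀ r ∈ uIcc t S, b x * (a r * deriv (v r) x) +
      1 / 2 * σ x ^ 2 * (a r * deriv (deriv (v r)) x) = -(a r * deriv (fun s => v s x) r) := by
    intro r hr
    have := hv.pde r (hsub hr) x hx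
    unfold generator at this
    linear_combination a r * this
  rw [← intervalIntegral.integral_const_mul, ← intervalIntegral.integral_const_mul,
    ← intervalIntegral.integral_add ((hint (w := fun r => deriv (v r)) hv.cont_space).const_mul _)
      ((hint (w := fun r => deriv (deriv (v r))) hv.cont_space_two).const_mul _),
    intervalIntegral.integral_congr hpde, intervalIntegral.integral_neg, hparts]
  ring

theorem hasParabolicAt_integral (hv : SolvesBackwardPDE L T b σ (fun _ => 0) v)
    (hvc : ContinuousOn (fun p : ℝ × ℝ => v p.1 p.2) (Ioo 0 T ×ˢ Ioo 0 L))
    (ha : ∀ r, HasDerivAt a (a' r) r) (ha' : Continuous a') (ht : t ∈ Ioo 0 T) (hS : S ∈ Ioo 0 T)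
    (hx : x ∈ Ioo 0 L) :
    HasParabolicAt b σ (fun t x => ∫ r in t..S, a r * v r x) t x
      ((∫ r in t..S, a' r * v r x) - a S * v S x) := by
  have hsub : uIcc t S ⊆ Ioo 0 T := ordConnected_Ioo.uIcc_subset ht hS
  have hac : Continuous a := continuous_iff_continuousAt.2 fun r => (ha r).continuousAt
  have hmul : ∀ {w : ℝ → ℝ → ℝ}, ContinuousOn (fun p : ℝ × ℝ => w p.1 p.2) (Ioo 0 T ×ˢ Ioo 0 L) →
      ContinuousOn (fun p : ℝ × ℝ => a p.1 * w p.1 p.2) (Ioo 0 T ×ˢ Ioo 0 L) := fun hw =>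
    (hac.comp continuous_fst).continuousOn.mul hw
  have hspace : ∀ {w w' : ℝ → ℝ → ℝ},
      ContinuousOn (fun p : ℝ × ℝ => w p.1 p.2) (Ioo 0 T ×ˢ Ioo 0 L) →
      ContinuousOn (fun p : ℝ × ℝ => w' p.1 p.2) (Ioo 0 T ×ˢ Ioo 0 L) →
      (∀ r ∈ Ioo 0 T, ∀ y ∈ Ioo 0 L, HasDerivAt (w r) (w' r y) y) → ∀ y ∈ Ioo 0 L,
      HasDerivAt (fun y => ∫ r in t..S, a r * w r y) (∫ r in t..S, a r * w' r y) y :=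
    fun {w w'} hw hw' hderiv y hy =>
      hasDerivAt_intervalIntegral_of_continuousOn (G := fun r y => a r * w r y)
        (G' := fun r y => a r * w' r y) hy
        (fun r hr z hz => (hderiv r (hsub hr) z hz).const_mul (a r))
        (fun z hz => ((hmul hw).uncurry_right (f := fun r y => a r * w r y) z hz).mono hsub)
        ((hmul hw').mono (prod_mono_left hsub))
  refine ⟨_, fun y => ∫ r in t..S, a r * deriv (v r) y, _,
    hasDerivAt_integral_left_of_continuousOn_Ioo
      ((hmul hvc).uncurry_right (f := fun r y => a r * v r y) x hx) ht hS, ?_,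
    hspace hv.cont_space hv.cont_space_two
      (fun r hr y hy => (hv.diff_space_two r hr y hy).hasDerivAt) x hx, ?_⟩
  · filter_upwards [isOpen_Ioo.mem_nhds hx] with y hy
    exact hspace hvc hv.cont_space (fun r hr y hy => (hv.diff_space r hr y hy).hasDerivAt) y hy
  · rw [hv.integral_mul_generator ha ha' ht hS hx]
    ring

end SolvesBackwardPDE

/-- The Duhamel potential `∫ₜᵀ e^{-k s} (evolution of φ from s back to t) ds` of the source
`e^{-k s} φ(x)`, where `v` is the solution with terminal value `φ` at time `T`. Homogeneity in time
turns the evolution from `s` into `v r` with `r = t + T - s`; the integral over `r` is cut off at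
`S`, because `v` is not differentiable at the terminal time. -/
def potential (T k : ℝ) (v : ℝ → ℝ → ℝ) (S t x : ℝ) : ℝ :=
  Real.exp (-k * t) * ∫ r in t..S, Real.exp (-k * (T - r)) * v r x

theorem SolvesBackwardPDE.hasParabolicAt_potential {L T k : ℝ} {b σ : ℝ → ℝ} {v : ℝ → ℝ → ℝ}
    (hv : SolvesBackwardPDE L T b σ (fun _ => 0) v)
    (hvc : ContinuousOn (fun p : ℝ × ℝ => v p.1 p.2) (Ioo 0 T ×ˢ Ioo 0 L)) {S t x : ℝ}
    (ht : t ∈ Ioo 0 T) (hS : S ∈ Ioo 0 T) (hx : x ∈ Ioo 0 L) :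
    HasParabolicAt b σ (potential T k v S) t x (-(Real.exp (-k * (t + (T - S))) * v S x)) := by
  have hweight : ∀ r, HasDerivAt (fun r => Real.exp (-k * (T - r)))
      (k * Real.exp (-k * (T - r))) r := fun r => by
    simpa [mul_comm] using (((hasDerivAt_id r).const_sub T).const_mul (-k)).exp
  have hexp : HasDerivAt (fun s => Real.exp (-k * s)) (-k * Real.exp (-k * t)) t := by
    simpa [mul_comm] using ((hasDerivAt_id t).const_mul (-k)).exp
  obtain ⟨qt, D, d, h1, h2, h3, h4⟩ :=
    hv.hasParabolicAt_integral hvc hweight (by fun_prop) ht hS hx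
  refine ⟨_, fun y => Real.exp (-k * t) * D y, _, hexp.mul h1, ?_, h3.const_mul _, ?_⟩
  · filter_upwards [h2] with y hy using hy.const_mul _
  · simp only [mul_assoc, intervalIntegral.integral_const_mul] at h4
    rw [mul_add (-k), Real.exp_add]
    linear_combination Real.exp (-k * t) * h4

theorem continuousOn_potential {T k l u : ℝ} {v : ℝ → ℝ → ℝ}
    (hv : ContinuousOn (fun p : ℝ × ℝ => v p.1 p.2) (Icc 0 T ×ˢ Icc l u)) :
    ContinuousOn (fun p : (ℝ × ℝ) × ℝ => potential T k v p.2 p.1.1 p.1.2)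
      ((Icc 0 T ×ˢ Icc l u) ×ˢ Icc 0 T) :=
  ContinuousOn.mul (by fun_prop) (continuousOn_intervalIntegral_of_continuousOn
    (G := fun r x => Real.exp (-k * (T - r)) * v r x)
    ((by fun_prop : Continuous fun p : ℝ × ℝ => Real.exp (-k * (T - p.1))).continuousOn.mul hv))

theorem potential_self (T k : ℝ) (v : ℝ → ℝ → ℝ) (t x : ℝ) : potential T k v t t x = 0 := by
  simp [potential]

theorem eventually_forall_abs_sub_lt {X Y : Type*} [TopologicalSpace X] [TopologicalSpace Y]
    {K : Set X} {s : Set Y} {k : X × Y → ℝ} {e : Y} (hK : IsCompact K)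
    (hk : ContinuousOn k (K ×ˢ s)) (he : e ∈ s) {δ : ℝ} (hδ : 0 < δ) :
    ∀ᶠ y in 𝓝[s] e, ∀ x ∈ K, |k (x, y) - k (x, e)| < δ := by
  have hke : ContinuousOn (fun p : X × Y => k (p.1, e)) (K ×ˢ s) :=
    hk.comp (by fun_prop) fun p hp => ⟨hp.1, he⟩
  have hlim := tendsto_zero_of_continuousOn_prod hK (hk.sub hke) he fun x _ => sub_self _
  rw [prod_comm] at hlim
  exact eventually_prod_principal_iff.1 (hlim.eventually (Metric.ball_mem_nhds 0 hδ)) |>.mono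
    fun y hy x hx => by simpa [Metric.mem_ball, Real.dist_eq] using hy x hx

theorem nonneg_add_of_cutoff {b σ : ℝ → ℝ} {t₀ T l u : ℝ} {q : ℝ → ℝ → ℝ} {P R : ℝ → ℝ → ℝ → ℝ}
    (hq : ContinuousOn (fun p : ℝ × ℝ => q p.1 p.2) (Icc t₀ T ×ˢ Icc l u))
    (hqpar : ∀ t ∈ Ioo t₀ T, ∀ x ∈ Ioo l u, ∃ ℓ ≤ R T t x, HasParabolicAt b σ q t x ℓ)
    (hP : ContinuousOn (fun p : (ℝ × ℝ) × ℝ => P p.2 p.1.1 p.1.2)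
      ((Icc t₀ T ×ˢ Icc l u) ×ˢ Icc t₀ T))
    (hR : ContinuousOn (fun p : (ℝ × ℝ) × ℝ => R p.2 p.1.1 p.1.2)
      ((Icc t₀ T ×ˢ Icc l u) ×ˢ Icc t₀ T))
    (hPpar : ∀ S ∈ Ioo t₀ T, ∀ t ∈ Ioo t₀ S, ∀ x ∈ Ioo l u,
      HasParabolicAt b σ (P S) t x (-R S t x))
    (hPself : ∀ S x, P S S x = 0)
    (hbd : ∀ t ∈ Icc t₀ T, ∀ x ∈ Icc l u, t = T ∨ x = l ∨ x = u → 0 ≤ q t x + P T t x) :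
    ∀ t ∈ Icc t₀ T, ∀ x ∈ Icc l u, 0 ≤ q t x + P T t x := by
  intro t ht x hx
  rcases ht.2.eq_or_lt with rfl | htT
  · exact hbd t ht x hx (.inl rfl)
  have htT' : t₀ ≤ T := ht.1.trans ht.2
  have hT : T ∈ Icc t₀ T := right_mem_Icc.2 htT'
  have hK : IsCompact (Icc t₀ T ×ˢ Icc l u) := isCompact_Icc.prod isCompact_Icc
  have hperturbed : ∀ δ > 0, 0 ≤ q t x + P T t x + δ * (2 + (T - t)) := by
    intro δ hδ
    have hlater : ∀ᶠ S in 𝓝[<] T, S ∈ Ioo t T := Ioo_mem_nhdsLT htT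
    have hle : 𝓝[<] T ≤ 𝓝[Icc t₀ T] T :=
      nhdsWithin_le_of_mem (mem_of_superset hlater fun S hS => ⟨ht.1.trans hS.1.le, hS.2.le⟩)
    obtain ⟨S, ⟨⟨hqS, hPS⟩, hRS⟩, htS, hST⟩ :=
      ((((eventually_forall_abs_sub_lt hK (hq.comp (f := fun p : (ℝ × ℝ) × ℝ => (p.2, p.1.2))
        (by fun_prop) fun p hp => ⟨hp.2, hp.1.2⟩) hT hδ).and
        (eventually_forall_abs_sub_lt hK hP hT hδ)).and
        (eventually_forall_abs_sub_lt hK hR hT hδ)).filter_mono hle |>.and hlater).exists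
    have hsub : Icc t₀ S ⊆ Icc t₀ T := Icc_subset_Icc_right hST.le
    have hS : S ∈ Icc t₀ T := ⟨ht.1.trans htS.le, hST.le⟩
    have hcut := nonneg_of_hasParabolicAt_nonpos (b := b) (σ := σ) (S₀ := t₀) (S := S) (l := l)
      (r := u) (q := fun t x => q t x + P S t x + δ * (1 + (T - t))) ?_ ?_ ?_ t ⟨ht.1, htS.le⟩ x hx
    · linarith [(abs_lt.1 (hPS (t, x) ⟨ht, hx⟩)).2]
    · refine (ContinuousOn.add (hq.mono (prod_mono_left hsub)) ?_).add (by fun_prop)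
      exact hP.comp (f := fun p : ℝ × ℝ => (p, S)) (by fun_prop) fun p hp => ⟨⟨hsub hp.1, hp.2⟩, hS⟩
    · intro r hr y hy
      obtain ⟨ℓ, hℓ, hqr⟩ := hqpar r ⟨hr.1, hr.2.trans hST⟩ y hy
      refine ⟨_, ?_, (hqr.add (hPpar S ⟨ht.1.trans_lt htS, hST⟩ r hr y hy)).add
        (.of_time ((((hasDerivAt_id r).const_sub T).const_add 1).const_mul δ))⟩
      linarith [(abs_lt.1 (hRS (r, y) ⟨hsub (Ioo_subset_Icc_self hr), Ioo_subset_Icc_self hy⟩)).1]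
    · intro r hr y hy hrb
      have hδr : 0 ≤ δ * (T - r) := mul_nonneg hδ.le (by linarith [hr.2])
      rcases hrb with rfl | hyb
      · have hqr : |q r y - q T y| < δ := hqS (T, y) ⟨hT, hy⟩
        have := hbd T hT y hy (.inl rfl)
        rw [hPself] at this ⊢
        linarith [(abs_lt.1 hqr).1]
      · linarith [hbd r (hsub hr) y hy (.inr hyb), (abs_lt.1 (hPS (r, y) ⟨hsub hr, hy⟩)).1]
  exact nonneg_of_forall_pos_nonneg_add_mul hperturbed

theorem nonneg_add_sum_potential {ι : Type*} {acc : Prop} {L T t₀ l u : ℝ} {b σ : ℝ → ℝ}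
    {q : ℝ → ℝ → ℝ} (I : Finset ι) {k : ι → ℝ} {φ : ι → ℝ → ℝ} {Y : ι → ℝ → ℝ → ℝ}
    (hY : ∀ i ∈ I, IsClassicalSolution acc L T b σ (fun _ => 0) (φ i) (fun _ => 0) (fun _ => 0)
      (Y i))
    (ht₀ : 0 ≤ t₀) (hlu : Icc l u ⊆ Ioo 0 L)
    (hq : ContinuousOn (fun p : ℝ × ℝ => q p.1 p.2) (Icc t₀ T ×ˢ Icc l u))
    (hqpar : ∀ t ∈ Ioo t₀ T, ∀ x ∈ Ioo l u,
      ∃ ℓ ≤ ∑ i ∈ I, Real.exp (-k i * t) * φ i x, HasParabolicAt b σ q t x ℓ)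
    (hbd : ∀ t ∈ Icc t₀ T, ∀ x ∈ Icc l u, t = T ∨ x = l ∨ x = u →
      0 ≤ q t x + ∑ i ∈ I, potential T (k i) (Y i) T t x) :
    ∀ t ∈ Icc t₀ T, ∀ x ∈ Icc l u, 0 ≤ q t x + ∑ i ∈ I, potential T (k i) (Y i) T t x := by
  have hsub : Icc t₀ T ⊆ Icc 0 T := Icc_subset_Icc_left ht₀
  have hYc : ∀ i ∈ I, ContinuousOn (fun p : ℝ × ℝ => Y i p.1 p.2) (Icc 0 T ×ˢ Icc l u) :=
    fun i hi => (hY i hi).continuousOn.mono (prod_mono_right (hlu.trans Ioo_subset_Icc_self))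
  refine nonneg_add_of_cutoff (b := b) (σ := σ)
    (P := fun S t x => ∑ i ∈ I, potential T (k i) (Y i) S t x)
    (R := fun S t x => ∑ i ∈ I, Real.exp (-k i * (t + (T - S))) * Y i S x) hq ?_ ?_ ?_ ?_ ?_ hbd
  · intro t ht x hx
    obtain ⟨ℓ, hℓ, hqt⟩ := hqpar t ht x hx
    refine ⟨ℓ, hℓ.trans_eq (Finset.sum_congr rfl fun i hi => ?_), hqt⟩
    rw [sub_self, add_zero,
      (hY i hi).terminal x (Ioo_subset_Icc_self (hlu (Ioo_subset_Icc_self hx)))]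
  · exact continuousOn_finsetSum I fun i hi =>
      (continuousOn_potential (hYc i hi)).mono (prod_mono (prod_mono_left hsub) hsub)
  · exact continuousOn_finsetSum I fun i hi => ContinuousOn.mul (by fun_prop)
      ((hYc i hi).comp (f := fun p : (ℝ × ℝ) × ℝ => (p.2, p.1.2)) (by fun_prop)
        fun p hp => ⟨hsub hp.2, hp.1.2⟩)
  · intro S hS t ht x hx
    have hS₀ : S ∈ Ioo 0 T := ⟨ht₀.trans_lt hS.1, hS.2⟩
    simpa only [Finset.sum_neg_distrib] using HasParabolicAt.sum I fun i hi =>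
      (hY i hi).solves.hasParabolicAt_potential (k := k i)
        ((hY i hi).continuousOn.mono (prod_mono Ioo_subset_Icc_self Ioo_subset_Icc_self))
        ⟨ht₀.trans_lt ht.1, ht.2.trans hS.2⟩ hS₀ (hlu (Ioo_subset_Icc_self hx))
  · exact fun S x => Finset.sum_eq_zero fun i _ => potential_self _ _ _ _ _

/-! ### Duhamel's formula for sources with compact support -/

theorem exists_isTest_eq_one {L : ℝ} {K : Set ℝ} (hK : IsCompact K) (hKL : K ⊆ Ioo 0 L) :
    ∃ χ : ℝ → ℝ, IsTest L χ ∧ (∀ x ∈ K, χ x = 1) ∧ ∀ x, χ x ∈ Icc (0 : ℝ) 1 := by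
  obtain ⟨k, hk, hKk, hkL⟩ := exists_compact_between hK isOpen_Ioo hKL
  obtain ⟨χ, h1, h0, hc, h01⟩ := exists_continuous_one_zero_of_isCompact hK
    isOpen_interior.isClosed_compl (disjoint_compl_right_iff_subset.2 hKk)
  refine ⟨χ, ⟨χ.continuous, hc, ?_⟩, fun x hx => h1 hx, h01⟩
  refine (closure_minimal (fun x hx => ?_) hk.isClosed).trans hkL
  by_contra hxk
  exact hx (h0 fun h => hxk (interior_subset h))

/-- Jointly continuous functions of `(s, x)` supported in `ℝ × K` for some compact `K ⊆ (0, L)`: the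
time-dependent counterpart of `IsTest`, used as right-hand sides of the backward equation. -/
structure IsTestSource (L : ℝ) (H : ℝ → ℝ → ℝ) : Prop where
  continuous : Continuous fun p : ℝ × ℝ => H p.1 p.2
  exists_isCompact : ∃ K, IsCompact K ∧ K ⊆ Ioo 0 L ∧ ∀ s, ∀ x ∉ K, H s x = 0

namespace IsTestSource

variable {L : ℝ} {H : ℝ → ℝ → ℝ}

theorem isTest (hH : IsTestSource L H) (s : ℝ) : IsTest L (H s) := by
  obtain ⟨K, hK, hKL, hHK⟩ := hH.exists_isCompact
  have hsupp : tsupport (H s) ⊆ K :=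
    closure_minimal (fun x hx => by_contra fun hxK => hx (hHK s x hxK)) hK.isClosed
  exact ⟨hH.continuous.comp (f := fun x => (s, x)) (by fun_prop),
    HasCompactSupport.intro hK (hHK s), hsupp.trans hKL⟩

theorem sum_exp_mul {ι : Type*} (I : Finset ι) (k : ι → ℝ) {φ : ι → ℝ → ℝ}
    (hφ : ∀ i ∈ I, IsTest L (φ i)) :
    IsTestSource L fun s x => ∑ i ∈ I, Real.exp (-k i * s) * φ i x where
  continuous := continuous_finsetSum I fun i hi =>
    Continuous.mul (by fun_prop) ((hφ i hi).continuous.comp continuous_snd)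
  exists_isCompact := by
    refine ⟨⋃ i ∈ I, tsupport (φ i), I.isCompact_biUnion fun i hi => (hφ i hi).hasCompactSupport,
      iUnion₂_subset fun i hi => (hφ i hi).tsupport_subset, fun s x hx => ?_⟩
    simp only [mem_iUnion, not_exists] at hx
    exact Finset.sum_eq_zero fun i hi => by
      rw [image_eq_zero_of_notMem_tsupport (hx i hi), mul_zero]

end IsTestSource

theorem IsTest.isTestSource_mul {L : ℝ} {F : ℝ → ℝ → ℝ} {χ : ℝ → ℝ} (hχ : IsTest L χ)
    (hF : ContinuousOn (fun p : ℝ × ℝ => F p.1 p.2) (univ ×ˢ Ioo 0 L)) :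
    IsTestSource L fun s x => F s x * χ x where
  continuous := by
    refine continuous_iff_continuousAt.2 fun p => ?_
    by_cases hp : p.2 ∈ tsupport χ
    · exact (hF.continuousAt ((isOpen_univ.prod isOpen_Ioo).mem_nhds
        ⟨mem_univ _, hχ.tsupport_subset hp⟩)).mul
          (hχ.continuous.comp continuous_snd).continuousAt
    · have hzero : (fun p : ℝ × ℝ => F p.1 p.2 * χ p.2) =ᶠ[𝓝 p] fun _ => 0 := by
        filter_upwards [continuous_snd.continuousAt.eventually
          (notMem_tsupport_iff_eventuallyEq.1 hp)] with r hr
        simp only [hr, Pi.zero_apply, mul_zero]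
      exact continuousAt_const.congr hzero.symm
  exists_isCompact := ⟨tsupport χ, hχ.hasCompactSupport, hχ.tsupport_subset, fun s x hx => by
    rw [image_eq_zero_of_notMem_tsupport hx, mul_zero]⟩

/-- Stone–Weierstrass for the algebra of polynomials in `e^{-s}` whose coefficients are continuous
functions of `x`. -/
theorem exists_sum_exp_mul_near {H : ℝ → ℝ → ℝ} (hH : Continuous fun p : ℝ × ℝ => H p.1 p.2)
    (T : ℝ) {K : Set ℝ} (hK : IsCompact K) {ε : ℝ} (hε : 0 < ε) :
    ∃ (I : Finset ℕ) (φ : ℕ → ℝ → ℝ), (∀ k, Continuous (φ k)) ∧ ∀ s ∈ Icc 0 T, ∀ x ∈ K,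
      |(∑ k ∈ I, Real.exp (-k * s) * φ k x) - H s x| < ε := by
  let ι : C(ℝ, ℝ) →ₐ[ℝ] C(ℝ × ℝ, ℝ) :=
    ContinuousMap.compRightAlgHom ℝ ℝ (⟨Prod.snd, continuous_snd⟩ : C(ℝ × ℝ, ℝ))
  let e : C(ℝ × ℝ, ℝ) := ⟨fun p => Real.exp (-p.1), by fun_prop⟩
  let Ψ : Polynomial C(ℝ, ℝ) →ₐ[ℝ] C(ℝ × ℝ, ℝ) :=
    Polynomial.eval₂AlgHom ι e fun a => Commute.all _ _
  have hsep : Ψ.range.SeparatesPoints := by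
    rintro ⟨s, x⟩ ⟨s', x'⟩ hne
    by_cases hx : x = x'
    · have hs : s ≠ s' := fun h => hne (by rw [h, hx])
      refine ⟨_, ⟨Ψ Polynomial.X, ⟨_, rfl⟩, rfl⟩, ?_⟩
      simpa [Ψ, e] using hs
    · refine ⟨_, ⟨Ψ (Polynomial.C (ContinuousMap.id ℝ)), ⟨_, rfl⟩, rfl⟩, ?_⟩
      simpa [Ψ, ι] using hx
  obtain ⟨_, ⟨p, rfl⟩, hp⟩ :=
    ContinuousMap.exists_mem_subalgebra_near_continuous_of_isCompact_of_separatesPoints hsep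
      ⟨fun p : ℝ × ℝ => H p.1 p.2, hH⟩ ((isCompact_Icc (a := 0) (b := T)).prod hK) hε
  have heval : ∀ s x, Ψ p (s, x) = ∑ k ∈ p.support, Real.exp (-k * s) * p.coeff k x := by
    intro s x
    change (Polynomial.eval₂ (ι : C(ℝ, ℝ) →+* C(ℝ × ℝ, ℝ)) e p) (s, x) = _
    rw [Polynomial.eval₂_eq_sum, Polynomial.sum, ContinuousMap.sum_apply]
    refine Finset.sum_congr rfl fun k _ => ?_
    rw [neg_mul, ← mul_neg, Real.exp_nat_mul, mul_comm]
    rfl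
  refine ⟨p.support, fun k => p.coeff k, fun k => (p.coeff k).continuous, fun s hs x hx => ?_⟩
  rw [← heval]
  exact hp (s, x) ⟨hs, hx⟩

theorem IsTestSource.exists_sum_exp_mul_near {L : ℝ} {H : ℝ → ℝ → ℝ} (hH : IsTestSource L H)
    (T : ℝ) {ε : ℝ} (hε : 0 < ε) :
    ∃ (I : Finset ℕ) (φ : ℕ → ℝ → ℝ), (∀ k, IsTest L (φ k)) ∧ ∀ s ∈ Icc 0 T, ∀ x,
      |(∑ k ∈ I, Real.exp (-k * s) * φ k x) - H s x| ≤ ε := by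
  obtain ⟨K, hK, hKL, hHK⟩ := hH.exists_isCompact
  obtain ⟨χ, hχ, hχ1, hχ01⟩ := exists_isTest_eq_one hK hKL
  obtain ⟨I, φ, hφ, hnear⟩ := ShortRate.exists_sum_exp_mul_near hH.continuous T
    hχ.hasCompactSupport.isCompact hε
  refine ⟨I, fun k x => φ k x * χ x, fun k => hχ.mul (hφ k).continuousOn, fun s hs x => ?_⟩
  have hHχ : H s x = H s x * χ x := by
    by_cases hx : x ∈ K
    · rw [hχ1 x hx, mul_one]
    · rw [hHK s x hx, zero_mul]
  have hfactor : (∑ k ∈ I, Real.exp (-k * s) * (φ k x * χ x)) - H s x =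
      ((∑ k ∈ I, Real.exp (-k * s) * φ k x) - H s x) * χ x := by
    rw [sub_mul, ← hHχ, Finset.sum_mul]
    simp only [mul_assoc]
  rw [hfactor, abs_mul, abs_of_nonneg (hχ01 x).1]
  by_cases hx : x ∈ tsupport χ
  · exact (mul_le_of_le_one_right (abs_nonneg _) (hχ01 x).2).trans (hnear s hs x hx).le
  · rw [image_eq_zero_of_notMem_tsupport hx, mul_zero]
    exact hε.le

/-- Duhamel's integral of the source `H`, the formal solution of the backward equation with
right-hand side `-H` and zero terminal value at time `T`. -/
def duhamel (Γ : ℝ → ℝ → ℝ → ℝ → ℝ) (L T : ℝ) (H : ℝ → ℝ → ℝ) (t x : ℝ) : ℝ :=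
  ∫ s in t..T, evolve Γ L (H s) s t x

namespace IsFundamentalSolution

variable {acc : Prop} {L T : ℝ} {b σ V : ℝ → ℝ} {Γ : ℝ → ℝ → ℝ → ℝ → ℝ} {t x : ℝ}

theorem continuousOn_evolve_terminal (hΓ : IsFundamentalSolution acc L T b σ Γ) {φ : ℝ → ℝ}
    (hφ : IsTest L φ) (ht : t ∈ Ico 0 T) (hx : x ∈ Icc 0 L) :
    ContinuousOn (fun s => evolve Γ L φ T (t + (T - s)) x) (Icc t T) := by
  refine (hΓ.isClassicalSolution_evolve ⟨ht.1.trans_lt ht.2, le_rfl⟩ hφ).continuousOn.comp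
    (f := fun s : ℝ => (t + (T - s), x)) (by fun_prop) fun s hs => ⟨⟨?_, ?_⟩, hx⟩
  · linarith [hs.2, ht.1]
  · linarith [hs.1]

theorem evolve_sum_exp_mul (hΓ : IsFundamentalSolution acc L T b σ Γ) (hV : IsLyapunov acc L b σ V)
    {s : ℝ} (hs : s ≤ T) (ht : t ∈ Icc 0 s) (hx : x ∈ Ioo 0 L) {ι : Type*} (I : Finset ι)
    (k : ι → ℝ) {φ : ι → ℝ → ℝ} (hφ : ∀ i ∈ I, IsTest L (φ i)) :
    evolve Γ L (fun y => ∑ i ∈ I, Real.exp (-k i * s) * φ i y) s t x =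
      ∑ i ∈ I, Real.exp (-k i * s) * evolve Γ L (φ i) T (t + (T - s)) x := by
  rw [hΓ.evolve_sum hs ht (Ioo_subset_Icc_self hx) I fun i hi => (hφ i hi).const_mul _]
  refine Finset.sum_congr rfl fun i hi => ?_
  rw [evolve_const_mul, hΓ.evolve_eq_evolve_add hV hs ht hx (hφ i hi)]

theorem continuousOn_evolve_source (hΓ : IsFundamentalSolution acc L T b σ Γ)
    (hV : IsLyapunov acc L b σ V) {H : ℝ → ℝ → ℝ} (hH : IsTestSource L H) (ht : t ∈ Ico 0 T)
    (hx : x ∈ Ioo 0 L) : ContinuousOn (fun s => evolve Γ L (H s) s t x) (Icc t T) := by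
  have hmem : ∀ {s}, s ∈ Icc t T → s ∈ Icc 0 T := fun hs => ⟨ht.1.trans hs.1, hs.2⟩
  refine continuousOn_of_uniform_approx_of_continuousOn fun U hU => ?_
  obtain ⟨ε, hε, hεU⟩ := Metric.mem_uniformity_dist.1 hU
  obtain ⟨I, φ, hφ, hnear⟩ := hH.exists_sum_exp_mul_near T (half_pos hε)
  refine ⟨fun s => ∑ k ∈ I, Real.exp (-k * s) * evolve Γ L (φ k) T (t + (T - s)) x,
    continuousOn_finsetSum I fun k _ => ContinuousOn.mul (by fun_prop)
      (hΓ.continuousOn_evolve_terminal (hφ k) ht (Ioo_subset_Icc_self hx)), fun s hs => hεU ?_⟩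
  have hN : IsTest L fun y => ∑ k ∈ I, Real.exp (-k * s) * φ k y :=
    IsTest.sum I fun k _ => (hφ k).const_mul _
  beta_reduce
  rw [← hΓ.evolve_sum_exp_mul hV hs.2 ⟨ht.1, hs.1⟩ hx I (fun k => (k : ℝ)) fun k _ => hφ k,
    Real.dist_eq, abs_sub_comm,
    ← hΓ.evolve_sub hs.2 ⟨ht.1, hs.1⟩ (Ioo_subset_Icc_self hx) hN (hH.isTest s)]
  exact (hΓ.abs_evolve_le hV hs.2 ⟨ht.1, hs.1⟩ hx (hN.sub (hH.isTest s))
    (hnear s (hmem hs))).trans_lt (half_lt_self hε)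

theorem intervalIntegrable_evolve_source (hΓ : IsFundamentalSolution acc L T b σ Γ)
    (hV : IsLyapunov acc L b σ V) {H : ℝ → ℝ → ℝ} (hH : IsTestSource L H) (ht : t ∈ Ico 0 T)
    (hx : x ∈ Ioo 0 L) : IntervalIntegrable (fun s => evolve Γ L (H s) s t x) volume t T :=
  ContinuousOn.intervalIntegrable_of_Icc ht.2.le (hΓ.continuousOn_evolve_source hV hH ht hx)

theorem duhamel_le_add (hΓ : IsFundamentalSolution acc L T b σ Γ) (hV : IsLyapunov acc L b σ V)
    {H H' : ℝ → ℝ → ℝ} (hH : IsTestSource L H) (hH' : IsTestSource L H') (ht : t ∈ Icc 0 T)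
    (hx : x ∈ Ioo 0 L) {κ : ℝ} (hκ : 0 ≤ κ)
    (h : ∀ s ∈ Icc 0 T, ∀ y, H s y ≤ H' s y + κ) :
    duhamel Γ L T H t x ≤ duhamel Γ L T H' t x + κ * (T - t) := by
  rcases ht.2.eq_or_lt with rfl | htT
  · simp [duhamel]
  have hint := hΓ.intervalIntegrable_evolve_source hV hH ⟨ht.1, htT⟩ hx
  have hint' := hΓ.intervalIntegrable_evolve_source hV hH' ⟨ht.1, htT⟩ hx
  calc duhamel Γ L T H t x
      ≤ ∫ s in t..T, (evolve Γ L (H' s) s t x + κ) := by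
        refine intervalIntegral.integral_mono_on ht.2 hint
          (hint'.add intervalIntegrable_const) fun s hs => ?_
        have := hΓ.evolve_le hV hs.2 ⟨ht.1, hs.1⟩ hx ((hH.isTest s).sub (hH'.isTest s)) hκ
          fun y => sub_le_iff_le_add'.2 (h s ⟨ht.1.trans hs.1, hs.2⟩ y)
        rw [hΓ.evolve_sub hs.2 ⟨ht.1, hs.1⟩ (Ioo_subset_Icc_self hx) (hH.isTest s)
          (hH'.isTest s)] at this
        linarith
    _ = duhamel Γ L T H' t x + κ * (T - t) := by
        rw [intervalIntegral.integral_add hint' intervalIntegrable_const,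
          intervalIntegral.integral_const, smul_eq_mul, mul_comm, duhamel]

theorem duhamel_sum_exp_mul (hΓ : IsFundamentalSolution acc L T b σ Γ)
    (hV : IsLyapunov acc L b σ V) (ht : t ∈ Icc 0 T) (hx : x ∈ Ioo 0 L) {ι : Type*}
    (I : Finset ι) (k : ι → ℝ) {φ : ι → ℝ → ℝ} (hφ : ∀ i ∈ I, IsTest L (φ i)) :
    duhamel Γ L T (fun s y => ∑ i ∈ I, Real.exp (-k i * s) * φ i y) t x =
      ∑ i ∈ I, potential T (k i) (evolve Γ L (φ i) T) T t x := by
  rcases ht.2.eq_or_lt with rfl | htT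
  · simp [duhamel, potential_self]
  have hint : ∀ i ∈ I, IntervalIntegrable
      (fun s => Real.exp (-k i * s) * evolve Γ L (φ i) T (t + (T - s)) x) volume t T :=
    fun i hi => ContinuousOn.intervalIntegrable_of_Icc ht.2 (ContinuousOn.mul (by fun_prop)
      (hΓ.continuousOn_evolve_terminal (hφ i hi) ⟨ht.1, htT⟩ (Ioo_subset_Icc_self hx)))
  have hterm : ∀ i, ∫ s in t..T, Real.exp (-k i * s) * evolve Γ L (φ i) T (t + (T - s)) x =
      potential T (k i) (evolve Γ L (φ i) T) T t x := by
    intro i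
    have := intervalIntegral.integral_comp_sub_left (a := t) (b := T)
      (fun r => Real.exp (-k i * (t + T - r)) * evolve Γ L (φ i) T r x) (t + T)
    simp only [sub_sub_cancel, add_sub_cancel_left, add_sub_cancel_right] at this
    simp only [← add_sub_assoc]
    rw [this, potential, ← intervalIntegral.integral_const_mul]
    refine intervalIntegral.integral_congr fun r _ => ?_
    rw [← mul_assoc, ← Real.exp_add]
    ring_nf
  rw [duhamel, ← Finset.sum_congr rfl fun i _ => hterm i,
    ← intervalIntegral.integral_finsetSum hint]
  refine intervalIntegral.integral_congr fun s hs => ?_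
  rw [uIcc_of_le ht.2] at hs
  exact hΓ.evolve_sum_exp_mul hV hs.2 ⟨ht.1, hs.1⟩ hx I k hφ

theorem nonneg_add_duhamel (hΓ : IsFundamentalSolution acc L T b σ Γ) (hV : IsLyapunov acc L b σ V)
    {t₀ l u : ℝ} {q H : ℝ → ℝ → ℝ} (hH : IsTestSource L H) (ht₀ : 0 ≤ t₀)
    (hlu : Icc l u ⊆ Ioo 0 L)
    (hq : ContinuousOn (fun p : ℝ × ℝ => q p.1 p.2) (Icc t₀ T ×ˢ Icc l u))
    (hqpar : ∀ t ∈ Ioo t₀ T, ∀ x ∈ Ioo l u, ∃ ℓ ≤ H t x, HasParabolicAt b σ q t x ℓ)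
    (hbd : ∀ t ∈ Icc t₀ T, ∀ x ∈ Icc l u, t = T ∨ x = l ∨ x = u →
      0 ≤ q t x + duhamel Γ L T H t x) :
    ∀ t ∈ Icc t₀ T, ∀ x ∈ Icc l u, 0 ≤ q t x + duhamel Γ L T H t x := by
  intro t ht x hx
  have hsub : Icc t₀ T ⊆ Icc 0 T := Icc_subset_Icc_left ht₀
  rcases ht.2.eq_or_lt with rfl | htT
  · exact hbd t ht x hx (.inl rfl)
  have hT : T ∈ Ioc 0 T := ⟨ht₀.trans_lt (ht.1.trans_lt htT), le_rfl⟩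
  have hperturbed : ∀ κ > 0, 0 ≤ q t x + duhamel Γ L T H t x + κ * (3 * (T - t)) := by
    intro κ hκ
    obtain ⟨I, φ, hφ, hnear⟩ := hH.exists_sum_exp_mul_near T hκ
    have hN : IsTestSource L fun s y => ∑ k ∈ I, Real.exp (-(k : ℝ) * s) * φ k y :=
      .sum_exp_mul I (fun k => (k : ℝ)) fun k _ => hφ k
    have hpot : ∀ t ∈ Icc t₀ T, ∀ x ∈ Icc l u,
        |∑ k ∈ I, potential T k (evolve Γ L (φ k) T) T t x - duhamel Γ L T H t x| ≤
          κ * (T - t) := by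
      intro t ht x hx
      rw [← hΓ.duhamel_sum_exp_mul hV (hsub ht) (hlu hx) I (fun k => (k : ℝ)) fun k _ => hφ k,
        abs_le]
      have hle := hΓ.duhamel_le_add hV hN hH (hsub ht) (hlu hx) hκ.le fun s hs y => by
        linarith [(abs_le.1 (hnear s hs y)).2]
      have hge := hΓ.duhamel_le_add hV hH hN (hsub ht) (hlu hx) hκ.le fun s hs y => by
        linarith [(abs_le.1 (hnear s hs y)).1]
      constructor <;> linarith
    have hsum := nonneg_add_sum_potential (q := fun t x => q t x + 2 * κ * (T - t)) I
      (k := fun k => (k : ℝ)) (fun k _ => hΓ.isClassicalSolution_evolve hT (hφ k)) ht₀ hlu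
      (hq.add (by fun_prop)) (fun r hr y hy => ?_) (fun r hr y hy hb => ?_) t ht x hx
    · linarith [(abs_le.1 (hpot t ht x hx)).2]
    · obtain ⟨ℓ, hℓ, hqr⟩ := hqpar r hr y hy
      refine ⟨_, ?_, hqr.add (.of_time (((hasDerivAt_id r).const_sub T).const_mul (2 * κ)))⟩
      linarith [(abs_le.1 (hnear r (hsub (Ioo_subset_Icc_self hr)) y)).1]
    · have := mul_nonneg hκ.le (sub_nonneg.2 hr.2)
      linarith [hbd r hr y hy hb, (abs_le.1 (hpot r hr y hy)).1]
  exact nonneg_of_forall_pos_nonneg_add_mul hperturbed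

end IsFundamentalSolution

/-! ### Removal of the cut-off -/

section Truncation

variable {L : ℝ} {F : ℝ → ℝ → ℝ} {η : ℝ → ℝ}

/-- For `0 ≤ η ≤ 1`, the source `F⁺ - η F⁻`: only the negative part of `F` is cut off, so that the
source decreases to `F` as `η` increases to `1`. -/
def truncate (F : ℝ → ℝ → ℝ) (η : ℝ → ℝ) (s x : ℝ) : ℝ := max (F s x) (F s x * η x)

theorem abs_truncate_le (hη : ∀ x, η x ∈ Icc (0 : ℝ) 1) (s x : ℝ) :
    |truncate F η s x| ≤ |F s x| := by
  refine abs_max_le_max_abs_abs.trans (max_le le_rfl ?_)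
  rw [abs_mul, abs_of_nonneg (hη x).1]
  exact mul_le_of_le_one_right (abs_nonneg _) (hη x).2

theorem exists_isTestSource_le_truncate {K : Set ℝ}
    (hF : ContinuousOn (fun p : ℝ × ℝ => F p.1 p.2) (univ ×ˢ Ioo 0 L)) (hη : IsTest L η)
    (hK : IsCompact K) (hKL : K ⊆ Ioo 0 L) :
    ∃ H, IsTestSource L H ∧ (∀ s x, H s x ≤ truncate F η s x) ∧
      (∀ s x, F s x * η x ≤ H s x) ∧ ∀ s, ∀ x ∈ K, F s x ≤ H s x := by
  obtain ⟨χ, hχ, hχ1, hχ01⟩ := exists_isTest_eq_one (hK.union hη.hasCompactSupport)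
    (union_subset hKL hη.tsupport_subset)
  have hoff : ∀ s, ∀ x ∉ tsupport η, F s x * η x = 0 := fun s x hx => by
    rw [image_eq_zero_of_notMem_tsupport hx, mul_zero]
  have htrunc : ContinuousOn (fun p : ℝ × ℝ => truncate F η p.1 p.2) (univ ×ˢ Ioo 0 L) :=
    hF.sup (hF.mul (hη.continuous.comp continuous_snd).continuousOn)
  refine ⟨_, hχ.isTestSource_mul htrunc, fun s x => ?_, fun s x => ?_, fun s x hx => ?_⟩
  · by_cases hx : x ∈ tsupport η
    · rw [hχ1 x (.inr hx), mul_one]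
    · exact mul_le_of_le_one_right ((hoff s x hx).ge.trans (le_max_right _ _)) (hχ01 x).2
  · by_cases hx : x ∈ tsupport η
    · rw [hχ1 x (.inr hx), mul_one]
      exact le_max_right _ _
    · rw [hoff s x hx]
      exact mul_nonneg ((hoff s x hx).ge.trans (le_max_right _ _)) (hχ01 x).1
  · rw [hχ1 x (.inl hx), mul_one]
    exact le_max_left _ _

theorem exists_isTest_tendsto_one {L : ℝ} (hL : 0 < L) :
    ∃ η : ℕ → ℝ → ℝ, (∀ n, IsTest L (η n)) ∧ (∀ n x, η n x ∈ Icc (0 : ℝ) 1) ∧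
      ∀ x ∈ Ioo 0 L, ∀ᶠ n in atTop, η n x = 1 := by
  have hsub : ∀ n : ℕ, Icc (L / (n + 2)) (L - L / (n + 2)) ⊆ Ioo 0 L := fun n x hx => by
    have : 0 < L / ((n : ℝ) + 2) := by positivity
    exact ⟨this.trans_le hx.1, by linarith [hx.2]⟩
  choose η hη hη1 hη01 using fun n => exists_isTest_eq_one isCompact_Icc (hsub n)
  refine ⟨η, hη, hη01, fun x hx => ?_⟩
  have hlim : Tendsto (fun n : ℕ => L / ((n : ℝ) + 2)) atTop (𝓝 0) :=
    Tendsto.div_atTop tendsto_const_nhds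
      (tendsto_atTop_add_const_right _ _ tendsto_natCast_atTop_atTop)
  filter_upwards [hlim.eventually_lt_const hx.1,
    hlim.eventually_lt_const (sub_pos.2 hx.2)] with n hleft hright
  exact hη1 n x ⟨hleft.le, by linarith⟩

end Truncation

namespace IsFundamentalSolution

variable {acc : Prop} {L T t₀ x₀ : ℝ} {b σ V η : ℝ → ℝ} {w F G H : ℝ → ℝ → ℝ}
  {Γ : ℝ → ℝ → ℝ → ℝ → ℝ}

theorem abs_evolve_le_evolve (hΓ : IsFundamentalSolution acc L T b σ Γ) {s t x : ℝ} (hs : s ≤ T)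
    (ht : t ∈ Icc 0 s) (hx : x ∈ Icc 0 L) {φ χ : ℝ → ℝ} (hφ : IsTest L φ) (hχ : IsTest L χ)
    (h : ∀ y, |φ y| ≤ χ y) : |evolve Γ L φ s t x| ≤ evolve Γ L χ s t x := by
  refine abs_le'.2 ⟨hΓ.evolve_mono hs ht hx hφ hχ fun y => (abs_le'.1 (h y)).1, ?_⟩
  rw [← neg_one_mul, ← evolve_const_mul]
  exact hΓ.evolve_mono hs ht hx (hφ.const_mul (-1)) hχ fun y => by
    simpa using (abs_le'.1 (h y)).2

theorem isLittleO_duhamel (hΓ : IsFundamentalSolution acc L T b σ Γ) (hV : IsLyapunov acc L b σ V)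
    (hL : 0 < L) (hT : 0 < T) (hG : IsTestSource L G) :
    (fun p : ℝ × ℝ => duhamel Γ L T G p.1 p.2) =o[lateralBoundary L T] fun p => V p.2 := by
  obtain ⟨K, hK, hKL, hGK⟩ := hG.exists_isCompact
  obtain ⟨χ, hχ, hχ1, hχ01⟩ := exists_isTest_eq_one hK hKL
  obtain ⟨M, hM⟩ := ((isCompact_Icc (a := 0) (b := T)).prod hK).exists_bound_of_continuousOn
    hG.continuous.continuousOn
  have hMχ : ∀ s ∈ Icc 0 T, ∀ y, |G s y| ≤ |M| * χ y := fun s hs y => by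
    by_cases hy : y ∈ K
    · rw [hχ1 y hy, mul_one]
      exact (hM (s, y) ⟨hs, hy⟩).trans (le_abs_self M)
    · rw [hGK s y hy, abs_zero]
      exact mul_nonneg (abs_nonneg M) (hχ01 y).1
  refine IsLittleO.of_bound fun κ hκ => eventually_lateralBoundary.2 ?_
  have hχV :=
    ((hΓ.isClassicalSolution_evolve ⟨hT, le_rfl⟩ hχ).isLittleO_lateralBoundary hL hV).bound
      (c := κ / (|M| * T + 1)) (by positivity)
  filter_upwards [eventually_lateralBoundary.1 hχV,
    eventually_lateralBoundary.1 (eventually_lateralBoundary_mem_Ioo hL T)] with x hxV hmem t ht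
  have hx : x ∈ Ioo 0 L := (hmem t ht).2
  have hbound : ∀ s ∈ uIoc t T,
      ‖evolve Γ L (G s) s t x‖ ≤ |M| * (κ / (|M| * T + 1) * ‖V x‖) := by
    intro s hs
    rw [uIoc_of_le ht.2] at hs
    have hts : t ∈ Icc 0 s := ⟨ht.1, hs.1.le⟩
    refine (hΓ.abs_evolve_le_evolve hs.2 hts (Ioo_subset_Icc_self hx) (hG.isTest s)
      (hχ.const_mul |M|) (hMχ s ⟨ht.1.trans hs.1.le, hs.2⟩)).trans ?_
    rw [evolve_const_mul, hΓ.evolve_eq_evolve_add hV hs.2 hts hx hχ]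
    gcongr
    exact (le_abs_self _).trans (hxV _ ⟨by linarith [ht.1, hs.2], by linarith [hs.1]⟩)
  refine (intervalIntegral.norm_integral_le_of_norm_le_const hbound).trans ?_
  calc |M| * (κ / (|M| * T + 1) * ‖V x‖) * |T - t|
      ≤ |M| * (κ / (|M| * T + 1) * ‖V x‖) * T := by
        rw [abs_of_nonneg (sub_nonneg.2 ht.2)]
        gcongr
        exact sub_le_self T ht.1
    _ = |M| * T / (|M| * T + 1) * (κ * ‖V x‖) := by ring
    _ ≤ κ * ‖V x‖ := mul_le_of_le_one_left (by positivity)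
        ((div_le_one (by positivity)).2 (le_add_of_nonneg_right zero_le_one))

theorem duhamel_le_integral (hΓ : IsFundamentalSolution acc L T b σ Γ)
    (hV : IsLyapunov acc L b σ V) (ht₀ : t₀ ∈ Ico 0 T) (hx₀ : x₀ ∈ Ioo 0 L) (hH : IsTestSource L H)
    (hHG : ∀ s y, H s y ≤ G s y)
    (hG : IntegrableOn (fun p : ℝ × ℝ => Γ t₀ x₀ p.1 p.2 * G p.1 p.2) (Ioo t₀ T ×ˢ Ioo 0 L)) :
    duhamel Γ L T H t₀ x₀ ≤ ∫ p in Ioo t₀ T ×ˢ Ioo 0 L, Γ t₀ x₀ p.1 p.2 * G p.1 p.2 := by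
  have hGprod : Integrable (fun p : ℝ × ℝ => Γ t₀ x₀ p.1 p.2 * G p.1 p.2)
      ((volume.restrict (Ioo t₀ T)).prod (volume.restrict (Ioo 0 L))) := by
    rwa [Measure.prod_restrict, ← Measure.volume_eq_prod]
  rw [Measure.volume_eq_prod, setIntegral_prod _ hG, duhamel,
    intervalIntegral.integral_of_le ht₀.2.le, integral_Ioc_eq_integral_Ioo]
  refine setIntegral_mono_ae_restrict ?_ hGprod.integral_prod_left ?_
  · exact (intervalIntegrable_iff_integrableOn_Ioo_of_le ht₀.2.le).1
      (hΓ.intervalIntegrable_evolve_source hV hH ht₀ hx₀)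
  · filter_upwards [hGprod.prod_right_ae, ae_restrict_mem measurableSet_Ioo] with s hGs hs
    have hs₀ : s ∈ Ioc 0 T := ⟨ht₀.1.trans_lt hs.1, hs.2.le⟩
    have hts : t₀ ∈ Ico 0 s := ⟨ht₀.1, hs.1⟩
    rw [evolve, if_pos hs.1, intervalIntegral.integral_of_le (hx₀.1.trans hx₀.2).le,
      integral_Ioc_eq_integral_Ioo]
    exact setIntegral_mono_on (hΓ.integrableOn_mul_test hs₀ hts (Ioo_subset_Icc_self hx₀)
      (hH.isTest s)) hGs measurableSet_Ioo fun y hy => mul_le_mul_of_nonneg_left (hHG s y)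
        (hΓ.nonneg s hs₀ t₀ hts x₀ (Ioo_subset_Icc_self hx₀) y hy)

theorem integrableOn_mul_truncate (hΓ : IsFundamentalSolution acc L T b σ Γ)
    (ht₀ : t₀ ∈ Ico 0 T) (hx₀ : x₀ ∈ Ioo 0 L)
    (hF : IntegrableOn (fun p : ℝ × ℝ => Γ t₀ x₀ p.1 p.2 * F p.1 p.2) (Ioo t₀ T ×ˢ Ioo 0 L))
    (hη : Continuous η) (hη01 : ∀ x, η x ∈ Icc (0 : ℝ) 1) :
    IntegrableOn (fun p : ℝ × ℝ => Γ t₀ x₀ p.1 p.2 * truncate F η p.1 p.2)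
      (Ioo t₀ T ×ˢ Ioo 0 L) := by
  have hFη := hF.mul_bdd (g := fun p : ℝ × ℝ => η p.2) (c := 1)
    (hη.comp continuous_snd).aestronglyMeasurable <| Eventually.of_forall fun p => by
      rw [Real.norm_of_nonneg (hη01 _).1]
      exact (hη01 _).2
  refine IntegrableOn.congr_fun (hF.sup hFη) (fun p hp => ?_)
    (measurableSet_Ioo.prod measurableSet_Ioo)
  have hΓp : 0 ≤ Γ t₀ x₀ p.1 p.2 :=
    hΓ.nonneg p.1 ⟨ht₀.1.trans_lt hp.1.1, hp.1.2.le⟩ t₀ ⟨ht₀.1, hp.1.1⟩ x₀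
      (Ioo_subset_Icc_self hx₀) p.2 hp.2
  rw [truncate, mul_max_of_nonneg _ _ hΓp, ← mul_assoc]
  rfl

theorem le_integral_truncate (hΓ : IsFundamentalSolution acc L T b σ Γ)
    (hV : IsLyapunov acc L b σ V)
    (hwc : ContinuousOn (fun p : ℝ × ℝ => w p.1 p.2) (Icc 0 T ×ˢ Ioo 0 L))
    (hwp : ∀ t ∈ Ioo 0 T, ∀ x ∈ Ioo 0 L, HasParabolicAt b σ w t x (-F t x))
    (hwT : ∀ x ∈ Ioo 0 L, w T x = 0)
    (hwV : (fun p : ℝ × ℝ => w p.1 p.2) =o[lateralBoundary L T] fun p => V p.2)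
    (hF : ContinuousOn (fun p : ℝ × ℝ => F p.1 p.2) (univ ×ˢ Ioo 0 L))
    (ht₀ : t₀ ∈ Ico 0 T) (hx₀ : x₀ ∈ Ioo 0 L)
    (hint : IntegrableOn (fun p : ℝ × ℝ => Γ t₀ x₀ p.1 p.2 * F p.1 p.2) (Ioo t₀ T ×ˢ Ioo 0 L))
    (hη : IsTest L η) (hη01 : ∀ x, η x ∈ Icc (0 : ℝ) 1) :
    w t₀ x₀ ≤ ∫ p in Ioo t₀ T ×ˢ Ioo 0 L, Γ t₀ x₀ p.1 p.2 * truncate F η p.1 p.2 := by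
  have hL : 0 < L := hx₀.1.trans hx₀.2
  have hT : 0 < T := ht₀.1.trans_lt ht₀.2
  have hFη : IsTestSource L fun s x => F s x * η x := hη.isTestSource_mul hF
  refine sub_nonneg.1 (nonneg_of_forall_pos_nonneg_add_mul
    (c := 2 * (Real.exp (T - t₀) * V x₀)) fun κ hκ => ?_)
  have hbd : ∀ᶠ p in lateralBoundary L T,
      w p.1 p.2 ≤ κ * V p.2 ∧ -(κ * V p.2) ≤ duhamel Γ L T (fun s x => F s x * η x) p.1 p.2 := by
    filter_upwards [hwV.bound hκ, (hΓ.isLittleO_duhamel hV hL hT hFη).bound hκ,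
      eventually_lateralBoundary_mem_Ioo hL T] with p hw hD hmem
    rw [Real.norm_of_nonneg (zero_le_one.trans (hV.one_le _ hmem.2))] at hw hD
    exact ⟨(le_abs_self _).trans hw, (abs_le.1 hD).1⟩
  obtain ⟨hleft, hright⟩ := eventually_sup.1 (eventually_lateralBoundary.1 hbd)
  obtain ⟨l, hl, hl0, hlx⟩ := (hleft.and (Ioo_mem_nhdsGT hx₀.1)).exists
  obtain ⟨u, hu, hxu, huL⟩ := (hright.and (Ioo_mem_nhdsLT hx₀.2)).exists
  have hsub : Icc l u ⊆ Ioo 0 L := fun y hy => ⟨hl0.trans_le hy.1, hy.2.trans_lt huL⟩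
  obtain ⟨H, hH, hHtrunc, hFηH, hFH⟩ :=
    exists_isTestSource_le_truncate hF hη isCompact_Icc hsub
  have hcomparison := hΓ.nonneg_add_duhamel hV hH le_rfl hsub
    (q := fun t x => -w t x + 2 * κ * (Real.exp (T - t) * V x)) ?_ ?_ ?_ t₀
    (Ico_subset_Icc_self ht₀) x₀ ⟨hlx.le, hxu.le⟩
  · linarith [hΓ.duhamel_le_integral hV ht₀ hx₀ hH hHtrunc
      (hΓ.integrableOn_mul_truncate ht₀ hx₀ hint hη.continuous hη01)]
  · exact (hwc.neg.add (continuousOn_const.mul (hV.continuousOn_exp_mul T _))).mono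
      (prod_mono_right hsub)
  · intro t ht x hx
    obtain ⟨ℓ, hℓ, hVx⟩ := hV.exists_hasParabolicAt_exp_mul (hsub (Ioo_subset_Icc_self hx)) T t
    refine ⟨_, ?_, (hwp t ht x (hsub (Ioo_subset_Icc_self hx))).neg.add (hVx.const_mul (2 * κ))⟩
    have := mul_nonpos_of_nonneg_of_nonpos (by positivity : 0 ≤ 2 * κ) hℓ
    linarith [hFH t x (Ioo_subset_Icc_self hx)]
  · intro t ht x hx hb
    have hlower := mul_le_mul_of_nonneg_left (hV.le_exp_mul ht.2 (hsub hx)) hκ.le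
    have hVx := mul_nonneg hκ.le (zero_le_one.trans (hV.one_le x (hsub hx)))
    have hD := hΓ.duhamel_le_add hV hFη hH ht (hsub hx) le_rfl fun s _ y => by
      simpa using hFηH s y
    rcases hb with rfl | rfl | rfl
    · simp only [duhamel, intervalIntegral.integral_same, hwT x (hsub hx)]
      linarith
    · linarith [hl t ht]
    · linarith [hu t ht]

theorem le_integral (hΓ : IsFundamentalSolution acc L T b σ Γ) (hV : IsLyapunov acc L b σ V)
    (hwc : ContinuousOn (fun p : ℝ × ℝ => w p.1 p.2) (Icc 0 T ×ˢ Ioo 0 L))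
    (hwp : ∀ t ∈ Ioo 0 T, ∀ x ∈ Ioo 0 L, HasParabolicAt b σ w t x (-F t x))
    (hwT : ∀ x ∈ Ioo 0 L, w T x = 0)
    (hwV : (fun p : ℝ × ℝ => w p.1 p.2) =o[lateralBoundary L T] fun p => V p.2)
    (hF : ContinuousOn (fun p : ℝ × ℝ => F p.1 p.2) (univ ×ˢ Ioo 0 L))
    (ht₀ : t₀ ∈ Ico 0 T) (hx₀ : x₀ ∈ Ioo 0 L)
    (hint : IntegrableOn (fun p : ℝ × ℝ => Γ t₀ x₀ p.1 p.2 * F p.1 p.2) (Ioo t₀ T ×ˢ Ioo 0 L)) :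
    w t₀ x₀ ≤ ∫ p in Ioo t₀ T ×ˢ Ioo 0 L, Γ t₀ x₀ p.1 p.2 * F p.1 p.2 := by
  obtain ⟨η, hη, hη01, hlim⟩ := exists_isTest_tendsto_one (hx₀.1.trans hx₀.2)
  refine ge_of_tendsto (f := fun n : ℕ => ∫ p in Ioo t₀ T ×ˢ Ioo 0 L,
    Γ t₀ x₀ p.1 p.2 * truncate F (η n) p.1 p.2) (x := atTop) ?_ (Eventually.of_forall fun n =>
      hΓ.le_integral_truncate hV hwc hwp hwT hwV hF ht₀ hx₀ hint (hη n) (hη01 n))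
  refine tendsto_integral_of_dominated_convergence (fun p => ‖Γ t₀ x₀ p.1 p.2 * F p.1 p.2‖)
    (fun n => (hΓ.integrableOn_mul_truncate ht₀ hx₀ hint (hη n).continuous
      (hη01 n)).aestronglyMeasurable) hint.norm (fun n => Eventually.of_forall fun p => ?_) ?_
  · rw [norm_mul, norm_mul]
    exact mul_le_mul_of_nonneg_left (abs_truncate_le (hη01 n) _ _) (norm_nonneg _)
  · filter_upwards [ae_restrict_mem (measurableSet_Ioo.prod measurableSet_Ioo)] with p hp
    refine tendsto_const_nhds.congr' ?_
    filter_upwards [hlim p.2 hp.2] with n hn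
    rw [truncate, hn, mul_one, max_self]

theorem eq_integral (hΓ : IsFundamentalSolution acc L T b σ Γ) (hV : IsLyapunov acc L b σ V)
    (hwc : ContinuousOn (fun p : ℝ × ℝ => w p.1 p.2) (Icc 0 T ×ˢ Ioo 0 L))
    (hwp : ∀ t ∈ Ioo 0 T, ∀ x ∈ Ioo 0 L, HasParabolicAt b σ w t x (-F t x))
    (hwT : ∀ x ∈ Ioo 0 L, w T x = 0)
    (hwV : (fun p : ℝ × ℝ => w p.1 p.2) =o[lateralBoundary L T] fun p => V p.2)
    (hF : ContinuousOn (fun p : ℝ × ℝ => F p.1 p.2) (univ ×ˢ Ioo 0 L))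
    (ht₀ : t₀ ∈ Ico 0 T) (hx₀ : x₀ ∈ Ioo 0 L)
    (hint : IntegrableOn (fun p : ℝ × ℝ => Γ t₀ x₀ p.1 p.2 * F p.1 p.2) (Ioo t₀ T ×ˢ Ioo 0 L)) :
    w t₀ x₀ = ∫ s in t₀..T, ∫ y in 0..L, Γ t₀ x₀ s y * F s y := by
  have hle := hΓ.le_integral hV hwc hwp hwT hwV hF ht₀ hx₀ hint
  have hge := hΓ.le_integral (F := fun s y => -F s y) hV hwc.neg
    (fun t ht x hx => (hwp t ht x hx).neg) (fun x hx => neg_eq_zero.2 (hwT x hx)) hwV.neg_left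
    hF.neg ht₀ hx₀ (by simp only [mul_neg]; exact hint.neg)
  simp only [mul_neg, integral_neg] at hge
  rw [le_antisymm hle (neg_le_neg_iff.1 hge), intervalIntegral.integral_of_le ht₀.2.le,
    integral_Ioc_eq_integral_Ioo, Measure.volume_eq_prod, setIntegral_prod _ hint]
  simp only [intervalIntegral.integral_of_le (hx₀.1.trans hx₀.2).le, integral_Ioc_eq_integral_Ioo]

end IsFundamentalSolution

/-! ### Divergence at the left endpoint -/

section LeftEndpoint

variable {l z : ℝ} {g h g' h' : ℝ → ℝ}

theorem antitoneOn_Ioc_of_hasDerivAt_nonpos (hg : ∀ x ∈ Ioc l z, HasDerivAt g (g' x) x)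
    (hg' : ∀ x ∈ Ioc l z, g' x ≤ 0) : AntitoneOn g (Ioc l z) :=
  antitoneOn_of_hasDerivWithinAt_nonpos (convex_Ioc l z)
    (fun x hx => (hg x hx).continuousAt.continuousWithinAt)
    (fun x hx => (hg x (interior_subset hx)).hasDerivWithinAt)
    fun x hx => hg' x (interior_subset hx)

theorem le_of_hasDerivAt_le_of_le_right (hg : ∀ x ∈ Ioc l z, HasDerivAt g (g' x) x)
    (hh : ∀ x ∈ Ioc l z, HasDerivAt h (h' x) x) (hle : ∀ x ∈ Ioc l z, g' x ≤ h' x)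
    (hz : h z ≤ g z) {x : ℝ} (hx : x ∈ Ioc l z) : h x ≤ g x := by
  have hanti := antitoneOn_Ioc_of_hasDerivAt_nonpos (fun y hy => (hg y hy).fun_sub (hh y hy))
    (fun y hy => sub_nonpos.2 (hle y hy)) hx (right_mem_Ioc.2 (hx.1.trans_le hx.2)) hx.2
  linarith

theorem exists_forall_le_of_antitoneOn (hg : AntitoneOn g (Ioc l z))
    (hlim : ¬Tendsto g (𝓝[>] l) atTop) : ∃ K, ∀ x ∈ Ioc l z, g x ≤ K := by
  contrapose! hlim
  refine tendsto_atTop.2 fun K => ?_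
  obtain ⟨x, hx, hxK⟩ := hlim K
  filter_upwards [Ioo_mem_nhdsGT hx.1] with y hy
  exact hxK.le.trans (hg ⟨hy.1, hy.2.le.trans hx.2⟩ hx hy.2.le)

theorem exists_tendsto_of_antitoneOn_Ioc {K : ℝ} (hlz : l < z) (hg : AntitoneOn g (Ioc l z))
    (hK : ∀ x ∈ Ioc l z, g x ≤ K) : ∃ a, Tendsto g (𝓝[>] l) (𝓝 a) :=
  ⟨_, AntitoneOn.tendsto_nhdsWithin_Ioo_right (nonempty_Ioo.2 hlz) (hg.mono Ioo_subset_Ioc_self)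
    ⟨K, forall_mem_image.2 fun _ hx => hK _ (Ioo_subset_Ioc_self hx)⟩⟩

theorem tendsto_atTop_of_hasDerivAt_le_mul {c : ℝ} (hc : 0 < c)
    (hg : ∀ᶠ x in 𝓝[>] l, HasDerivAt g (g' x) x) (hh : ∀ᶠ x in 𝓝[>] l, HasDerivAt h (h' x) x)
    (hle : ∀ᶠ x in 𝓝[>] l, g' x ≤ c * h' x) (hlim : Tendsto h (𝓝[>] l) atTop) :
    Tendsto g (𝓝[>] l) atTop := by
  obtain ⟨z, hlz, hz⟩ := mem_nhdsGT_iff_exists_Ioc_subset.1 ((hg.and hh).and hle)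
  refine tendsto_atTop_mono' _ ?_
    (tendsto_atTop_add_const_right _ (g z - c * h z) (hlim.const_mul_atTop hc))
  filter_upwards [Ioc_mem_nhdsGT hlz] with x hx
  exact le_of_hasDerivAt_le_of_le_right (fun y hy => (hz hy).1.1)
    (fun y hy => ((hz hy).1.2.const_mul c).add_const _) (fun y hy => (hz hy).2)
    (by linarith) hx

/-- If `v` stayed bounded, then `κ θ + v` and `v` would converge, hence so would `θ`; its limit
differs from `1` or from `0`, and accordingly `κ θ + v` dominates `α` or `v` dominates `β`. -/
theorem tendsto_atTop_of_balance {κ : ℝ} {a b α β θ v v' : ℝ → ℝ} (hlz : l < z) (hκ : 0 < κ)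
    (ha : ∀ x ∈ Ioc l z, 0 ≤ a x) (hb : ∀ x ∈ Ioc l z, 0 ≤ b x)
    (hα : ∀ x ∈ Ioc l z, HasDerivAt α (-a x) x) (hβ : ∀ x ∈ Ioc l z, HasDerivAt β (-b x) x)
    (hαlim : Tendsto α (𝓝[>] l) atTop) (hβlim : Tendsto β (𝓝[>] l) atTop)
    (hθ01 : ∀ x ∈ Ioc l z, θ x ∈ Icc (0 : ℝ) 1)
    (hθ : ∀ x ∈ Ioc l z, HasDerivAt θ (-((1 - θ x) * a x) + θ x * b x) x)
    (hv : ∀ x ∈ Ioc l z, HasDerivAt v (v' x) x) (hv' : ∀ x ∈ Ioc l z, v' x ≤ -(κ * (θ x * b x))) :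
    Tendsto v (𝓝[>] l) atTop := by
  have hnear : ∀ᶠ x in 𝓝[>] l, x ∈ Ioc l z := Ioc_mem_nhdsGT hlz
  have hE : ∀ x ∈ Ioc l z, HasDerivAt (fun y => κ * θ y + v y)
      (κ * (-((1 - θ x) * a x) + θ x * b x) + v' x) x := fun x hx =>
    ((hθ x hx).const_mul κ).fun_add (hv x hx)
  have hE' : ∀ x ∈ Ioc l z, κ * (-((1 - θ x) * a x) + θ x * b x) + v' x ≤
      -(κ * ((1 - θ x) * a x)) := fun x hx => by linarith [hv' x hx]
  by_contra hcon
  have hv_anti : AntitoneOn v (Ioc l z) := antitoneOn_Ioc_of_hasDerivAt_nonpos hv fun x hx =>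
    (hv' x hx).trans (neg_nonpos.2 (mul_nonneg hκ.le (mul_nonneg (hθ01 x hx).1 (hb x hx))))
  have hE_anti : AntitoneOn (fun y => κ * θ y + v y) (Ioc l z) :=
    antitoneOn_Ioc_of_hasDerivAt_nonpos hE fun x hx => (hE' x hx).trans <| neg_nonpos.2 <|
      mul_nonneg hκ.le (mul_nonneg (sub_nonneg.2 (hθ01 x hx).2) (ha x hx))
  obtain ⟨K, hK⟩ := exists_forall_le_of_antitoneOn hv_anti hcon
  obtain ⟨v₀, hv₀⟩ := exists_tendsto_of_antitoneOn_Ioc hlz hv_anti hK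
  obtain ⟨E₀, hE₀⟩ := exists_tendsto_of_antitoneOn_Ioc hlz hE_anti (K := κ + K) fun x hx =>
    add_le_add (mul_le_of_le_one_right hκ.le (hθ01 x hx).2) (hK x hx)
  have hθ₀ : Tendsto θ (𝓝[>] l) (𝓝 (κ⁻¹ * (E₀ - v₀))) :=
    ((hE₀.sub hv₀).const_mul κ⁻¹).congr fun y => by field_simp; ring
  rcases lt_or_ge (κ⁻¹ * (E₀ - v₀)) 1 with hlt | hge
  · obtain ⟨r, hr, hr1⟩ := exists_between hlt
    refine not_tendsto_nhds_of_tendsto_atTop (tendsto_atTop_of_hasDerivAt_le_mul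
      (mul_pos hκ (sub_pos.2 hr1)) (hnear.mono hE) (hnear.mono hα) ?_ hαlim) E₀ hE₀
    filter_upwards [hnear, hθ₀.eventually_lt_const hr] with x hx hθr
    nlinarith [hE' x hx, mul_nonneg (mul_nonneg hκ.le (ha x hx)) (sub_nonneg.2 hθr.le)]
  · refine not_tendsto_nhds_of_tendsto_atTop (tendsto_atTop_of_hasDerivAt_le_mul (c := κ / 2)
      (half_pos hκ) (hnear.mono hv) (hnear.mono hβ) ?_ hβlim) v₀ hv₀
    filter_upwards [hnear, hθ₀.eventually_const_lt (by linarith : (1 / 2 : ℝ) < _)] with x hx hθr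
    nlinarith [hv' x hx, mul_nonneg (mul_nonneg hκ.le (hb x hx)) (sub_nonneg.2 hθr.le)]

theorem tendsto_intervalIntegral_atTop_of_lintegral_eq_top (hlz : l < z)
    (hg : ContinuousOn g (Ioc l z)) (hg0 : ∀ x ∈ Ioc l z, 0 ≤ g x)
    (htop : ∫⁻ y in Ioo l z, ENNReal.ofReal (g y) = ⊤) :
    Tendsto (fun x => ∫ y in x..z, g y) (𝓝[>] l) atTop := by
  have hint : ∀ x ∈ Ioc l z, IntegrableOn g (Ioc x z) := fun x hx =>
    ((hg.mono fun y hy => ⟨hx.1.trans_le hy.1, hy.2⟩).integrableOn_Icc).mono_set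
      Ioc_subset_Icc_self
  have hanti : AntitoneOn (fun x => ∫ y in x..z, g y) (Ioc l z) := fun x hx y hy hxy =>
    intervalIntegral.integral_mono_interval hxy hy.2 le_rfl
      ((ae_restrict_mem measurableSet_Ioc).mono fun r hr => hg0 r ⟨hx.1.trans hr.1, hr.2⟩)
      ((intervalIntegrable_iff_integrableOn_Ioc_of_le hx.2).2 (hint x hx))
  by_contra hcon
  obtain ⟨K, hK⟩ := exists_forall_le_of_antitoneOn hanti hcon
  obtain ⟨a, -, ha, hlim⟩ := exists_seq_strictAnti_tendsto' hlz
  have ha' : ∀ n, a n ∈ Ioc l z := fun n => Ioo_subset_Ioc_self (ha n)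
  have hgint : IntegrableOn g (Ioc l z) := by
    refine integrableOn_Ioc_of_intervalIntegral_norm_bounded_left (I := K)
      (fun n => hint _ (ha' n)) hlim (Eventually.of_forall fun n => ?_)
    rw [← intervalIntegral.integral_of_le (ha' n).2]
    refine (intervalIntegral.integral_congr fun y hy => ?_).trans_le (hK _ (ha' n))
    rw [uIcc_of_le (ha' n).2] at hy
    exact Real.norm_of_nonneg (hg0 y ⟨(ha' n).1.trans_le hy.1, hy.2⟩)
  exact (hgint.mono_set Ioo_subset_Ioc_self).lintegral_lt_top.ne htop

end LeftEndpoint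

section ScalePotential

variable {L z x : ℝ} {b σ s m : ℝ → ℝ}

/-- The potential `∫ₓᶻ s(y) ∫_y^z m(r) dr dy` for a scale density `s` and a speed density `m`,
a solution of `𝒜 v = 1` with `v(z) = v'(z) = 0`. -/
def scalePotential (s m : ℝ → ℝ) (z x : ℝ) : ℝ := ∫ y in x..z, s y * ∫ r in y..z, m r

theorem continuousOn_mul_integral_left (hs : ContinuousOn s (Ioo 0 L))
    (hm : ContinuousOn m (Ioo 0 L)) (hz : z ∈ Ioo 0 L) :
    ContinuousOn (fun y => s y * ∫ r in y..z, m r) (Ioo 0 L) :=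
  hs.mul fun _ hy =>
    (hasDerivAt_integral_left_of_continuousOn_Ioo hm hy hz).continuousAt.continuousWithinAt

theorem hasDerivAt_scalePotential (hs : ContinuousOn s (Ioo 0 L)) (hm : ContinuousOn m (Ioo 0 L))
    (hz : z ∈ Ioo 0 L) (hx : x ∈ Ioo 0 L) :
    HasDerivAt (scalePotential s m z) (-(s x * ∫ r in x..z, m r)) x :=
  hasDerivAt_integral_left_of_continuousOn_Ioo (continuousOn_mul_integral_left hs hm hz) hx hz

theorem hasGeneratorAt_scalePotential
    (hs : ∀ x ∈ Ioo 0 L, HasDerivAt s (-(2 * b x / σ x ^ 2) * s x) x)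
    (hm : ContinuousOn m (Ioo 0 L)) (hσ : σ x ≠ 0) (hsm : σ x ^ 2 * s x * m x = 2)
    (hz : z ∈ Ioo 0 L) (hx : x ∈ Ioo 0 L) : HasGeneratorAt b σ (scalePotential s m z) x 1 := by
  have hsc : ContinuousOn s (Ioo 0 L) := HasDerivAt.continuousOn hs
  refine ⟨fun y => -(s y * ∫ r in y..z, m r), _, ?_,
    ((hs x hx).fun_mul (hasDerivAt_integral_left_of_continuousOn_Ioo hm hx hz)).neg, ?_⟩
  · filter_upwards [isOpen_Ioo.mem_nhds hx] with y hy using hasDerivAt_scalePotential hsc hm hz hy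
  · field_simp
    linear_combination -hsm

theorem scalePotential_nonneg (hs : ∀ x ∈ Ioo 0 L, 0 ≤ s x) (hm : ∀ x ∈ Ioo 0 L, 0 ≤ m x)
    (hz : z ∈ Ioo 0 L) (hx : x ∈ Ioo 0 L) : 0 ≤ scalePotential s m z x := by
  unfold scalePotential
  rcases le_total x z with hxz | hzx
  · refine intervalIntegral.integral_nonneg hxz fun y hy => ?_
    have hy0 : 0 < y := hx.1.trans_le hy.1
    exact mul_nonneg (hs y ⟨hy0, hy.2.trans_lt hz.2⟩) (intervalIntegral.integral_nonneg hy.2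
      fun r hr => hm r ⟨hy0.trans_le hr.1, hr.2.trans_lt hz.2⟩)
  · rw [intervalIntegral.integral_symm, ← intervalIntegral.integral_neg]
    refine intervalIntegral.integral_nonneg hzx fun y hy => ?_
    have hyL : y < L := hy.2.trans_lt hx.2
    rw [intervalIntegral.integral_symm, mul_neg, neg_neg]
    exact mul_nonneg (hs y ⟨hz.1.trans_le hy.1, hyL⟩) (intervalIntegral.integral_nonneg hy.1
      fun r hr => hm r ⟨hz.1.trans_le hr.1, hr.2.trans_lt hyL⟩)

end ScalePotential

/-! ### Feller's integrals -/

theorem lintegral_triangle_swap {a c : ℝ} {g h : ℝ → ENNReal}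
    (hg : AEMeasurable g (volume.restrict (Ioo a c)))
    (hh : AEMeasurable h (volume.restrict (Ioo a c))) :
    ∫⁻ z in Ioo a c, (∫⁻ y in Ioo a z, g y) * h z =
      ∫⁻ y in Ioo a c, g y * ∫⁻ z in Ioo y c, h z := by
  have hleft : ∀ z ∈ Ioo a c, (∫⁻ y in Ioo a z, g y) * h z =
      ∫⁻ y in Ioo a c, {p : ℝ × ℝ | p.2 < p.1}.indicator (fun p => g p.2 * h p.1) (z, y) := by
    intro z hz
    have hinter : Iio z ∩ Ioo a c = Ioo a z := by
      rw [inter_comm, Ioo_inter_Iio, min_eq_right hz.2.le]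
    rw [← lintegral_mul_const'' (h z) (hg.mono_measure
      (Measure.restrict_mono (Ioo_subset_Ioo_right hz.2.le) le_rfl)), ← hinter,
      ← Measure.restrict_restrict measurableSet_Iio, ← lintegral_indicator measurableSet_Iio]
    rfl
  have hright : ∀ y ∈ Ioo a c, g y * ∫⁻ z in Ioo y c, h z =
      ∫⁻ z in Ioo a c, {p : ℝ × ℝ | p.2 < p.1}.indicator (fun p => g p.2 * h p.1) (z, y) := by
    intro y hy
    have hinter : Ioi y ∩ Ioo a c = Ioo y c := by
      rw [inter_comm, Ioo_inter_Ioi, max_eq_right hy.1.le]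
    rw [← lintegral_const_mul'' (g y) (hh.mono_measure
      (Measure.restrict_mono (Ioo_subset_Ioo_left hy.1.le) le_rfl)), ← hinter,
      ← Measure.restrict_restrict measurableSet_Ioi, ← lintegral_indicator measurableSet_Ioi]
    rfl
  rw [setLIntegral_congr_fun measurableSet_Ioo hleft,
    setLIntegral_congr_fun measurableSet_Ioo hright]
  exact lintegral_lintegral_swap
    (f := fun z y => {p : ℝ × ℝ | p.2 < p.1}.indicator (fun p => g p.2 * h p.1) (z, y))
    ((hg.comp_snd.mul hh.comp_fst).indicator (measurableSet_lt measurable_snd measurable_fst))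

theorem lintegral_Ioo_ofReal {g : ℝ → ℝ} {y z : ℝ} (hyz : y ≤ z) (hg : ContinuousOn g (Icc y z))
    (hg0 : ∀ x ∈ Icc y z, 0 ≤ g x) :
    ∫⁻ x in Ioo y z, ENNReal.ofReal (g x) = ENNReal.ofReal (∫ x in y..z, g x) := by
  rw [intervalIntegral.integral_of_le hyz, integral_Ioc_eq_integral_Ioo]
  refine (ofReal_integral_eq_lintegral_ofReal
    (hg.integrableOn_Icc.mono_set Ioo_subset_Icc_self) ?_).symm
  filter_upwards [ae_restrict_mem measurableSet_Ioo] with x hx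
  exact hg0 x (Ioo_subset_Icc_self hx)

section Feller

variable {L c : ℝ} {μ σ : ℝ → ℝ}

theorem scaleDensity_pos (b σ : ℝ → ℝ) (c x : ℝ) : 0 < scaleDensity b σ c x := Real.exp_pos _

theorem speedDensity_nonneg (b σ : ℝ → ℝ) (c x : ℝ) : 0 ≤ speedDensity b σ c x := by
  unfold speedDensity
  positivity

theorem sq_mul_scaleDensity_mul_speedDensity {x : ℝ} (hσ : σ x ≠ 0) :
    σ x ^ 2 * scaleDensity μ σ c x * speedDensity μ σ c x = 2 := by
  rw [speedDensity, scaleDensity, Real.exp_neg]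
  field_simp

section Continuous

variable (hμ : ContinuousOn μ (Ioo 0 L)) (hσ : ContinuousOn σ (Ioo 0 L))
  (hσ0 : ∀ x ∈ Ioo 0 L, σ x ≠ 0) (hc : c ∈ Ioo 0 L)

include hμ hσ hσ0 hc

theorem hasDerivAt_scaleDensity {x : ℝ} (hx : x ∈ Ioo 0 L) :
    HasDerivAt (scaleDensity μ σ c) (-(2 * μ x / σ x ^ 2) * scaleDensity μ σ c x) x := by
  have hcont : ContinuousOn (fun y => 2 * μ y / σ y ^ 2) (Ioo 0 L) :=
    (continuousOn_const.mul hμ).div (hσ.pow 2) fun y hy => pow_ne_zero 2 (hσ0 y hy)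
  have hflip : scaleDensity μ σ c = fun x => Real.exp (∫ y in x..c, 2 * μ y / σ y ^ 2) := by
    ext x
    rw [scaleDensity, intervalIntegral.integral_symm, neg_neg]
  rw [hflip, mul_comm]
  exact (hasDerivAt_integral_left_of_continuousOn_Ioo hcont hx hc).exp

theorem continuousOn_scaleDensity : ContinuousOn (scaleDensity μ σ c) (Ioo 0 L) :=
  HasDerivAt.continuousOn fun _ hx => hasDerivAt_scaleDensity hμ hσ hσ0 hc hx

theorem continuousOn_speedDensity : ContinuousOn (speedDensity μ σ c) (Ioo 0 L) := by
  have hs := continuousOn_scaleDensity hμ hσ hσ0 hc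
  have hinv : speedDensity μ σ c = fun x => 2 / σ x ^ 2 * (scaleDensity μ σ c x)⁻¹ := by
    ext x
    rw [speedDensity, scaleDensity, Real.exp_neg, inv_inv]
  rw [hinv]
  exact (continuousOn_const.div (hσ.pow 2) fun y hy => pow_ne_zero 2 (hσ0 y hy)).mul
    (hs.inv₀ fun x _ => (scaleDensity_pos μ σ c x).ne')

theorem fellerI0_eq_lintegral : fellerI0 μ σ c = ∫⁻ y in Ioo 0 c,
    ENNReal.ofReal (scaleDensity μ σ c y * ∫ r in y..c, speedDensity μ σ c r) := by
  have hs := continuousOn_scaleDensity hμ hσ hσ0 hc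
  have hm := continuousOn_speedDensity hμ hσ hσ0 hc
  have hsub : Ioo 0 c ⊆ Ioo 0 L := Ioo_subset_Ioo_right hc.2.le
  unfold fellerI0 scaleMeasure
  rw [lintegral_triangle_swap ((hs.mono hsub).aemeasurable measurableSet_Ioo).ennreal_ofReal
    ((hm.mono hsub).aemeasurable measurableSet_Ioo).ennreal_ofReal]
  refine setLIntegral_congr_fun measurableSet_Ioo fun y hy => ?_
  rw [ENNReal.ofReal_mul (scaleDensity_pos μ σ c y).le, ← lintegral_Ioo_ofReal hy.2.le
    (hm.mono fun r hr => ⟨hy.1.trans_le hr.1, hr.2.trans_lt hc.2⟩)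
    fun r _ => speedDensity_nonneg μ σ c r]

theorem fellerJ0_eq_lintegral : fellerJ0 μ σ c = ∫⁻ y in Ioo 0 c,
    ENNReal.ofReal ((∫ r in y..c, scaleDensity μ σ c r) * speedDensity μ σ c y) := by
  refine setLIntegral_congr_fun measurableSet_Ioo fun y hy => ?_
  rw [ENNReal.ofReal_mul (intervalIntegral.integral_nonneg hy.2.le
    fun r _ => (scaleDensity_pos μ σ c r).le), ← lintegral_Ioo_ofReal hy.2.le
    ((continuousOn_scaleDensity hμ hσ hσ0 hc).mono
      fun r hr => ⟨hy.1.trans_le hr.1, hr.2.trans_lt hc.2⟩)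
    fun r _ => (scaleDensity_pos μ σ c r).le]
  rfl

theorem tendsto_scalePotential_of_fellerI0_eq_top (hI : fellerI0 μ σ c = ⊤) :
    Tendsto (scalePotential (scaleDensity μ σ c) (speedDensity μ σ c) c) (𝓝[>] 0) atTop := by
  refine tendsto_intervalIntegral_atTop_of_lintegral_eq_top hc.1
    ((continuousOn_mul_integral_left (continuousOn_scaleDensity hμ hσ hσ0 hc)
      (continuousOn_speedDensity hμ hσ hσ0 hc) hc).mono fun y hy => ⟨hy.1, hy.2.trans_lt hc.2⟩)
    (fun y hy => mul_nonneg (scaleDensity_pos μ σ c y).le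
      (intervalIntegral.integral_nonneg hy.2 fun r _ => speedDensity_nonneg μ σ c r)) ?_
  rw [← fellerI0_eq_lintegral hμ hσ hσ0 hc, hI]

theorem continuousOn_integral_scaleDensity_mul_speedDensity :
    ContinuousOn (fun x => (∫ r in x..c, scaleDensity μ σ c r) * speedDensity μ σ c x)
      (Ioo 0 L) :=
  ContinuousOn.mul (HasDerivAt.continuousOn fun _ hx => hasDerivAt_integral_left_of_continuousOn_Ioo
    (continuousOn_scaleDensity hμ hσ hσ0 hc) hx hc) (continuousOn_speedDensity hμ hσ hσ0 hc)

theorem tendsto_integral_scaleDensity_mul_speedDensity_of_fellerJ0_eq_top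
    (hJ : fellerJ0 μ σ c = ⊤) :
    Tendsto (fun x => ∫ y in x..c, (∫ r in y..c, scaleDensity μ σ c r) * speedDensity μ σ c y)
      (𝓝[>] 0) atTop := by
  refine tendsto_intervalIntegral_atTop_of_lintegral_eq_top hc.1
    ((continuousOn_integral_scaleDensity_mul_speedDensity hμ hσ hσ0 hc).mono
      fun y hy => ⟨hy.1, hy.2.trans_lt hc.2⟩)
    (fun y hy => mul_nonneg (intervalIntegral.integral_nonneg hy.2
      fun r _ => (scaleDensity_pos μ σ c r).le) (speedDensity_nonneg μ σ c y)) ?_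
  rw [← fellerJ0_eq_lintegral hμ hσ hσ0 hc, hJ]

/-- As `q ≥ δ`, the function `ψ - δ ∫ₓᶜ s` is antitone; since moreover `ψ → ∞`, it follows that
`ψ ≥ (δ / 2) ∫ₓᶜ s` near `0`. -/
theorem tendsto_integral_speedDensity_mul_of_fellerJ0_eq_top {z δ : ℝ} {ψ q : ℝ → ℝ}
    (hz : z ∈ Ioo 0 L) (hψ : ∀ x ∈ Ioo 0 L, HasDerivAt ψ (-(scaleDensity μ σ c x * q x)) x)
    (hδ : 0 < δ) (hq : ∀ x ∈ Ioc 0 z, δ ≤ q x) (hψlim : Tendsto ψ (𝓝[>] 0) atTop)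
    (hJ : fellerJ0 μ σ c = ⊤) :
    Tendsto (fun x => ∫ r in x..z, speedDensity μ σ c r * ψ r) (𝓝[>] 0) atTop := by
  have hs := continuousOn_scaleDensity hμ hσ hσ0 hc
  have hm := continuousOn_speedDensity hμ hσ hσ0 hc
  have hL : ∀ᶠ x in 𝓝[>] (0 : ℝ), x ∈ Ioo 0 L := Ioo_mem_nhdsGT (hc.1.trans hc.2)
  set S : ℝ → ℝ := fun x => ∫ r in x..c, scaleDensity μ σ c r
  have hS : ∀ x ∈ Ioo 0 L, HasDerivAt S (-scaleDensity μ σ c x) x := fun x hx =>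
    hasDerivAt_integral_left_of_continuousOn_Ioo hs hx hc
  have hbound : ∀ x ∈ Ioc 0 z, δ * S x + (ψ z - δ * S z) ≤ ψ x := fun x hx =>
    le_of_hasDerivAt_le_of_le_right (fun y hy => hψ y ⟨hy.1, hy.2.trans_lt hz.2⟩)
      (fun y hy => ((hS y ⟨hy.1, hy.2.trans_lt hz.2⟩).const_mul δ).add_const _)
      (fun y hy => by nlinarith [scaleDensity_pos μ σ c y, hq y hy]) (by linarith) hx
  refine tendsto_atTop_of_hasDerivAt_le_mul (half_pos hδ)
    (hL.mono fun x hx => hasDerivAt_integral_left_of_continuousOn_Ioo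
      (hm.mul (HasDerivAt.continuousOn hψ)) hx hz)
    (hL.mono fun x hx => hasDerivAt_integral_left_of_continuousOn_Ioo
      (continuousOn_integral_scaleDensity_mul_speedDensity hμ hσ hσ0 hc) hx hc) ?_
    (tendsto_integral_scaleDensity_mul_speedDensity_of_fellerJ0_eq_top hμ hσ hσ0 hc hJ)
  filter_upwards [Ioc_mem_nhdsGT hz.1, hψlim.eventually_ge_atTop (-(ψ z - δ * S z))]
    with x hx hψx
  have hSψ : δ / 2 * S x ≤ ψ x := by linarith [hbound x hx]
  nlinarith [mul_le_mul_of_nonneg_left hSψ (speedDensity_nonneg μ σ c x)]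

end Continuous

end Feller

/-! ### Growth of the tilted scale potential -/

theorem hasDerivAt_div_mul_balance {A ψ R : ℝ → ℝ} {a b x : ℝ}
    (hA : HasDerivAt A (-(a * (ψ x * R x))) x) (hψ : HasDerivAt ψ (-(b * ψ x)) x)
    (hR : HasDerivAt R (-(a * R x)) x) (hψ0 : ψ x ≠ 0) (hR0 : R x ≠ 0) :
    HasDerivAt (fun y => A y / (ψ y * R y))
      (-((1 - A x / (ψ x * R x)) * a) + A x / (ψ x * R x) * b) x := by
  refine (hA.fun_div (hψ.fun_mul hR) (mul_ne_zero hψ0 hR0)).congr_deriv ?_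
  field_simp
  ring

section TiltedPotential

variable {L z C : ℝ} {s m k ψ q : ℝ → ℝ}
  (hs0 : ∀ x ∈ Ioo 0 L, 0 ≤ s x) (hm0 : ∀ x ∈ Ioo 0 L, 0 ≤ m x) (hm : ContinuousOn m (Ioo 0 L))
  (hψ0 : ∀ x ∈ Ioo 0 L, 0 < ψ x) (hk : ∀ x ∈ Ioo 0 L, k x ∈ Icc 0 C)
  (hψ : ∀ x ∈ Ioo 0 L, HasDerivAt ψ (-(s x * q x)) x)
  (hq : ∀ x ∈ Ioo 0 L, HasDerivAt q (-(m x * (k x * ψ x))) x)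
  (hz : z ∈ Ioo 0 L) (hqz : 0 < q z)

theorem Ioc_subset_Ioo_of_mem (hz : z ∈ Ioo 0 L) : Ioc 0 z ⊆ Ioo 0 L :=
  fun _ hx => ⟨hx.1, hx.2.trans_lt hz.2⟩

include hm hψ hz in
theorem hasDerivAt_const_add_integral_mul {a x : ℝ} (hx : x ∈ Ioo 0 L) :
    HasDerivAt (fun y => a + ∫ r in y..z, m r * ψ r) (-(m x * ψ x)) x :=
  (hasDerivAt_integral_left_of_continuousOn_Ioo (hm.mul (HasDerivAt.continuousOn hψ))
    hx hz).const_add a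

include hm hψ hz in
theorem hasDerivAt_integral_mul_sq {x : ℝ} (hx : x ∈ Ioo 0 L) :
    HasDerivAt (fun y => ∫ r in y..z, m r * ψ r ^ 2) (-(m x * ψ x ^ 2)) x :=
  hasDerivAt_integral_left_of_continuousOn_Ioo (hm.mul ((HasDerivAt.continuousOn hψ).pow 2)) hx hz

include hm0 hψ0 hz in
theorem integral_mul_nonneg {x : ℝ} (hx : x ∈ Ioc 0 z) : 0 ≤ ∫ r in x..z, m r * ψ r :=
  intervalIntegral.integral_nonneg hx.2 fun _ hr =>
    have hr' := Ioc_subset_Ioo_of_mem hz ⟨hx.1.trans_le hr.1, hr.2⟩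
    mul_nonneg (hm0 _ hr') (hψ0 _ hr').le

include hm0 hψ0 hk hq hz in
theorem right_le_of_hasDerivAt_neg_mul {x : ℝ} (hx : x ∈ Ioc 0 z) : q z ≤ q x :=
  antitoneOn_Ioc_of_hasDerivAt_nonpos (fun y hy => hq y (Ioc_subset_Ioo_of_mem hz hy))
    (fun y hy => have hy' := Ioc_subset_Ioo_of_mem hz hy
      neg_nonpos.2 (mul_nonneg (hm0 y hy') (mul_nonneg (hk y hy').1 (hψ0 y hy').le)))
    hx (right_mem_Ioc.2 hz.1) hx.2

include hm0 hm hψ0 hk hψ hq hz hqz in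
theorem le_mul_add_integral_mul {x : ℝ} (hx : x ∈ Ioc 0 z) :
    q x ≤ (C + 1) * (q z + ∫ r in x..z, m r * ψ r) := by
  refine le_of_hasDerivAt_le_of_le_right
    (fun y hy => (hasDerivAt_const_add_integral_mul hm hψ hz
      (Ioc_subset_Ioo_of_mem hz hy)).const_mul (C + 1))
    (fun y hy => hq y (Ioc_subset_Ioo_of_mem hz hy)) (fun y hy => ?_) ?_ hx
  · have hy' := Ioc_subset_Ioo_of_mem hz hy
    nlinarith [mul_nonneg (hm0 y hy') (hψ0 y hy').le, (hk y hy').2]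
  · rw [intervalIntegral.integral_same, add_zero]
    nlinarith [(hk z hz).1.trans (hk z hz).2]

include hs0 hm0 hm hψ0 hk hψ hq hz hqz in
theorem integral_mul_sq_le {x : ℝ} (hx : x ∈ Ioc 0 z) :
    ∫ r in x..z, m r * ψ r ^ 2 ≤ ψ x * (q z + ∫ r in x..z, m r * ψ r) := by
  refine le_of_hasDerivAt_le_of_le_right
    (fun y hy => (hψ y (Ioc_subset_Ioo_of_mem hz hy)).fun_mul
      (hasDerivAt_const_add_integral_mul hm hψ hz (Ioc_subset_Ioo_of_mem hz hy)))
    (fun y hy => hasDerivAt_integral_mul_sq hm hψ hz (Ioc_subset_Ioo_of_mem hz hy))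
    (fun y hy => ?_) ?_ hx
  · have hq0 := hqz.le.trans (right_le_of_hasDerivAt_neg_mul hm0 hψ0 hk hq hz hy)
    have hR := add_nonneg hqz.le (integral_mul_nonneg hm0 hψ0 hz hy)
    nlinarith [mul_nonneg (mul_nonneg (hs0 y (Ioc_subset_Ioo_of_mem hz hy)) hq0) hR]
  · simp only [intervalIntegral.integral_same, add_zero]
    exact (mul_pos (hψ0 z hz) hqz).le

include hs0 hm0 hm hψ0 hk hψ hq hz hqz in
theorem mul_integral_mul_sq_le {x : ℝ} (hx : x ∈ Ioc 0 z) :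
    (C + 1)⁻¹ * ((∫ r in x..z, m r * ψ r ^ 2) / (ψ x * (q z + ∫ r in x..z, m r * ψ r)) *
      (s x * q x / ψ x)) ≤ s x / ψ x ^ 2 * ∫ r in x..z, m r * ψ r ^ 2 := by
  have hx' := Ioc_subset_Ioo_of_mem hz hx
  have hC : 0 < C + 1 := by linarith [(hk z hz).1.trans (hk z hz).2]
  have hR0 : 0 < q z + ∫ r in x..z, m r * ψ r :=
    add_pos_of_pos_of_nonneg hqz (integral_mul_nonneg hm0 hψ0 hz hx)
  have hψx := (hψ0 x hx').ne'
  calc _ = s x / ψ x ^ 2 * (∫ r in x..z, m r * ψ r ^ 2) *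
        ((C + 1)⁻¹ * (q x / (q z + ∫ r in x..z, m r * ψ r))) := by field_simp
    _ ≤ _ := by
      refine mul_le_of_le_one_right (mul_nonneg (div_nonneg (hs0 x hx') (sq_nonneg _))
        (integral_mul_nonneg hm0 (fun y hy => pow_pos (hψ0 y hy) 2) hz hx)) ?_
      rw [inv_mul_le_one₀ hC, div_le_iff₀ hR0]
      exact le_mul_add_integral_mul hm0 hm hψ0 hk hψ hq hz hqz hx

include hs0 hm0 hm hψ0 hk hψ hq hz hqz in
/-- `tendsto_atTop_of_balance` applies with `θ = ∫ₓᶻ m ψ² / (ψ (q(z) + ∫ₓᶻ m ψ))`,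
`α = log (q(z) + ∫ₓᶻ m ψ)` and `β = log ψ`. -/
theorem tendsto_scalePotential_div_sq (hs : ContinuousOn s (Ioo 0 L))
    (hψlim : Tendsto ψ (𝓝[>] 0) atTop)
    (hmψlim : Tendsto (fun x => ∫ r in x..z, m r * ψ r) (𝓝[>] 0) atTop) :
    Tendsto (scalePotential (fun x => s x / ψ x ^ 2) (fun x => m x * ψ x ^ 2) z)
      (𝓝[>] 0) atTop := by
  have hsub := Ioc_subset_Ioo_of_mem hz
  have hψc : ContinuousOn ψ (Ioo 0 L) := HasDerivAt.continuousOn hψ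
  have hC : 0 < C + 1 := by linarith [(hk z hz).1.trans (hk z hz).2]
  set R : ℝ → ℝ := fun x => q z + ∫ r in x..z, m r * ψ r
  have hR0 : ∀ x ∈ Ioc 0 z, 0 < R x := fun x hx =>
    add_pos_of_pos_of_nonneg hqz (integral_mul_nonneg hm0 hψ0 hz hx)
  have hR' : ∀ x ∈ Ioc 0 z, HasDerivAt R (-(m x * ψ x / R x * R x)) x := fun x hx => by
    rw [div_mul_cancel₀ _ (hR0 x hx).ne']
    exact hasDerivAt_const_add_integral_mul hm hψ hz (hsub hx)
  have hψ' : ∀ x ∈ Ioc 0 z, HasDerivAt ψ (-(s x * q x / ψ x * ψ x)) x := fun x hx => by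
    rw [div_mul_cancel₀ _ (hψ0 x (hsub hx)).ne']
    exact hψ x (hsub hx)
  have hψR : ∀ x ∈ Ioc 0 z, 0 < ψ x * R x := fun x hx => mul_pos (hψ0 x (hsub hx)) (hR0 x hx)
  refine tendsto_atTop_of_balance hz.1 (inv_pos.2 hC)
    (fun x hx => div_nonneg (mul_nonneg (hm0 x (hsub hx)) (hψ0 x (hsub hx)).le) (hR0 x hx).le)
    (fun x hx => div_nonneg (mul_nonneg (hs0 x (hsub hx)) (hqz.le.trans
      (right_le_of_hasDerivAt_neg_mul hm0 hψ0 hk hq hz hx))) (hψ0 x (hsub hx)).le)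
    (fun x hx => ((hR' x hx).log (hR0 x hx).ne').congr_deriv ?_)
    (fun x hx => ((hψ' x hx).log (hψ0 x (hsub hx)).ne').congr_deriv ?_)
    (Real.tendsto_log_atTop.comp (tendsto_atTop_add_const_left _ _ hmψlim))
    (Real.tendsto_log_atTop.comp hψlim)
    (fun x hx => ⟨div_nonneg (integral_mul_nonneg hm0 (fun y hy => pow_pos (hψ0 y hy) 2) hz hx)
      (hψR x hx).le, (div_le_one (hψR x hx)).2
        (integral_mul_sq_le hs0 hm0 hm hψ0 hk hψ hq hz hqz hx)⟩)
    (fun x hx => hasDerivAt_div_mul_balance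
      ((hasDerivAt_integral_mul_sq hm hψ hz (hsub hx)).congr_deriv ?_) (hψ' x hx) (hR' x hx)
      (hψ0 x (hsub hx)).ne' (hR0 x hx).ne')
    (fun x hx => hasDerivAt_scalePotential (hs.div (hψc.pow 2) fun y hy =>
      (pow_pos (hψ0 y hy) 2).ne') (hm.mul (hψc.pow 2)) hz (hsub hx))
    (fun x hx => neg_le_neg (mul_integral_mul_sq_le hs0 hm0 hm hψ0 hk hψ hq hz hqz hx))
  · rw [← neg_mul, mul_div_cancel_right₀ _ (hR0 x hx).ne']
  · rw [← neg_mul, mul_div_cancel_right₀ _ (hψ0 x (hsub hx)).ne']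
  · have hRx := (hR0 x hx).ne'
    field_simp

include hs0 hm0 hψ0 hk hψ hq in
theorem eventually_le_or_tendsto_atTop (hL : 0 < L) :
    (∃ K, ∀ᶠ x in 𝓝[>] 0, ψ x ≤ K) ∨ Tendsto ψ (𝓝[>] 0) atTop ∧ ∃ z ∈ Ioo 0 L, 0 < q z := by
  by_cases hqpos : ∃ z ∈ Ioo 0 L, 0 < q z
  · obtain ⟨z, hz, hqz⟩ := hqpos
    by_cases hlim : Tendsto ψ (𝓝[>] 0) atTop
    · exact Or.inr ⟨hlim, z, hz, hqz⟩
    · obtain ⟨K, hK⟩ := exists_forall_le_of_antitoneOn (antitoneOn_Ioc_of_hasDerivAt_nonpos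
        (fun y hy => hψ y (Ioc_subset_Ioo_of_mem hz hy)) fun y hy =>
          neg_nonpos.2 (mul_nonneg (hs0 y (Ioc_subset_Ioo_of_mem hz hy))
            (hqz.le.trans (right_le_of_hasDerivAt_neg_mul hm0 hψ0 hk hq hz hy)))) hlim
      exact Or.inl ⟨K, eventually_of_mem (Ioc_mem_nhdsGT hz.1) hK⟩
  · push Not at hqpos
    have hc : L / 2 ∈ Ioo 0 L := ⟨half_pos hL, half_lt_self hL⟩
    refine Or.inl ⟨ψ (L / 2), eventually_of_mem (Ioc_mem_nhdsGT hc.1) fun x hx => ?_⟩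
    refine le_of_hasDerivAt_le_of_le_right (g := fun _ => ψ (L / 2))
      (fun y _ => hasDerivAt_const y _) (fun y hy => hψ y (Ioc_subset_Ioo_of_mem hc hy))
      (fun y hy => ?_) le_rfl hx
    have hy' := Ioc_subset_Ioo_of_mem hc hy
    exact neg_nonneg.2 (mul_nonpos_of_nonneg_of_nonpos (hs0 y hy') (hqpos y hy'))

end TiltedPotential

/-! ### The exponential transform -/

section ExponentialTransform

variable {b σ : ℝ → ℝ} {x : ℝ}

theorem hasGeneratorAt_exp_mul {h p k D : ℝ → ℝ} {p' d : ℝ}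
    (hh : ∀ᶠ y in 𝓝 x, HasDerivAt h (p y) y) (hp : HasDerivAt p p' x)
    (hk : ∀ᶠ y in 𝓝 x, HasDerivAt k (D y) y) (hD : HasDerivAt D d x) :
    HasGeneratorAt b σ (fun y => Real.exp (h y) * k y) x
      (Real.exp (h x) * (b x * D x + 1 / 2 * σ x ^ 2 * d + σ x ^ 2 * p x * D x +
        (b x * p x + 1 / 2 * σ x ^ 2 * (p x ^ 2 + p')) * k x)) := by
  have hexp := hh.self_of_nhds.exp
  refine ⟨fun y => Real.exp (h y) * p y * k y + Real.exp (h y) * D y, _, ?_,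
    ((hexp.fun_mul hp).fun_mul hk.self_of_nhds).fun_add (hexp.fun_mul hD), by ring⟩
  filter_upwards [hh, hk] with y hhy hky using hhy.exp.fun_mul hky

theorem eventually_hasDerivAt_of_contDiffAt {f : ℝ → ℝ} (hf : ContDiffAt ℝ 2 f x) :
    ∀ᶠ y in 𝓝 x, HasDerivAt f (deriv f y) y := by
  filter_upwards [hf.eventually (by simp)] with y hy
    using (hy.differentiableAt (by simp)).hasDerivAt

theorem hasDerivAt_deriv_of_contDiffAt {f : ℝ → ℝ} (hf : ContDiffAt ℝ 2 f x) :
    HasDerivAt (deriv f) (deriv (deriv f) x) x :=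
  ((hf.derivWithin (m := 1) (by norm_num)).differentiableAt (by simp)).hasDerivAt

variable {μ f : ℝ → ℝ} {κ ℓ : ℝ} (hf : ContDiffAt ℝ 2 f x)
  (hode : 1 / 2 * σ x ^ 2 * deriv f x ^ 2 - generator μ σ f x - κ = 0)
include hf hode

theorem HasGeneratorAt.exp_mul {φ : ℝ → ℝ} (hφ : HasGeneratorAt μ σ φ x ℓ) :
    HasGeneratorAt (tiltedDrift μ σ f) σ (fun y => Real.exp (f y) * φ y) x
      (Real.exp (f x) * (ℓ - κ * φ x)) := by
  obtain ⟨D, d, hφD, hD, rfl⟩ := hφ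
  convert hasGeneratorAt_exp_mul (eventually_hasDerivAt_of_contDiffAt hf)
    (hasDerivAt_deriv_of_contDiffAt hf) hφD hD using 1
  unfold generator at hode
  unfold tiltedDrift
  linear_combination Real.exp (f x) * φ x * hode

theorem HasParabolicAt.exp_mul {u : ℝ → ℝ → ℝ} {t : ℝ} (hu : HasParabolicAt μ σ u t x ℓ) :
    HasParabolicAt (tiltedDrift μ σ f) σ (fun r y => Real.exp (f y) * u r y) t x
      (Real.exp (f x) * (ℓ - κ * u t x)) := by
  obtain ⟨ut, D, d, hut, huD, hD, rfl⟩ := hu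
  obtain ⟨D', d', huD', hD', hℓ⟩ :=
    HasGeneratorAt.exp_mul (φ := u t) hf hode ⟨D, d, huD, hD, rfl⟩
  refine ⟨_, D', d', hut.const_mul _, huD', hD', ?_⟩
  rw [← hℓ]
  ring

end ExponentialTransform

section Source

variable {L T s x : ℝ} {μ σ f g : ℝ → ℝ}

theorem hasDerivAt_payoff_time (T s ξ a c : ℝ) :
    HasDerivAt (fun r => Real.exp (-ξ * (T - r) + a) * c)
      (Real.exp (-ξ * (T - s) + a) * ξ * c) s :=
  (((((hasDerivAt_id' s).const_sub T).const_mul (-ξ)).add_const a).exp.mul_const c).congr_deriv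
    (by ring)

theorem hasGeneratorAt_payoff (b : ℝ → ℝ) (hf : ContDiffAt ℝ 2 f x) (hg : ContDiffAt ℝ 2 g x) :
    HasGeneratorAt b σ (fun y => Real.exp (-y * (T - s) + f y) * g y) x
      (Real.exp (-x * (T - s) + f x) * (b x * deriv g x + 1 / 2 * σ x ^ 2 * deriv (deriv g) x +
        σ x ^ 2 * (-(T - s) + deriv f x) * deriv g x + (b x * (-(T - s) + deriv f x) +
          1 / 2 * σ x ^ 2 * ((-(T - s) + deriv f x) ^ 2 + deriv (deriv f) x)) * g x)) := by
  refine hasGeneratorAt_exp_mul (p := fun y => -(T - s) + deriv f y) ?_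
    ((hasDerivAt_deriv_of_contDiffAt hf).const_add _)
    (eventually_hasDerivAt_of_contDiffAt hg) (hasDerivAt_deriv_of_contDiffAt hg)
  filter_upwards [eventually_hasDerivAt_of_contDiffAt hf] with y hy
  simpa using ((hasDerivAt_id y).neg.mul_const (T - s)).fun_add hy

theorem source_eq (hf : ContDiffAt ℝ 2 f x) (hg : ContDiffAt ℝ 2 g x) :
    source T μ σ f g s x = Real.exp (-x * (T - s) + f x) * x * g x +
      Real.exp (-x * (T - s) + f x) * (tiltedDrift μ σ f x * deriv g x +
        1 / 2 * σ x ^ 2 * deriv (deriv g) x + σ x ^ 2 * (-(T - s) + deriv f x) * deriv g x +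
          (tiltedDrift μ σ f x * (-(T - s) + deriv f x) +
            1 / 2 * σ x ^ 2 * ((-(T - s) + deriv f x) ^ 2 + deriv (deriv f) x)) * g x) := by
  rw [source, (hasGeneratorAt_payoff _ hf hg).generator_eq,
    (hasDerivAt_payoff_time T s x (f x) (g x)).deriv]

theorem hasParabolicAt_payoff (hf : ContDiffAt ℝ 2 f x) (hg : ContDiffAt ℝ 2 g x) :
    HasParabolicAt (tiltedDrift μ σ f) σ (fun r y => Real.exp (-y * (T - r) + f y) * g y) s x
      (source T μ σ f g s x) := by
  obtain ⟨D, d, hD, hd, hℓ⟩ :=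
    hasGeneratorAt_payoff (σ := σ) (T := T) (s := s) (tiltedDrift μ σ f) hf hg
  exact ⟨_, D, d, hasDerivAt_payoff_time T s x (f x) (g x), hD, hd, by rw [source_eq hf hg, hℓ]⟩

theorem continuousOn_source (hμ : ContinuousOn μ (Ioo 0 L)) (hσ : ContinuousOn σ (Ioo 0 L))
    (hf : ContDiffOn ℝ 2 f (Ioo 0 L)) (hg : ContDiffOn ℝ 2 g (Ioo 0 L)) :
    ContinuousOn (fun p : ℝ × ℝ => source T μ σ f g p.1 p.2) (univ ×ˢ Ioo 0 L) := by
  have hlift : ∀ {k : ℝ → ℝ}, ContinuousOn k (Ioo 0 L) →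
      ContinuousOn (fun p : ℝ × ℝ => k p.2) (univ ×ˢ Ioo 0 L) := fun hk =>
    hk.comp continuousOn_snd fun p hp => hp.2
  have hderiv : ∀ {k : ℝ → ℝ}, ContDiffOn ℝ 2 k (Ioo 0 L) →
      ContDiffOn ℝ 1 (deriv k) (Ioo 0 L) := fun hk =>
    hk.deriv_of_isOpen isOpen_Ioo (by norm_num)
  have hμ₂ := hlift hμ
  have hσ₂ := hlift hσ
  have hf₂ := hlift hf.continuousOn
  have hg₂ := hlift hg.continuousOn
  have hf'₂ := hlift (hderiv hf).continuousOn
  have hg'₂ := hlift (hderiv hg).continuousOn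
  have hf''₂ := hlift ((hderiv hf).continuousOn_deriv_of_isOpen isOpen_Ioo le_rfl)
  have hg''₂ := hlift ((hderiv hg).continuousOn_deriv_of_isOpen isOpen_Ioo le_rfl)
  refine ContinuousOn.congr ?_ fun p hp => source_eq
    (hf.contDiffAt (isOpen_Ioo.mem_nhds hp.2)) (hg.contDiffAt (isOpen_Ioo.mem_nhds hp.2))
  have hτ : ContinuousOn (fun p : ℝ × ℝ => -(T - p.1)) (univ ×ˢ Ioo 0 L) := by fun_prop
  have hx : ContinuousOn (fun p : ℝ × ℝ => -p.2 * (T - p.1)) (univ ×ˢ Ioo 0 L) := by fun_prop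
  have hσ₂' := hσ₂.pow 2
  have hdrift := hμ₂.sub (hσ₂'.mul hf'₂)
  have hshift := hτ.add hf'₂
  have hexp := (hx.add hf₂).rexp
  exact ((hexp.mul continuousOn_snd).mul hg₂).add (hexp.mul
    ((((hdrift.mul hg'₂).add ((continuousOn_const.mul hσ₂').mul hg''₂)).add
      ((hσ₂'.mul hshift).mul hg'₂)).add (((hdrift.mul hshift).add
        ((continuousOn_const.mul hσ₂').mul ((hshift.pow 2).add hf''₂))).mul hg₂)))

end Source

/-! ### Lyapunov functions at a natural boundary -/

section NaturalBoundary

/-- Minus the derivative of `e^{-f}` with respect to the scale function normalised at `c`. -/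
def scaleDeriv (μ σ f : ℝ → ℝ) (c x : ℝ) : ℝ :=
  deriv f x * Real.exp (-f x) / scaleDensity μ σ c x

variable {L C c : ℝ} {μ σ f k : ℝ → ℝ}

theorem hasDerivAt_exp_neg_scale {x : ℝ} (c : ℝ) (hf : DifferentiableAt ℝ f x) :
    HasDerivAt (fun y => Real.exp (-f y)) (-(scaleDensity μ σ c x * scaleDeriv μ σ f c x)) x := by
  refine hf.hasDerivAt.fun_neg.exp.congr_deriv ?_
  rw [scaleDeriv, mul_div_cancel₀ _ (scaleDensity_pos μ σ c x).ne', mul_neg, mul_comm]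

variable (hμ : ContinuousOn μ (Ioo 0 L)) (hσ : ContinuousOn σ (Ioo 0 L))
  (hσ0 : ∀ x ∈ Ioo 0 L, σ x ≠ 0) (hf : ContDiffOn ℝ 2 f (Ioo 0 L))
  (hode : ∀ x ∈ Ioo 0 L, 1 / 2 * σ x ^ 2 * deriv f x ^ 2 - generator μ σ f x - k x = 0)

include hμ hσ hσ0 hf

/-- The Riccati equation linearises: `e^{-f}` solves `μ ψ' + ½ σ² ψ'' = k ψ`, written here in scale
and speed coordinates. -/
theorem hasDerivAt_scaleDeriv (hc : c ∈ Ioo 0 L) {x κ : ℝ} (hx : x ∈ Ioo 0 L)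
    (hode : 1 / 2 * σ x ^ 2 * deriv f x ^ 2 - generator μ σ f x - κ = 0) :
    HasDerivAt (scaleDeriv μ σ f c) (-(speedDensity μ σ c x * (κ * Real.exp (-f x)))) x := by
  have hfx := hf.contDiffAt (isOpen_Ioo.mem_nhds hx)
  have hs0 := (scaleDensity_pos μ σ c x).ne'
  have hσx := hσ0 x hx
  refine (((hasDerivAt_deriv_of_contDiffAt hfx).fun_mul
    (eventually_hasDerivAt_of_contDiffAt hfx).self_of_nhds.fun_neg.exp).fun_div
      (hasDerivAt_scaleDensity hμ hσ hσ0 hc hx) hs0).congr_deriv ?_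
  have hm : speedDensity μ σ c x = 2 / (σ x ^ 2 * scaleDensity μ σ c x) := by
    rw [eq_div_iff (by positivity), mul_comm, sq_mul_scaleDensity_mul_speedDensity hσx]
  rw [hm, ← sub_eq_zero.1 hode, generator]
  field_simp
  ring

theorem hasDerivAt_scaleDensity_div_sq (hc : c ∈ Ioo 0 L) {x : ℝ} (hx : x ∈ Ioo 0 L) :
    HasDerivAt (fun y => scaleDensity μ σ c y / Real.exp (-f y) ^ 2)
      (-(2 * tiltedDrift μ σ f x / σ x ^ 2) *
        (scaleDensity μ σ c x / Real.exp (-f x) ^ 2)) x := by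
  have hfx := hf.contDiffAt (isOpen_Ioo.mem_nhds hx)
  have hσx := hσ0 x hx
  refine ((hasDerivAt_scaleDensity hμ hσ hσ0 hc hx).fun_div
    ((eventually_hasDerivAt_of_contDiffAt hfx).self_of_nhds.fun_neg.exp.fun_pow 2)
      (by positivity)).congr_deriv ?_
  unfold tiltedDrift
  field_simp
  ring

include hode

theorem exists_isLyapunov_of_fellerI0_eq_top (acc : Prop) (hc : c ∈ Ioo 0 L)
    (hk : ∀ x ∈ Ioo 0 L, 0 ≤ k x) (hI : fellerI0 μ σ c = ⊤) {K : ℝ}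
    (hK : ∀ᶠ x in 𝓝[>] 0, Real.exp (-f x) ≤ K) :
    ∃ V, IsLyapunov acc L (tiltedDrift μ σ f) σ V ∧
      Tendsto (fun x => V x * Real.exp (-f x)) (𝓝[>] 0) atTop := by
  set v := scalePotential (scaleDensity μ σ c) (speedDensity μ σ c) c
  have hv0 : ∀ x ∈ Ioo 0 L, 0 ≤ v x := fun x hx =>
    scalePotential_nonneg (fun y _ => (scaleDensity_pos μ σ c y).le)
      (fun y _ => speedDensity_nonneg μ σ c y) hc hx
  have hv : Tendsto v (𝓝[>] 0) atTop :=
    tendsto_scalePotential_of_fellerI0_eq_top hμ hσ hσ0 hc hI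
  have hgen : ∀ x ∈ Ioo 0 L, HasGeneratorAt μ σ v x 1 := fun x hx =>
    hasGeneratorAt_scalePotential (fun y hy => hasDerivAt_scaleDensity hμ hσ hσ0 hc hy)
      (continuousOn_speedDensity hμ hσ hσ0 hc) (hσ0 x hx)
      (sq_mul_scaleDensity_mul_speedDensity (hσ0 x hx)) hc hx
  have hVf : Tendsto (fun x => (1 + Real.exp (f x) * (1 + v x)) * Real.exp (-f x))
      (𝓝[>] 0) atTop := by
    refine tendsto_atTop_mono (fun x => ?_) hv
    have hcancel : Real.exp (f x) * Real.exp (-f x) = 1 := by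
      rw [← Real.exp_add, add_neg_cancel, Real.exp_zero]
    linear_combination -(1 + v x) * hcancel + (Real.exp_pos (-f x)).le
  have hK0 : 0 < K := hK.exists.elim fun x hx => (Real.exp_pos _).trans_le hx
  refine ⟨fun x => 1 + Real.exp (f x) * (1 + v x), ⟨fun x hx => ?_, fun x hx => ?_,
    fun _ => ?_⟩, hVf⟩
  · have := hv0 x hx
    exact le_add_of_nonneg_right (by positivity)
  · refine ⟨_, ?_, (((hgen x hx).const_add 1).exp_mul
      (hf.contDiffAt (isOpen_Ioo.mem_nhds hx)) (hode x hx)).const_add 1⟩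
    have hkv := mul_nonneg (hk x hx) (add_nonneg zero_le_one (hv0 x hx))
    nlinarith [Real.exp_pos (f x), hv0 x hx]
  · refine tendsto_atTop_mono' _ ?_ (hVf.atTop_div_const hK0)
    filter_upwards [hK, Ioo_mem_nhdsGT (hc.1.trans hc.2)] with x hxK hx
    have := hv0 x hx
    rw [div_le_iff₀ hK0]
    gcongr

theorem exists_isLyapunov_of_fellerJ0_eq_top (acc : Prop) (hc : c ∈ Ioo 0 L)
    (hk : ∀ x ∈ Ioo 0 L, k x ∈ Icc 0 C) (hJ : fellerJ0 μ σ c = ⊤)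
    (hlim : Tendsto (fun x => Real.exp (-f x)) (𝓝[>] 0) atTop) {z : ℝ} (hz : z ∈ Ioo 0 L)
    (hqz : 0 < scaleDeriv μ σ f c z) :
    ∃ V, IsLyapunov acc L (tiltedDrift μ σ f) σ V ∧
      Tendsto (fun x => V x * Real.exp (-f x)) (𝓝[>] 0) atTop := by
  have hs := continuousOn_scaleDensity hμ hσ hσ0 hc
  have hm := continuousOn_speedDensity hμ hσ hσ0 hc
  have hs0 : ∀ x ∈ Ioo 0 L, 0 ≤ scaleDensity μ σ c x := fun x _ => (scaleDensity_pos μ σ c x).le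
  have hm0 : ∀ x ∈ Ioo 0 L, 0 ≤ speedDensity μ σ c x := fun x _ => speedDensity_nonneg μ σ c x
  have hψ : ∀ x ∈ Ioo 0 L, HasDerivAt (fun y => Real.exp (-f y))
      (-(scaleDensity μ σ c x * scaleDeriv μ σ f c x)) x := fun x hx =>
    hasDerivAt_exp_neg_scale c ((hf.contDiffAt (isOpen_Ioo.mem_nhds hx)).differentiableAt (by simp))
  have hq : ∀ x ∈ Ioo 0 L, HasDerivAt (scaleDeriv μ σ f c)
      (-(speedDensity μ σ c x * (k x * Real.exp (-f x)))) x := fun x hx =>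
    hasDerivAt_scaleDeriv hμ hσ hσ0 hf hc hx (hode x hx)
  have hψ0 : ∀ x ∈ Ioo 0 L, 0 < Real.exp (-f x) := fun x _ => Real.exp_pos _
  set v := scalePotential (fun x => scaleDensity μ σ c x / Real.exp (-f x) ^ 2)
    (fun x => speedDensity μ σ c x * Real.exp (-f x) ^ 2) z
  have hv : Tendsto v (𝓝[>] 0) atTop :=
    tendsto_scalePotential_div_sq hs0 hm0 hm hψ0 hk hψ hq hz hqz hs hlim
      (tendsto_integral_speedDensity_mul_of_fellerJ0_eq_top hμ hσ hσ0 hc hz hψ hqz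
        (fun x hx => right_le_of_hasDerivAt_neg_mul hm0 hψ0 hk hq hz hx) hlim hJ)
  have hv0 : ∀ x ∈ Ioo 0 L, 0 ≤ v x := fun x hx => scalePotential_nonneg
    (fun y hy => div_nonneg (hs0 y hy) (sq_nonneg _))
    (fun y hy => mul_nonneg (hm0 y hy) (sq_nonneg _)) hz hx
  have hgen : ∀ x ∈ Ioo 0 L, HasGeneratorAt (tiltedDrift μ σ f) σ v x 1 := fun x hx =>
    hasGeneratorAt_scalePotential
      (fun y hy => hasDerivAt_scaleDensity_div_sq hμ hσ hσ0 hf hc hy)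
      (hm.mul ((HasDerivAt.continuousOn hψ).pow 2)) (hσ0 x hx)
      (by rw [← sq_mul_scaleDensity_mul_speedDensity (hσ0 x hx)]; field_simp) hz hx
  refine ⟨fun x => 1 + v x, ⟨fun x hx => le_add_of_nonneg_right (hv0 x hx), fun x hx =>
    ⟨1, le_add_of_nonneg_right (hv0 x hx), (hgen x hx).const_add 1⟩, fun _ =>
    tendsto_atTop_add_const_left _ _ hv⟩, ?_⟩
  refine tendsto_atTop_mono' _ ?_ hlim
  filter_upwards [Ioo_mem_nhdsGT (hc.1.trans hc.2)] with x hx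
  exact le_mul_of_one_le_left (hψ0 x hx).le (le_add_of_nonneg_right (hv0 x hx))

theorem exists_isLyapunov_of_zeroIsNatural (acc : Prop) (hL : 0 < L)
    (hk : ∀ x ∈ Ioo 0 L, k x ∈ Icc 0 C) (hnat : ZeroIsNatural μ σ L) :
    ∃ V, IsLyapunov acc L (tiltedDrift μ σ f) σ V ∧
      Tendsto (fun x => V x * Real.exp (-f x)) (𝓝[>] 0) atTop := by
  have hc : L / 2 ∈ Ioo 0 L := ⟨half_pos hL, half_lt_self hL⟩
  have hψ : ∀ x ∈ Ioo 0 L, HasDerivAt (fun y => Real.exp (-f y))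
      (-(scaleDensity μ σ (L / 2) x * scaleDeriv μ σ f (L / 2) x)) x := fun x hx =>
    hasDerivAt_exp_neg_scale _ ((hf.contDiffAt (isOpen_Ioo.mem_nhds hx)).differentiableAt (by simp))
  rcases eventually_le_or_tendsto_atTop (fun x _ => (scaleDensity_pos μ σ (L / 2) x).le)
    (fun x _ => speedDensity_nonneg μ σ (L / 2) x) (fun x _ => Real.exp_pos _) hk hψ
    (fun x hx => hasDerivAt_scaleDeriv hμ hσ hσ0 hf hc hx (hode x hx)) hL
    with ⟨K, hK⟩ | ⟨hlim, z, hz, hqz⟩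
  · exact exists_isLyapunov_of_fellerI0_eq_top hμ hσ hσ0 hf hode acc hc
      (fun x hx => (hk x hx).1) hnat.1 hK
  · exact exists_isLyapunov_of_fellerJ0_eq_top hμ hσ hσ0 hf hode acc hc hk hnat.2 hlim hz hqz

end NaturalBoundary

/-! ### The representation formula -/

/-- The price minus the discounted payoff, multiplied by `e^f`. This is the unknown to which the
representation formula for the tilted operator applies. -/
def excess (T : ℝ) (f g : ℝ → ℝ) (u : ℝ → ℝ → ℝ) (t x : ℝ) : ℝ :=
  Real.exp (f x) * u t x - Real.exp (-x * (T - t) + f x) * g x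

theorem excess_eq (T : ℝ) (f g : ℝ → ℝ) (u : ℝ → ℝ → ℝ) (t x : ℝ) :
    excess T f g u t x = Real.exp (f x) * (u t x - Real.exp (-x * (T - t)) * g x) := by
  rw [excess, Real.exp_add]
  ring

theorem HasParabolicAt.excess {T t x : ℝ} {μ σ f g : ℝ → ℝ} {u : ℝ → ℝ → ℝ}
    (hu : HasParabolicAt μ σ u t x (x * u t x)) (hf : ContDiffAt ℝ 2 f x)
    (hg : ContDiffAt ℝ 2 g x)
    (hode : 1 / 2 * σ x ^ 2 * deriv f x ^ 2 - generator μ σ f x - x = 0) :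
    HasParabolicAt (tiltedDrift μ σ f) σ (excess T f g u) t x (-source T μ σ f g t x) := by
  have h := (hu.exp_mul hf hode).sub (hasParabolicAt_payoff (T := T) (μ := μ) (σ := σ) hf hg)
  rwa [sub_self, mul_zero, zero_sub] at h

namespace IsClassicalSolution

variable {acc : Prop} {L T : ℝ} {μ σ k f g β0 βL V : ℝ → ℝ} {u : ℝ → ℝ → ℝ}

theorem continuousOn_sub_discount (hu : IsClassicalSolution acc L T μ σ k g β0 βL u) :
    ContinuousOn (fun p : ℝ × ℝ => u p.1 p.2 - Real.exp (-p.2 * (T - p.1)) * g p.2)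
      (Icc 0 T ×ˢ Icc 0 L) := by
  have hterm : ContinuousOn (fun p : ℝ × ℝ => u T p.2) (Icc 0 T ×ˢ Icc 0 L) :=
    hu.continuousOn.comp (f := fun p : ℝ × ℝ => (T, p.2)) (by fun_prop)
      fun p hp => ⟨right_mem_Icc.2 (hp.1.1.trans hp.1.2), hp.2⟩
  have hexp : ContinuousOn (fun p : ℝ × ℝ => Real.exp (-p.2 * (T - p.1)))
      (Icc 0 T ×ˢ Icc 0 L) := by fun_prop
  refine (hu.continuousOn.sub (hexp.mul hterm)).congr fun p hp => ?_
  simp only [Pi.sub_apply, Pi.mul_apply, hu.terminal p.2 hp.2]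

theorem continuousOn_excess (hu : IsClassicalSolution acc L T μ σ k g β0 βL u)
    (hf : ContinuousOn f (Ioo 0 L)) :
    ContinuousOn (fun p : ℝ × ℝ => excess T f g u p.1 p.2) (Icc 0 T ×ˢ Ioo 0 L) := by
  have hexp : ContinuousOn (fun p : ℝ × ℝ => Real.exp (f p.2)) (Icc 0 T ×ˢ Ioo 0 L) :=
    (hf.comp continuousOn_snd fun p hp => hp.2).rexp
  exact (hexp.mul (hu.continuousOn_sub_discount.mono
    (prod_mono_right Ioo_subset_Icc_self))).congr fun p _ => excess_eq T f g u p.1 p.2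

theorem excess_terminal (hu : IsClassicalSolution acc L T μ σ k g β0 βL u) {x : ℝ}
    (hx : x ∈ Icc 0 L) : excess T f g u T x = 0 := by
  simp [excess_eq, hu.terminal x hx]

theorem isLittleO_excess
    (hu : IsClassicalSolution acc L T μ σ k g (fun _ => g 0)
      (fun t => Real.exp (-L * (T - t)) * g L) u)
    (hL : 0 < L) (hf : ContinuousOn f (Ioc 0 L)) (hf0 : acc → ContinuousOn f (Icc 0 L))
    (hV : ∀ x ∈ Ioo 0 L, 1 ≤ V x)
    (hacc : ¬acc → Tendsto (fun x => V x * Real.exp (-f x)) (𝓝[>] 0) atTop) :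
    (fun p : ℝ × ℝ => excess T f g u p.1 p.2) =o[lateralBoundary L T] fun p => V p.2 := by
  simp only [excess_eq]
  exact isLittleO_exp_mul (d := fun t x => u t x - Real.exp (-x * (T - t)) * g x) hL
    hu.continuousOn_sub_discount (fun h t ht => by simp [hu.bc_zero h t ht])
    (fun t ht => by simp [hu.bc_right t ht]) hf hf0 hV hacc

end IsClassicalSolution

theorem integral_eq_zero_of_kernel_eq_zero {L T t x : ℝ} {Γ : ℝ → ℝ → ℝ → ℝ → ℝ} {F : ℝ → ℝ → ℝ}
    (hL : 0 ≤ L) (htT : t ≤ T) (hΓ : ∀ s ∈ Ioc t T, ∀ y ∈ Ioo 0 L, Γ t x s y = 0) :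
    ∫ s in t..T, ∫ y in 0..L, Γ t x s y * F s y = 0 := by
  rw [intervalIntegral.integral_of_le htT]
  refine setIntegral_eq_zero_of_forall_eq_zero fun s hs => ?_
  rw [intervalIntegral.integral_of_le hL, integral_Ioc_eq_integral_Ioo]
  exact setIntegral_eq_zero_of_forall_eq_zero fun y hy => by rw [hΓ s hs y hy, zero_mul]

theorem exists_isLyapunov {acc : Prop} {L : ℝ} {μ σ f : ℝ → ℝ} (hL : 0 < L)
    (hμ : ContinuousOn μ (Ioo 0 L)) (hσ : ContinuousOn σ (Ioo 0 L))
    (hσ0 : ∀ x ∈ Ioo 0 L, σ x ≠ 0) (hnat : ¬acc → ZeroIsNatural μ σ L)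
    (hf : ContDiffOn ℝ 2 f (Ioo 0 L))
    (hode : ∀ x ∈ Ioo 0 L, 1 / 2 * σ x ^ 2 * deriv f x ^ 2 - generator μ σ f x - x = 0) :
    ∃ V, IsLyapunov acc L (tiltedDrift μ σ f) σ V ∧
      (¬acc → Tendsto (fun x => V x * Real.exp (-f x)) (𝓝[>] 0) atTop) := by
  by_cases hacc : acc
  · exact ⟨_, isLyapunov_one hacc L _ σ, fun h => absurd hacc h⟩
  · obtain ⟨V, hV, hVf⟩ := exists_isLyapunov_of_zeroIsNatural (k := id) hμ hσ hσ0 hf hode acc hL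
      (fun x hx => Ioo_subset_Icc_self hx) (hnat hacc)
    exact ⟨V, hV, fun _ => hVf⟩

end ShortRate

end

theorem mainTheorem1_general (L T : ℝ)
    (μ σ : ℝ → ℝ) (hμ : ContinuousOn μ (Set.Ioo 0 L)) (hσ : ContinuousOn σ (Set.Ioo 0 L))
    (hσ0 : ∀ x ∈ Set.Ioo 0 L, σ x ≠ 0)
    (acc : Prop) (hnat : ¬acc → ShortRate.ZeroIsNatural μ σ L)
    (g : ℝ → ℝ) (hg : ContDiffOn ℝ 2 g (Set.Ioo 0 L))
    (u : ℝ → ℝ → ℝ)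
    (hu : ShortRate.IsClassicalSolution acc L T μ σ (fun x => x) g (fun _ => g 0)
      (fun t => Real.exp (-L * (T - t)) * g L) u)
    (f : ℝ → ℝ) (hf : ContDiffOn ℝ 2 f (Set.Ioo 0 L))
    (hfL : ContinuousOn f (Set.Ioc 0 L)) (hf0 : acc → ContinuousOn f (Set.Icc 0 L))
    (hode : ∀ x ∈ Set.Ioo 0 L,
      1 / 2 * σ x ^ 2 * (deriv f x) ^ 2 - ShortRate.generator μ σ f x - x = 0)
    (Γ : ℝ → ℝ → ℝ → ℝ → ℝ)
    (hΓ : ShortRate.IsFundamentalSolution acc L T (ShortRate.tiltedDrift μ σ f) σ Γ)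
    (t : ℝ) (ht : t ∈ Set.Icc 0 T) (x : ℝ) (hx : x ∈ Set.Icc 0 L) (hx0 : x = 0 → acc)
    (hint : MeasureTheory.IntegrableOn
      (fun p : ℝ × ℝ => Γ t x p.1 p.2 * ShortRate.source T μ σ f g p.1 p.2)
      (Set.Ioo t T ×ˢ Set.Ioo 0 L)) :
    u t x = Real.exp (-x * (T - t)) * g x +
      Real.exp (-f x) * ∫ s in t..T, ∫ ξ in 0..L,
        Γ t x s ξ * ShortRate.source T μ σ f g s ξ := by
  have hL0 := hx.1.trans hx.2
  rcases eq_or_ne x L with rfl | hxL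
  · rw [ShortRate.integral_eq_zero_of_kernel_eq_zero hL0 ht.2 fun s hs y hy =>
      hΓ.bc_right s ⟨ht.1.trans_lt hs.1, hs.2⟩ y hy t ⟨ht.1, hs.1⟩, mul_zero, add_zero,
      hu.bc_right t ht]
  rcases eq_or_ne x 0 with rfl | hx_ne
  · rw [ShortRate.integral_eq_zero_of_kernel_eq_zero hL0 ht.2 fun s hs y hy =>
      hΓ.bc_zero (hx0 rfl) s ⟨ht.1.trans_lt hs.1, hs.2⟩ y hy t ⟨ht.1, hs.1⟩,
      hu.bc_zero (hx0 rfl) t ht]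
    simp
  rcases eq_or_ne t T with rfl | htT
  · simp [hu.terminal x hx]
  have hxI : x ∈ Set.Ioo 0 L := ⟨hx.1.lt_of_ne' hx_ne, hx.2.lt_of_ne hxL⟩
  have hL : 0 < L := hxI.1.trans hxI.2
  obtain ⟨V, hV, hVf⟩ := ShortRate.exists_isLyapunov hL hμ hσ hσ0 hnat hf hode
  have hrep := hΓ.eq_integral hV (hu.continuousOn_excess hf.continuousOn)
    (fun s hs y hy => (hu.solves.hasParabolicAt hs hy).excess
      (hf.contDiffAt (isOpen_Ioo.mem_nhds hy)) (hg.contDiffAt (isOpen_Ioo.mem_nhds hy))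
      (hode y hy))
    (fun y hy => hu.excess_terminal (Set.Ioo_subset_Icc_self hy))
    (hu.isLittleO_excess hL hfL hf0 hV.one_le hVf)
    (ShortRate.continuousOn_source hμ hσ hf hg) ⟨ht.1, ht.2.lt_of_ne htT⟩ hxI hint
  rw [← hrep, ShortRate.excess_eq, ← mul_assoc, ← Real.exp_add, neg_add_cancel, Real.exp_zero,
    one_mul, add_sub_cancel]

theorem mainTheorem1 (L T : ℝ) (hL : 0 < L) (hT : 0 < T)
    (μ σ : ℝ → ℝ) (hμ : ContinuousOn μ (Set.Ioo 0 L)) (hσ : ContinuousOn σ (Set.Ioo 0 L))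
    (hσpos : ∀ x ∈ Set.Ioo 0 L, 0 < σ x)
    (hzero : ShortRate.ZeroIsRegular μ σ L ∨ ShortRate.ZeroIsExit μ σ L ∨
      ShortRate.ZeroIsNatural μ σ L)
    (hright : ShortRate.RightIsRegular μ σ L)
    -- the payoff and the price
    (g : ℝ → ℝ) (hg : ContDiffOn ℝ 2 g (Set.Ioo 0 L))
    (u : ℝ → ℝ → ℝ) (hu : ShortRate.SolvesPricingProblem L T μ σ g u)
    -- the solution of the nonlinear ODE, finite at the accessible endpoints
    (f : ℝ → ℝ) (hf : ContDiffOn ℝ 2 f (Set.Ioo 0 L))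
    (hfL : ContinuousOn f (Set.Ioc 0 L))
    (hf0 : ShortRate.ZeroIsRegular μ σ L ∨ ShortRate.ZeroIsExit μ σ L →
      ContinuousOn f (Set.Icc 0 L))
    (hode : ∀ x ∈ Set.Ioo 0 L,
      1 / 2 * σ x ^ 2 * (deriv f x) ^ 2 - ShortRate.generator μ σ f x - x = 0)
    -- the fundamental solution
    (Γ : ℝ → ℝ → ℝ → ℝ → ℝ)
    (hΓ : ShortRate.IsFundamentalSolution
      (ShortRate.ZeroIsRegular μ σ L ∨ ShortRate.ZeroIsExit μ σ L) L T
      (ShortRate.tiltedDrift μ σ f) σ Γ)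
    (t : ℝ) (ht : t ∈ Set.Icc 0 T) (x : ℝ) (hx : x ∈ Set.Icc 0 L)
    (hx0 : x = 0 → ShortRate.ZeroIsRegular μ σ L ∨ ShortRate.ZeroIsExit μ σ L)
    -- the double integral converges absolutely
    (hint : MeasureTheory.IntegrableOn
      (fun p : ℝ × ℝ => Γ t x p.1 p.2 * ShortRate.source T μ σ f g p.1 p.2)
      (Set.Ioo t T ×ˢ Set.Ioo 0 L)) :
    u t x = Real.exp (-x * (T - t)) * g x +
      Real.exp (-f x) * ∫ s in t..T, ∫ ξ in 0..L,
        Γ t x s ξ * ShortRate.source T μ σ f g s ξ :=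
  mainTheorem1_general L T μ σ hμ hσ (fun x hx => (hσpos x hx).ne') _ (fun h => by tauto)
    g hg u hu f hf hfL hf0 hode Γ hΓ t ht x hx hx0 hint
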